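/- Let $\omega>0$. For $R>0$ let $C_R=\{x\in\mathbb R^2:|x|=R\}$, $D_+=\{|x|<R\}$, $D_-=\{|x|>R\}$, and let $H_{\omega,C_R}$ be the self-adjoint operator in $L^2(\mathbb R^2)$ (the Schrödinger operator with $\delta'$-interaction of strength $\omega$ on $C_R$) that the first representation theorem associates with the quadratic form $$\mathfrak h[u]=\|\nabla u_+\|^2_{L^2(D_+)}+\|\nabla u_-\|^2_{L^2(D_-)}-\omega\,\big\|u_+|_{C_R}-u_-|_{C_R}\big\|^2_{L^2(C_R)},\qquad \operatorname{dom}\mathfrak h=H^1(D_+)\oplus H^1(D_-),$$ where $u_\pm=u|_{D_\pm}$ and $u_\pm|_{C_R}$ are the traces on $C_R$. Let $\lambda_1^\omega(C_R)=\inf\sigma(H_{\omega,C_R})$ be its spectral threshold, and let $I_\nu,K_\nu$ be the modified Bessel functions of the first and second kind. Then for every $R>0$ the number $\lambda_1^\omega(C_R)$ is the lowest eigenvalue of $H_{\omega,C_R}$ and is negative; write $\lambda_1^\omega(C_R)=-k^2$ with $k=k(R)>0$. The following hold. (i) For every $R>0$, $k$ is the unique positive solution of the equation $k^2R\,I_1(kR)K_1(kR)=\omega$.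 (ii) The function $(0,\infty)\ni R\mapsto\lambda_1^\omega(C_R)$ is continuous and strictly increasing, and $$\lim_{R\to0^+}\lambda_1^\omega(C_R)=-\infty,\qquad \lim_{R\to\infty}\lambda_1^\omega(C_R)=-4\omega^2.$$ (iii) For every $R>0$, the eigenfunctions of $H_{\omega,C_R}$ for the eigenvalue $\lambda_1^\omega(C_R)$ are exactly the nonzero complex multiples of the radial function (with $r=|x|$) $$u_1(x)=\begin{cases}K_1(kR)\,I_0(kr),& r<R,\\ -I_1(kR)\,K_0(kr),& r>R.\end{cases}$$ -/

import Mathlib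

open MeasureTheory Filter Topology Set

noncomputable section

namespace DeltaPrime

/-! Modified Bessel functions -/

/-- The modified Bessel function of the first kind `I_n`, of integer order `n ≥ 0`:
`I_n(x) = ∑ₘ (x/2)^(2m+n) / (m! (m+n)!)`. -/
def besselI (n : ℕ) (x : ℝ) : ℝ :=
  ∑' m : ℕ, (x / 2) ^ (2 * m + n) / ((m.factorial : ℝ) * ((m + n).factorial : ℝ))

/-- The modified Bessel function of the second kind (Macdonald function) `K_n`, of integer order
`n ≥ 0`, for `x > 0`: `K_n(x) = ∫₀^∞ exp(-x cosh t) cosh(n t) dt`. -/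
def besselK (n : ℕ) (x : ℝ) : ℝ :=
  ∫ t in Ioi (0 : ℝ), Real.exp (-x * Real.cosh t) * Real.cosh (n * t)

/-! The Sobolev space `H¹(Ω)` and traces -/

/-- The Euclidean plane `ℝ²`. -/
abbrev Plane := EuclideanSpace ℝ (Fin 2)

/-- The complex Hilbert space `L²(ℝ²)`. -/
abbrev L2Plane := Lp ℂ 2 (volume : Measure Plane)

/-- The classical partial derivative `∂ᵢ φ`. -/
def pderiv {F : Type*} [NormedAddCommGroup F] [NormedSpace ℝ F]
    (i : Fin 2) (φ : Plane → F) (x : Plane) : F :=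
  fderiv ℝ φ x (EuclideanSpace.single i (1 : ℝ))

/-- `G = (G₀, G₁)` is a square-integrable weak gradient of `u` on the open set `Ω`. -/
def HasWeakGrad (Ω : Set Plane) (u : Plane → ℂ) (G : Fin 2 → Plane → ℂ) : Prop :=
  ∀ i, MemLp (G i) 2 (volume.restrict Ω) ∧
    ∀ φ : Plane → ℝ, ContDiff ℝ (⊤ : ℕ∞) φ → HasCompactSupport φ → tsupport φ ⊆ Ω →
      ∫ x in Ω, pderiv i φ x • u x = -∫ x in Ω, φ x • G i x

/-- Membership of (the restriction to `Ω` of) `u` in the Sobolev space `H¹(Ω)`. -/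
def MemH1 (Ω : Set Plane) (u : Plane → ℂ) : Prop :=
  MemLp u 2 (volume.restrict Ω) ∧ ∃ G, HasWeakGrad Ω u G

open Classical in
/-- The weak gradient of `u ∈ H¹(Ω)` (unique up to a null set of `Ω`; zero if `u ∉ H¹(Ω)`). -/
def weakGrad (Ω : Set Plane) (u : Plane → ℂ) : Fin 2 → Plane → ℂ :=
  if h : ∃ G, HasWeakGrad Ω u G then h.choose else 0

/-- `g ∈ L²(Σ)` is the trace on `Σ` of `u ∈ H¹(Ω)`, where `σ` is the arc-length measure of
`Σ = ∂Ω`: the trace map is the continuous extension of `φ ↦ φ|_Σ` from (restrictions to `Ω` of)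
smooth compactly supported functions `φ` on `ℝ²` to `H¹(Ω)`. -/
def IsTrace (Ω : Set Plane) (σ : Measure Plane) (u g : Plane → ℂ) : Prop :=
  MemLp g 2 σ ∧ ∃ φ : ℕ → Plane → ℂ,
    (∀ n, ContDiff ℝ (⊤ : ℕ∞) (φ n) ∧ HasCompactSupport (φ n)) ∧
    Tendsto (fun n => eLpNorm (fun x => φ n x - u x) 2 (volume.restrict Ω)) atTop (𝓝 0) ∧
    (∀ i, Tendsto (fun n => eLpNorm (fun x => pderiv i (φ n) x - weakGrad Ω u i x) 2
      (volume.restrict Ω)) atTop (𝓝 0)) ∧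
    Tendsto (fun n => eLpNorm (fun x => φ n x - g x) 2 σ) atTop (𝓝 0)

open Classical in
/-- The trace `u|_Σ` of `u ∈ H¹(Ω)`. By the trace theorem it exists and is unique `σ`-almost
everywhere when `Ω` is a disk or the exterior of a disk, and `σ` is arc length on the boundary. -/
def trace (Ω : Set Plane) (σ : Measure Plane) (u : Plane → ℂ) : Plane → ℂ :=
  if h : ∃ g, IsTrace Ω σ u g then h.choose else 0

/-! The quadratic form, the operator, and its spectrum -/

/-- The open disk `{|x| < R}`. -/
def disk (R : ℝ) : Set Plane := {x | ‖x‖ < R}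

/-- The exterior `{|x| > R}` of the disk. -/
def exterior (R : ℝ) : Set Plane := {x | R < ‖x‖}

/-- The arc-length measure of the circle of radius `R` centred at the origin, as a measure on the
plane: the image of `R dθ` on `(0, 2π]` under `θ ↦ (R cos θ, R sin θ)`. -/
def arcLength (R : ℝ) : Measure Plane :=
  ENNReal.ofReal R • Measure.map (fun θ : ℝ => (!₂[R * Real.cos θ, R * Real.sin θ] : Plane))
    (volume.restrict (Ioc 0 (2 * Real.pi)))

/-- The form domain `H¹(ℝ² ∖ C_R) = H¹(disk) ⊕ H¹(exterior)`, a set of elements of `L²(ℝ²)`. -/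
def formDomain (R : ℝ) : Set L2Plane :=
  {u | MemH1 (disk R) u ∧ MemH1 (exterior R) u}

/-- The jump `[u] = u₊|_Σ - u₋|_Σ` of the traces across the circle of radius `R`. -/
def jump (R : ℝ) (u : Plane → ℂ) (x : Plane) : ℂ :=
  trace (disk R) (arcLength R) u x - trace (exterior R) (arcLength R) u x

/-- The Dirichlet form `∫_Ω ∇u · conj ∇v`. -/
def dirichlet (Ω : Set Plane) (u v : Plane → ℂ) : ℂ :=
  ∑ i : Fin 2, ∫ x in Ω, weakGrad Ω u i x * starRingEnd ℂ (weakGrad Ω v i x)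

/-- The sesquilinear form whose quadratic form is
`u ↦ ‖∇u‖²_{L²(ℝ² ∖ C_R)} - ω ‖[u]‖²_{L²(C_R)}`. -/
def form (ω R : ℝ) (u v : Plane → ℂ) : ℂ :=
  dirichlet (disk R) u v + dirichlet (exterior R) u v
    - (ω : ℂ) * ∫ x, jump R u x * starRingEnd ℂ (jump R v x) ∂arcLength R

/-- The graph of the operator `H` that the first representation theorem associates with the form:
`u ∈ dom H` and `H u = f`, that is, `u` is in the form domain and `form u v = ⟨f, v⟩` for all `v`
in the form domain. -/
def OpEq (ω R : ℝ) (u f : L2Plane) : Prop :=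
  u ∈ formDomain R ∧
    ∀ v ∈ formDomain R, form ω R u v = ∫ x, f x * starRingEnd ℂ (v x)

/-- `z` is in the resolvent set of `H`: `H - z` has a bounded, everywhere defined inverse `T`. -/
def InResolventSet (ω R : ℝ) (z : ℂ) : Prop :=
  ∃ T : L2Plane →L[ℂ] L2Plane, ∀ u f : L2Plane, OpEq ω R u (z • u + f) ↔ u = T f

/-- The spectrum of `H`. -/
def opSpectrum (ω R : ℝ) : Set ℂ := {z | ¬ InResolventSet ω R z}

/-- `u` is an eigenfunction of `H` for the real eigenvalue `t`. -/
def IsEigenfunction (ω R : ℝ) (t : ℝ) (u : L2Plane) : Prop :=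
  u ≠ 0 ∧ OpEq ω R u ((t : ℂ) • u)

/-- The spectral threshold `λ₁^ω(C_R) = inf σ(H)`. -/
def lambda1 (ω R : ℝ) : ℝ := sInf {t : ℝ | (t : ℂ) ∈ opSpectrum ω R}

/-- The radial function equal to `K₁(kR) I₀(kr)` for `r < R` and `-I₁(kR) K₀(kr)` for `r > R`. -/
def groundState (k R : ℝ) (x : Plane) : ℝ :=
  if ‖x‖ < R then besselK 1 (k * R) * besselI 0 (k * ‖x‖)
  else -(besselI 1 (k * R) * besselK 0 (k * ‖x‖))

end DeltaPrime

end

/-!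
The lower bound for the operator comes from writing the energy as a sum of squares. Let `κ > 0`. The
positive radial solutions `w` of `Δw = κ² w`, namely `I₀(κr)` on the disk and `K₀(κr)` on its
exterior, have logarithmic gradients `X = ∇w / w` that satisfy the Riccati equation
`div X + |X|² = κ²`. Integrating `div (|u|² X)` gives on each side of the circle **Green's identity**
(`IsRiccatiField.green`)

  `∫ |∇u|² + κ² ∫ |u|² = ∫ |∇u - X u|² + c ∫_{C_R} |u|²`,

where `c > 0` is the outward normal component of `X` on the circle. The two boundary terms
`c |u₊|² + d |u₋|²` are, by the Cauchy–Schwarz inequality with its exact defect, equal to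
`(1/c + 1/d)⁻¹ |u₊ - u₋|²` plus a multiple of `|c u₊ + d u₋|²`, and the Wronskian relation
`I₀ K₁ + I₁ K₀ = 1/x` gives `(1/c + 1/d)⁻¹ = κ F(κR)` with `F(x) = x I₁(x) K₁(x)` (`secular`). This is
`energy_identity`; dropping squares, it yields the sharp inequality `jump_le`:

  `κ F(κR) ‖u₊ - u₋‖² ≤ ‖∇u‖² + κ² ‖u‖²`.

If `κ F(κR) > ω`, the form plus `κ²` is therefore coercive on `H¹(ℝ² ∖ C_R)`, and the Lax–Milgram
theorem provides the resolvent at `-κ²` (`inResolventSet_of_lt`). If `k F(kR) = ω`, an eigenfunction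
for `-k²` has equality in `jump_le`, so that all the squares vanish. Then `∇u = X u` on both sides,
`u / w` has vanishing gradient and is constant on each side, and the last square fixes the ratio of
the two constants: `u` is a multiple of the radial function (`eq_mul_groundState_of_opEq`).
Conversely, Green's identity shows that these multiples solve the eigenvalue equation
(`opEq_of_groundState`). Hence the threshold is `-k²`, where `k F(kR) = ω` (`lambda1_eq`).

The rest is monotonicity: `F` increases strictly from `0` to `1/2` (`strictMonoOn_secular`,
`tendsto_secular_zero`, `tendsto_secular_atTop`). Indeed `F' = F (a - b)` and `F (a + b) = 1`, where
`a` and `-b` are the logarithmic derivatives of `√x I₁` and `√x K₁`. Both functions solve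
`p'' = Q p` with the decreasing `Q = 1 + 3/(4x²)`, which forces `b² < Q < a²`
(`besselI_ratio_bound`, `besselK_ratio_bound`). So the root `k` of `k F(kR) = ω` is unique, depends
continuously on `R`, decreases strictly, and tends to `∞` as `R → 0` and to `2ω` as `R → ∞`.

The traces need two facts. Smooth functions are dense in `H¹` of the disk and of the exterior, by a
dilation of the domain into itself followed by mollification (`exists_smooth_approx`). Green's
identity for smooth functions bounds the boundary values by the `H¹` norm, which gives existence
(`IsTraceDomain.exists_trace`); uniqueness is `SobolevData.trace_unique`.
-/

open scoped ENNReal Convolution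

noncomputable section

namespace DeltaPrime

/-! ### Modified Bessel functions of the first kind -/

theorem summable_besselI_bound (n : ℕ) (y : ℝ) :
    Summable fun m : ℕ => |y| ^ (2 * m + n) / (m.factorial : ℝ) := by
  have := (Real.summable_pow_div_factorial (|y| ^ 2)).mul_left (|y| ^ n)
  refine this.congr fun m => ?_
  rw [pow_add, pow_mul]
  ring

theorem norm_besselI_term_le (n m : ℕ) {x B : ℝ} (hx : |x| ≤ B) :
    ‖(x / 2) ^ (2 * m + n) / ((m.factorial : ℝ) * ((m + n).factorial : ℝ))‖
      ≤ |B| ^ (2 * m + n) / (m.factorial : ℝ) := by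
  have h1 : (1 : ℝ) ≤ ((m + n).factorial : ℝ) := by exact_mod_cast Nat.succ_le_of_lt (Nat.factorial_pos _)
  have h2 : (0 : ℝ) < (m.factorial : ℝ) := by exact_mod_cast Nat.factorial_pos _
  rw [norm_div, norm_pow, Real.norm_eq_abs, Real.norm_eq_abs, abs_of_pos (by positivity : (0:ℝ) < _ * _)]
  have h3 : |x / 2| ≤ |B| := by
    rw [abs_div, abs_two]
    have := abs_nonneg x
    have := le_abs_self B
    linarith
  gcongr
  nlinarith

theorem summable_besselI (n : ℕ) (x : ℝ) :
    Summable fun m : ℕ => (x / 2) ^ (2 * m + n) / ((m.factorial : ℝ) * ((m + n).factorial : ℝ)) :=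
  Summable.of_norm_bounded (summable_besselI_bound n |x|) fun m => by
    simpa using norm_besselI_term_le n m (le_refl |x|)

theorem besselI_pos {x : ℝ} (hx : 0 < x) (n : ℕ) : 0 < besselI n x :=
  (summable_besselI n x).tsum_pos (fun m => by positivity) 0 (by positivity)

theorem besselI_zero_zero : besselI 0 0 = 1 := by
  unfold besselI
  rw [tsum_eq_single 0]
  · simp
  · intro m hm
    simp [hm]

theorem besselI_one_zero : besselI 1 0 = 0 := by
  unfold besselI
  simp

theorem one_le_besselI_zero (x : ℝ) : 1 ≤ besselI 0 x := by
  have := (summable_besselI 0 x).le_tsum 0 (fun m _ => by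
    have : 0 ≤ (x / 2) ^ (2 * m + 0) := by rw [add_zero, pow_mul]; positivity
    positivity)
  simpa [besselI] using this

theorem besselI_zero_pos (x : ℝ) : 0 < besselI 0 x := zero_lt_one.trans_le (one_le_besselI_zero x)

theorem hasDerivAt_besselI_zero (x : ℝ) : HasDerivAt (besselI 0) (besselI 1 x) x := by
  have hB : x ∈ Ioo (-(|x| + 1)) (|x| + 1) := by
    constructor <;> [have := neg_abs_le x; have := le_abs_self x] <;> linarith
  have key := hasDerivAt_tsum_of_isPreconnected (summable_besselI_bound 1 (|x| + 1))
    (t := Ioo (-(|x| + 1)) (|x| + 1))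
    (g := fun (m : ℕ) (y : ℝ) =>
      (y / 2) ^ (2 * (m + 1) + 0) / (((m + 1).factorial : ℝ) * ((m + 1 + 0).factorial : ℝ)))
    (g' := fun (m : ℕ) (y : ℝ) =>
      (y / 2) ^ (2 * m + 1) / ((m.factorial : ℝ) * ((m + 1).factorial : ℝ)))
    isOpen_Ioo isPreconnected_Ioo (fun m y _ => ?_) (fun m y hy => ?_) hB
    ((summable_nat_add_iff 1).2 (summable_besselI 0 x)) hB
  · have h0 : besselI 0 = fun y => 1 + ∑' m : ℕ,
        (y / 2) ^ (2 * (m + 1) + 0) / (((m + 1).factorial : ℝ) * ((m + 1 + 0).factorial : ℝ)) := by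
      funext y
      unfold besselI
      rw [(summable_besselI 0 y).tsum_eq_zero_add]
      simp
    rw [h0]
    exact key.const_add 1
  · have h := (((hasDerivAt_id y).div_const 2).pow (2 * (m + 1) + 0)).div_const
      (((m + 1).factorial : ℝ) * ((m + 1 + 0).factorial : ℝ))
    refine h.congr_deriv ?_
    have h2 : (m.factorial : ℝ) ≠ 0 := by exact_mod_cast (Nat.factorial_pos _).ne'
    simp only [add_zero, id, Nat.factorial_succ, Nat.cast_mul, Nat.cast_add, Nat.cast_one]
    rw [show 2 * (m + 1) - 1 = 2 * m + 1 by omega]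
    push_cast
    field_simp
  · exact norm_besselI_term_le 1 m (abs_le.2 ⟨hy.1.le, hy.2.le⟩)

theorem hasDerivAt_mul_besselI_one (x : ℝ) :
    HasDerivAt (fun y => y * besselI 1 y) (x * besselI 0 x) x := by
  have hB : x ∈ Ioo (-(|x| + 1)) (|x| + 1) := by
    constructor <;> [have := neg_abs_le x; have := le_abs_self x] <;> linarith
  have key := hasDerivAt_tsum_of_isPreconnected
    ((summable_besselI_bound 0 (|x| + 1)).mul_left (|x| + 1))
    (t := Ioo (-(|x| + 1)) (|x| + 1))
    (g := fun (m : ℕ) (y : ℝ) =>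
      y * ((y / 2) ^ (2 * m + 1) / ((m.factorial : ℝ) * ((m + 1).factorial : ℝ))))
    (g' := fun (m : ℕ) (y : ℝ) =>
      y * ((y / 2) ^ (2 * m + 0) / ((m.factorial : ℝ) * ((m + 0).factorial : ℝ))))
    isOpen_Ioo isPreconnected_Ioo (fun m y _ => ?_) (fun m y hy => ?_) hB
    ((summable_besselI 1 x).mul_left x) hB
  · have h0 : (fun y => y * besselI 1 y) = fun y => ∑' m : ℕ,
        y * ((y / 2) ^ (2 * m + 1) / ((m.factorial : ℝ) * ((m + 1).factorial : ℝ))) := by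
      funext y
      rw [tsum_mul_left]
      rfl
    rw [h0]
    exact key.congr_deriv tsum_mul_left
  · have h := (hasDerivAt_id y).mul ((((hasDerivAt_id y).div_const 2).pow (2 * m + 1)).div_const
      ((m.factorial : ℝ) * ((m + 1).factorial : ℝ)))
    refine h.congr_deriv ?_
    have h2 : (m.factorial : ℝ) ≠ 0 := by exact_mod_cast (Nat.factorial_pos _).ne'
    simp only [Pi.pow_apply, add_zero, id, Nat.factorial_succ, Nat.cast_mul, Nat.cast_add, Nat.cast_one,
      Nat.add_sub_cancel, pow_succ]
    push_cast
    field_simp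
    ring
  · rw [norm_mul]
    have h1 : |y| ≤ |x| + 1 := abs_le.2 ⟨hy.1.le, hy.2.le⟩
    have h2 := norm_besselI_term_le 0 m h1
    rw [Real.norm_eq_abs y]
    exact mul_le_mul h1 h2 (norm_nonneg _) (by positivity)

theorem hasDerivAt_besselI_one {x : ℝ} (hx : x ≠ 0) :
    HasDerivAt (besselI 1) (besselI 0 x - besselI 1 x / x) x := by
  have h := (hasDerivAt_mul_besselI_one x).div (hasDerivAt_id x) hx
  have h' : HasDerivAt (besselI 1)
      ((x * besselI 0 x * id x - x * besselI 1 x * 1) / id x ^ 2) x := by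
    refine h.congr_of_eventuallyEq ?_
    filter_upwards [isOpen_ne.mem_nhds hx] with y hy
    have hy' : y ≠ 0 := hy
    simp [hy']
  refine h'.congr_deriv ?_
  simp only [id]
  field_simp

theorem continuous_besselI_zero : Continuous (besselI 0) :=
  continuous_iff_continuousAt.2 fun x => (hasDerivAt_besselI_zero x).continuousAt

theorem hasDerivAt_besselI_one_zero : HasDerivAt (besselI 1) (1 / 2) 0 := by
  have key := hasDerivAt_tsum_of_isPreconnected
    ((summable_besselI_bound 0 1))
    (t := Ioo (-1) 1)
    (g := fun (m : ℕ) (y : ℝ) =>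
      ((y / 2) ^ (2 * m + 1) / ((m.factorial : ℝ) * ((m + 1).factorial : ℝ))))
    (g' := fun (m : ℕ) (y : ℝ) =>
      ((2 * m + 1) / (2 * (m + 1)) * ((y / 2) ^ (2 * m + 0) / ((m.factorial : ℝ) * ((m + 0).factorial : ℝ)))))
    (y₀ := 0) (y := 0)
    isOpen_Ioo isPreconnected_Ioo (fun m y _ => ?_) (fun m y hy => ?_) (by simp)
    ((summable_besselI 1 0)) (by simp)
  · refine key.congr_deriv ?_
    rw [tsum_eq_single 0]
    · simp
    · intro m hm
      simp [hm]
  · have h := ((((hasDerivAt_id y).div_const 2).pow (2 * m + 1)).div_const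
      ((m.factorial : ℝ) * ((m + 1).factorial : ℝ)))
    refine h.congr_deriv ?_
    have h2 : (m.factorial : ℝ) ≠ 0 := by exact_mod_cast (Nat.factorial_pos _).ne'
    simp only [add_zero, id, Nat.factorial_succ, Nat.cast_mul, Nat.cast_add, Nat.cast_one,
      Nat.add_sub_cancel]
    push_cast
    field_simp
  · rw [norm_mul]
    have h1 : |y| ≤ 1 := abs_le.2 ⟨hy.1.le, hy.2.le⟩
    have h2 := norm_besselI_term_le 0 m h1
    have h3 : ‖((2 * m + 1) / (2 * (m + 1)) : ℝ)‖ ≤ 1 := by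
      rw [Real.norm_eq_abs, abs_of_pos (by positivity), div_le_one (by positivity)]
      linarith
    calc _ ≤ 1 * _ := mul_le_mul h3 h2 (norm_nonneg _) zero_le_one
      _ = _ := by simp

theorem continuous_besselI_one : Continuous (besselI 1) :=
  continuous_iff_continuousAt.2 fun x => by
    rcases eq_or_ne x 0 with rfl | hx
    · exact hasDerivAt_besselI_one_zero.continuousAt
    · exact (hasDerivAt_besselI_one hx).continuousAt

/-- `(y I₀)² - (y I₁)²` vanishes at `0` and has the derivative `2 y I₀²`. -/
theorem besselI_one_lt_besselI_zero {x : ℝ} (hx : 0 < x) : besselI 1 x < besselI 0 x := by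
  have hd : ∀ y : ℝ, HasDerivAt (fun y => (y * besselI 0 y) ^ 2 - (y * besselI 1 y) ^ 2)
      (2 * y * besselI 0 y ^ 2) y := fun y => by
    refine ((((hasDerivAt_id y).mul (hasDerivAt_besselI_zero y)).pow 2).sub
      ((hasDerivAt_mul_besselI_one y).pow 2)).congr_deriv ?_
    simp only [id, Pi.mul_apply]
    push_cast
    ring
  have hmono : StrictMonoOn (fun y => (y * besselI 0 y) ^ 2 - (y * besselI 1 y) ^ 2) (Ici 0) := by
    refine strictMonoOn_of_deriv_pos (convex_Ici 0)
      (fun y _ => (hd y).continuousAt.continuousWithinAt) fun y hy => ?_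
    rw [interior_Ici, mem_Ioi] at hy
    rw [(hd y).deriv]
    have := besselI_zero_pos y
    positivity
  have h := hmono (mem_Ici.2 le_rfl) (mem_Ici.2 hx.le) hx
  simp only [zero_mul, zero_pow, ne_eq, OfNat.ofNat_ne_zero, not_false_eq_true, sub_self] at h
  have h1 := besselI_pos hx 1
  have h0 := besselI_zero_pos x
  by_contra hle
  push Not at hle
  have : x * besselI 0 x ≤ x * besselI 1 x := by gcongr
  nlinarith [mul_pos hx h0]

/-! ### Modified Bessel functions of the second kind -/

/-- The moments `∫₀^∞ exp(-x cosh t) coshʲ t dt`. For `j = 0, 1` these are `K₀` and `K₁`. -/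
def coshMoment (j : ℕ) (x : ℝ) : ℝ :=
  ∫ t in Ioi (0 : ℝ), Real.exp (-x * Real.cosh t) * Real.cosh t ^ j

theorem besselK_zero_eq : besselK 0 = coshMoment 0 := by
  funext x; simp [besselK, coshMoment]

theorem besselK_one_eq : besselK 1 = coshMoment 1 := by
  funext x; simp [besselK, coshMoment]

theorem exp_neg_mul_cosh_le {x : ℝ} (hx : 0 < x) (j : ℕ) (t : ℝ) :
    Real.exp (-x * Real.cosh t) * Real.cosh t ^ j
      ≤ 2 * (j + 1).factorial / x ^ (j + 1) * Real.exp (-t) := by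
  have hc := Real.cosh_pos t
  have h1 : (x * Real.cosh t) ^ (j + 1) / (j + 1).factorial ≤ Real.exp (x * Real.cosh t) :=
    Real.pow_div_factorial_le_exp _ (by positivity) _
  have h2 : Real.exp t / 2 ≤ Real.cosh t := by
    rw [Real.cosh_eq]
    have := Real.exp_pos (-t)
    linarith
  have hf : (0 : ℝ) < ((j + 1).factorial : ℝ) := by exact_mod_cast Nat.factorial_pos _
  rw [neg_mul, Real.exp_neg, Real.exp_neg, div_mul_eq_mul_div, le_div_iff₀ (by positivity),
    inv_mul_eq_div, div_mul_eq_mul_div, div_le_iff₀ (Real.exp_pos _)]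
  have h3 : 1 ≤ 2 * (Real.exp t)⁻¹ * Real.cosh t := by
    have := Real.exp_pos t
    rw [mul_assoc, inv_mul_eq_div, mul_div_assoc', le_div_iff₀ this]
    linarith
  rw [div_le_iff₀ hf] at h1
  calc Real.cosh t ^ j * x ^ (j + 1)
      ≤ (Real.cosh t ^ j * x ^ (j + 1)) * (2 * (Real.exp t)⁻¹ * Real.cosh t) :=
        le_mul_of_one_le_right (by positivity) h3
    _ = (2 * (Real.exp t)⁻¹) * (x * Real.cosh t) ^ (j + 1) := by rw [mul_pow]; ring
    _ ≤ (2 * (Real.exp t)⁻¹) * (Real.exp (x * Real.cosh t) * (j + 1).factorial) := by gcongr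
    _ = _ := by ring

theorem integrableOn_coshMoment {x : ℝ} (hx : 0 < x) (j : ℕ) :
    IntegrableOn (fun t => Real.exp (-x * Real.cosh t) * Real.cosh t ^ j) (Ioi 0) := by
  refine Integrable.mono' ((integrableOn_exp_neg_Ioi 0).const_mul
    (2 * (j + 1).factorial / x ^ (j + 1))) ?_ (ae_of_all _ fun t => ?_)
  · exact (by fun_prop : Continuous fun t : ℝ =>
      Real.exp (-x * Real.cosh t) * Real.cosh t ^ j).aestronglyMeasurable
  · have := Real.cosh_pos t
    rw [Real.norm_eq_abs, abs_of_pos (by positivity)]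
    exact exp_neg_mul_cosh_le hx j t

theorem coshMoment_pos {x : ℝ} (hx : 0 < x) (j : ℕ) : 0 < coshMoment j x := by
  unfold coshMoment
  rw [setIntegral_pos_iff_support_of_nonneg_ae]
  · rw [inter_eq_right.2]
    · simp
    · intro t _
      have := Real.cosh_pos t
      exact (by positivity : (0:ℝ) < Real.exp (-x * Real.cosh t) * Real.cosh t ^ j).ne'
  · exact ae_of_all _ fun t => by have := Real.cosh_pos t; simp only [Pi.zero_apply]; positivity
  · exact integrableOn_coshMoment hx j

theorem hasDerivAt_coshMoment {x : ℝ} (hx : 0 < x) (j : ℕ) :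
    HasDerivAt (coshMoment j) (-coshMoment (j + 1) x) x := by
  have hm : ∀ (y : ℝ) (i : ℕ), Continuous fun t : ℝ =>
      Real.exp (-y * Real.cosh t) * Real.cosh t ^ i := fun y i => by fun_prop
  have key := hasDerivAt_integral_of_dominated_loc_of_deriv_le
    (μ := volume.restrict (Ioi (0 : ℝ)))
    (F := fun y t => Real.exp (-y * Real.cosh t) * Real.cosh t ^ j)
    (F' := fun y t => -(Real.exp (-y * Real.cosh t) * Real.cosh t ^ (j + 1)))
    (bound := fun t => Real.exp (-(x / 2) * Real.cosh t) * Real.cosh t ^ (j + 1))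
    (s := Ioi (x / 2)) (x₀ := x) (Ioi_mem_nhds (by linarith))
    (Eventually.of_forall fun y => (hm y j).aestronglyMeasurable)
    (integrableOn_coshMoment hx j) (hm x (j + 1)).neg.aestronglyMeasurable
    (ae_of_all _ fun t y hy => ?_) (integrableOn_coshMoment (half_pos hx) (j + 1))
    (ae_of_all _ fun t y _ => ?_)
  · refine key.2.congr_deriv ?_
    rw [coshMoment, integral_neg]
  · have hc := Real.cosh_pos t
    rw [norm_neg, Real.norm_eq_abs, abs_of_pos (by positivity)]
    have : x / 2 < y := hy
    gcongr
  · have h := (((hasDerivAt_id y).neg.mul_const (Real.cosh t)).exp).mul_const (Real.cosh t ^ j)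
    refine h.congr_deriv ?_
    simp only [id, Pi.neg_apply]
    ring

/-- Integration by parts: `(e^{-x cosh t} sinh t)' = e^{-x cosh t} (cosh t - x (cosh² t - 1))`. -/
theorem coshMoment_two {x : ℝ} (hx : 0 < x) :
    coshMoment 2 x = coshMoment 0 x + coshMoment 1 x / x := by
  have hd : ∀ t : ℝ, HasDerivAt (fun t => Real.exp (-x * Real.cosh t) * Real.sinh t)
      (Real.exp (-x * Real.cosh t) * Real.cosh t ^ 1 + x * (Real.exp (-x * Real.cosh t) * Real.cosh t ^ 0)
        - x * (Real.exp (-x * Real.cosh t) * Real.cosh t ^ 2)) t := fun t => by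
    have h := (((Real.hasDerivAt_cosh t).const_mul (-x)).exp).mul (Real.hasDerivAt_sinh t)
    refine h.congr_deriv ?_
    have := Real.cosh_sq t
    simp only [pow_one, pow_zero]
    rw [this]
    ring
  have i1 := integrableOn_coshMoment hx 1
  have i0 := (integrableOn_coshMoment hx 0).const_mul x
  have i2 := (integrableOn_coshMoment hx 2).const_mul x
  have key := integral_Ioi_of_hasDerivAt_of_tendsto' (a := 0) (m := 0) (fun t _ => hd t)
    ((i1.add i0).sub i2) ?_
  · have e := integral_sub (i1.add i0) i2
    have e' := integral_add i1 i0
    simp only [Pi.add_apply] at e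
    rw [e, e', integral_const_mul, integral_const_mul] at key
    simp only [Real.sinh_zero, mul_zero, sub_zero] at key
    change coshMoment 1 x + x * coshMoment 0 x - x * coshMoment 2 x = 0 at key
    field_simp
    linarith
  · have hlim : Tendsto (fun t : ℝ => 2 * (1 + 1).factorial / x ^ (1 + 1) * Real.exp (-t)) atTop (𝓝 0) := by
      simpa only [mul_zero] using Real.tendsto_exp_neg_atTop_nhds_zero.const_mul
        (2 * ((1 + 1).factorial : ℝ) / x ^ (1 + 1))
    refine squeeze_zero_norm' ?_ hlim
    filter_upwards [eventually_ge_atTop 0] with t ht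
    have hs : 0 ≤ Real.sinh t := Real.sinh_nonneg_iff.2 ht
    rw [Real.norm_eq_abs, abs_of_nonneg (by positivity)]
    refine le_trans ?_ (exp_neg_mul_cosh_le hx 1 t)
    have := (Real.sinh_lt_cosh t).le
    rw [pow_one]
    gcongr

theorem besselK_zero_pos {x : ℝ} (hx : 0 < x) : 0 < besselK 0 x := by
  rw [besselK_zero_eq]; exact coshMoment_pos hx 0

theorem besselK_one_pos {x : ℝ} (hx : 0 < x) : 0 < besselK 1 x := by
  rw [besselK_one_eq]; exact coshMoment_pos hx 1

theorem hasDerivAt_besselK_zero {x : ℝ} (hx : 0 < x) :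
    HasDerivAt (besselK 0) (-besselK 1 x) x := by
  rw [besselK_zero_eq, besselK_one_eq]; exact hasDerivAt_coshMoment hx 0

theorem hasDerivAt_besselK_one {x : ℝ} (hx : 0 < x) :
    HasDerivAt (besselK 1) (-besselK 0 x - besselK 1 x / x) x := by
  rw [besselK_zero_eq, besselK_one_eq]
  refine (hasDerivAt_coshMoment hx 1).congr_deriv ?_
  rw [coshMoment_two hx]
  ring

theorem besselK_zero_le_besselK_one {x : ℝ} (hx : 0 < x) : besselK 0 x ≤ besselK 1 x := by
  rw [besselK_zero_eq, besselK_one_eq]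
  refine setIntegral_mono (integrableOn_coshMoment hx 0) (integrableOn_coshMoment hx 1) fun t => ?_
  have := Real.one_le_cosh t
  simp only [pow_zero, pow_one]
  gcongr

theorem coshMoment_le_exp {x₀ x : ℝ} (hx₀ : 0 < x₀) (hx : x₀ ≤ x) (j : ℕ) :
    coshMoment j x ≤ Real.exp (-(x - x₀)) * coshMoment j x₀ := by
  unfold coshMoment
  rw [← integral_const_mul]
  refine setIntegral_mono (integrableOn_coshMoment (hx₀.trans_le hx) j)
    ((integrableOn_coshMoment hx₀ j).const_mul _) fun t => ?_
  have h1 := Real.one_le_cosh t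
  have : 0 < Real.cosh t := Real.cosh_pos t
  simp only
  rw [← mul_assoc, ← Real.exp_add]
  gcongr
  nlinarith

/-- `x K₁(x) = e^{-x} + x ∫₀^∞ e^{-x cosh t} e^{-t} dt` lies between `e^{-x}` and `e^{-x} + x`. -/
theorem mul_besselK_one_bounds {x : ℝ} (hx : 0 < x) :
    Real.exp (-x) ≤ x * besselK 1 x ∧ x * besselK 1 x ≤ Real.exp (-x) + x := by
  have hd : ∀ t : ℝ, HasDerivAt (fun t => -(Real.exp (-x * Real.cosh t)))
      (x * (Real.exp (-x * Real.cosh t) * Real.sinh t)) t := fun t => by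
    refine (((Real.hasDerivAt_cosh t).const_mul (-x)).exp.neg).congr_deriv ?_
    ring
  have hint : IntegrableOn (fun t => Real.exp (-x * Real.cosh t) * Real.sinh t) (Ioi 0) := by
    refine Integrable.mono' (integrableOn_coshMoment hx 1) ?_ (ae_of_all _ fun t => ?_)
    · exact (by fun_prop : Continuous fun t : ℝ =>
        Real.exp (-x * Real.cosh t) * Real.sinh t).aestronglyMeasurable
    · rw [norm_mul, Real.norm_eq_abs, Real.abs_exp, pow_one]
      gcongr
      rw [Real.norm_eq_abs, abs_le]
      have h1 := Real.sinh_lt_cosh t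
      have h2 := Real.sinh_lt_cosh (-t)
      rw [Real.sinh_neg, Real.cosh_neg] at h2
      constructor <;> linarith
  have hs : x * ∫ t in Ioi (0:ℝ), Real.exp (-x * Real.cosh t) * Real.sinh t = Real.exp (-x) := by
    rw [← integral_const_mul, integral_Ioi_of_hasDerivAt_of_tendsto' (a := 0) (m := 0)
      (fun t _ => hd t) (hint.const_mul x)]
    · simp
    · have hlim : Tendsto (fun t : ℝ => 2 * (0 + 1).factorial / x ^ (0 + 1) * Real.exp (-t)) atTop (𝓝 0) := by
        simpa only [mul_zero] using Real.tendsto_exp_neg_atTop_nhds_zero.const_mul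
          (2 * ((0 + 1).factorial : ℝ) / x ^ (0 + 1))
      refine squeeze_zero_norm (fun t => ?_) hlim
      rw [norm_neg, Real.norm_eq_abs, Real.abs_exp]
      simpa using exp_neg_mul_cosh_le hx 0 t
  have i1 := integrableOn_coshMoment hx 1
  have hK : besselK 1 x = ∫ t in Ioi (0:ℝ), Real.exp (-x * Real.cosh t) * Real.cosh t ^ 1 := by
    rw [besselK_one_eq]; rfl
  constructor
  · rw [← hs, hK]
    refine mul_le_mul_of_nonneg_left (setIntegral_mono hint i1 fun t => ?_) hx.le
    have := (Real.sinh_lt_cosh t).le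
    simp only [pow_one]
    gcongr
  · rw [← hs, hK]
    have h := setIntegral_mono i1 (hint.add (integrableOn_exp_neg_Ioi 0)) fun t => ?_
    · have e := integral_add hint (integrableOn_exp_neg_Ioi 0)
      simp only [Pi.add_apply] at h
      rw [e, integral_exp_neg_Ioi_zero] at h
      nlinarith
    · have hc := Real.cosh_pos t
      simp only [pow_one, Pi.add_apply]
      have h1 : Real.cosh t = Real.sinh t + Real.exp (-t) := by
        rw [← Real.cosh_sub_sinh]; ring
      have h2 : Real.exp (-x * Real.cosh t) ≤ 1 := by
        rw [Real.exp_le_one_iff]; nlinarith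
      have h3 := Real.exp_pos (-t)
      nth_rw 2 [h1]
      nlinarith

/-! ### Wronskian and inequalities for ratios of Bessel functions -/

theorem tendsto_mul_besselK_one : Tendsto (fun x => x * besselK 1 x) (𝓝[>] 0) (𝓝 1) := by
  have h1 : Tendsto (fun x : ℝ => Real.exp (-x)) (𝓝[>] 0) (𝓝 1) := by
    have : ContinuousAt (fun x : ℝ => Real.exp (-x)) 0 := by fun_prop
    simpa [ContinuousAt] using this.tendsto.mono_left nhdsWithin_le_nhds
  have h2 : Tendsto (fun x : ℝ => Real.exp (-x) + x) (𝓝[>] 0) (𝓝 1) := by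
    have : ContinuousAt (fun x : ℝ => Real.exp (-x) + x) 0 := by fun_prop
    simpa [ContinuousAt] using this.tendsto.mono_left nhdsWithin_le_nhds
  refine tendsto_of_tendsto_of_tendsto_of_le_of_le' h1 h2 ?_ ?_
  · filter_upwards [self_mem_nhdsWithin] with x hx using (mul_besselK_one_bounds hx).1
  · filter_upwards [self_mem_nhdsWithin] with x hx using (mul_besselK_one_bounds hx).2

theorem tendsto_besselI_zero_nhdsGT : Tendsto (besselI 0) (𝓝[>] 0) (𝓝 1) := by
  simpa [besselI_zero_zero] using (continuous_besselI_zero.tendsto 0).mono_left nhdsWithin_le_nhds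

theorem tendsto_besselI_one_nhdsGT : Tendsto (besselI 1) (𝓝[>] 0) (𝓝 0) := by
  simpa [besselI_one_zero] using (continuous_besselI_one.tendsto 0).mono_left nhdsWithin_le_nhds

/-- A function on `(0, ∞)` with zero derivative and limit `L` at `0` is equal to `L`. -/
theorem eq_of_hasDerivAt_zero_of_tendsto {W : ℝ → ℝ} {L : ℝ}
    (hW : ∀ x, 0 < x → HasDerivAt W 0 x) (hL : Tendsto W (𝓝[>] 0) (𝓝 L)) {x : ℝ} (hx : 0 < x) :
    W x = L := by
  have hc : ∀ y ∈ Ioi (0 : ℝ), W y = W x := fun y hy =>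
    isOpen_Ioi.is_const_of_deriv_eq_zero isPreconnected_Ioi
      (fun z hz => (hW z hz).differentiableAt.differentiableWithinAt)
      (fun z hz => (hW z hz).deriv) hy hx
  refine tendsto_nhds_unique ?_ hL
  refine tendsto_const_nhds.congr' ?_
  filter_upwards [self_mem_nhdsWithin] with y hy using (hc y hy).symm

/-- The Wronskian relation `I₀ K₁ + I₁ K₀ = 1 / x`. -/
theorem besselWronskian {x : ℝ} (hx : 0 < x) :
    x * (besselI 0 x * besselK 1 x + besselI 1 x * besselK 0 x) = 1 := by
  refine eq_of_hasDerivAt_zero_of_tendsto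
    (W := fun x => x * (besselI 0 x * besselK 1 x + besselI 1 x * besselK 0 x)) (fun y hy => ?_) ?_ hx
  · refine ((hasDerivAt_id y).mul (((hasDerivAt_besselI_zero y).mul (hasDerivAt_besselK_one hy)).add
      ((hasDerivAt_besselI_one hy.ne').mul (hasDerivAt_besselK_zero hy)))).congr_deriv ?_
    simp only [id, Pi.add_apply, Pi.mul_apply]
    field_simp
    ring
  · have hsmall : Tendsto (fun y => besselI 1 y * (y * besselK 0 y)) (𝓝[>] 0) (𝓝 0) := by
      have h := tendsto_besselI_one_nhdsGT.mul tendsto_mul_besselK_one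
      rw [zero_mul] at h
      refine squeeze_zero' ?_ ?_ h
      · filter_upwards [self_mem_nhdsWithin] with y hy
        have hy : 0 < y := hy
        have := besselI_pos hy 1
        have := besselK_zero_pos hy
        positivity
      · filter_upwards [self_mem_nhdsWithin] with y hy
        have hy : 0 < y := hy
        have := besselI_pos hy 1
        have := besselK_zero_le_besselK_one hy
        gcongr
    have h := (tendsto_besselI_zero_nhdsGT.mul tendsto_mul_besselK_one).add hsmall
    rw [one_mul, add_zero] at h
    refine h.congr fun y => ?_
    ring

theorem pos_of_hasDerivAt_pos_of_tendsto_zero {E E' : ℝ → ℝ}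
    (hE : ∀ x, 0 < x → HasDerivAt E (E' x) x) (hE' : ∀ x, 0 < x → 0 < E' x)
    (hL : Tendsto E (𝓝[>] 0) (𝓝 0)) {x : ℝ} (hx : 0 < x) : 0 < E x := by
  have hmono : StrictMonoOn E (Ioi 0) :=
    strictMonoOn_of_deriv_pos (convex_Ioi 0)
      (fun y hy => (hE y hy).continuousAt.continuousWithinAt) fun y hy => by
        rw [interior_Ioi] at hy
        rw [(hE y hy).deriv]
        exact hE' y hy
  have h1 : E (x / 2) < E x := hmono (half_pos hx) hx (by linarith)
  refine lt_of_le_of_lt (le_of_tendsto hL ?_) h1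
  filter_upwards [Ioo_mem_nhdsGT (half_pos hx)] with y hy
  exact (hmono hy.1 (half_pos hx) hy.2).le

theorem neg_of_hasDerivAt_pos_of_tendsto_zero {E E' : ℝ → ℝ}
    (hE : ∀ x, 0 < x → HasDerivAt E (E' x) x) (hE' : ∀ x, 0 < x → 0 < E' x)
    (hL : Tendsto E atTop (𝓝 0)) {x : ℝ} (hx : 0 < x) : E x < 0 := by
  have hmono : StrictMonoOn E (Ioi 0) :=
    strictMonoOn_of_deriv_pos (convex_Ioi 0)
      (fun y hy => (hE y hy).continuousAt.continuousWithinAt) fun y hy => by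
        rw [interior_Ioi] at hy
        rw [(hE y hy).deriv]
        exact hE' y hy
  have h1 : E x < E (x + 1) := hmono hx (by simp; linarith) (by linarith)
  refine lt_of_lt_of_le h1 (ge_of_tendsto hL ?_)
  filter_upwards [eventually_ge_atTop (x + 1)] with y hy
  exact hmono.monotoneOn (by simp; linarith) (by simp; linarith) hy

/-- With `Q = 1 + 3/(4x²)`, the function `p = √x I₁` solves `p'' = Q p`; since `Q` decreases,
`p'² - Q p²` increases from its limit `0` at the origin. -/
theorem besselI_ratio_bound {x : ℝ} (hx : 0 < x) :
    0 < x * besselI 0 x ^ 2 - besselI 0 x * besselI 1 x - x * besselI 1 x ^ 2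
      - besselI 1 x ^ 2 / (2 * x) := by
  refine pos_of_hasDerivAt_pos_of_tendsto_zero
    (E := fun x => x * besselI 0 x ^ 2 - besselI 0 x * besselI 1 x - x * besselI 1 x ^ 2
      - besselI 1 x ^ 2 / (2 * x))
    (E' := fun x => 3 / (2 * x ^ 2) * besselI 1 x ^ 2) (fun y hy => ?_) (fun y hy => ?_) ?_ hx
  · have h0 := hasDerivAt_besselI_zero y
    have h1 := hasDerivAt_besselI_one hy.ne'
    refine (((((hasDerivAt_id y).mul (h0.pow 2)).sub (h0.mul h1)).sub
      ((hasDerivAt_id y).mul (h1.pow 2))).sub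
      ((h1.pow 2).div ((hasDerivAt_id y).const_mul 2) (by simpa using hy.ne'))).congr_deriv ?_
    simp only [id, Pi.pow_apply]
    field_simp
    push_cast
    ring
  · have := besselI_pos hy 1
    positivity
  · have hq : Tendsto (fun y => besselI 1 y / y) (𝓝[>] 0) (𝓝 (1 / 2)) := by
      have h := hasDerivAt_iff_tendsto_slope.1 hasDerivAt_besselI_one_zero
      refine (h.mono_left (nhdsWithin_mono _ fun y hy => (ne_of_gt hy : y ≠ 0))).congr fun y => ?_
      simp [slope, besselI_one_zero, div_eq_inv_mul]
    have hid : Tendsto (fun y : ℝ => y) (𝓝[>] 0) (𝓝 0) := nhdsWithin_le_nhds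
    have h0 := tendsto_besselI_zero_nhdsGT
    have h1 := tendsto_besselI_one_nhdsGT
    have h := (((hid.mul (h0.pow 2)).sub (h0.mul h1)).sub (hid.mul (h1.pow 2))).sub
      ((h1.mul hq).div_const 2)
    simp only [zero_mul, mul_zero, sub_zero, zero_div] at h
    refine h.congr fun y => ?_
    rcases eq_or_ne y 0 with rfl | hy
    · simp
    · field_simp

theorem tendsto_mul_coshMoment (j : ℕ) : Tendsto (fun x => x * coshMoment j x) atTop (𝓝 0) := by
  have h : Tendsto (fun x : ℝ => Real.exp 1 * coshMoment j 1 * (x ^ 1 * Real.exp (-x))) atTop (𝓝 0) := by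
    simpa using (Real.tendsto_pow_mul_exp_neg_atTop_nhds_zero 1).const_mul (Real.exp 1 * coshMoment j 1)
  refine squeeze_zero' ?_ ?_ h
  · filter_upwards [eventually_gt_atTop 0] with x hx
    exact mul_nonneg hx.le (coshMoment_pos hx j).le
  · filter_upwards [eventually_ge_atTop 1] with x hx
    have := coshMoment_le_exp one_pos hx j
    calc x * coshMoment j x ≤ x * (Real.exp (-(x - 1)) * coshMoment j 1) := by gcongr
      _ = _ := by rw [neg_sub, sub_eq_add_neg, Real.exp_add]; ring

theorem tendsto_coshMoment (j : ℕ) : Tendsto (coshMoment j) atTop (𝓝 0) := by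
  have := (tendsto_mul_coshMoment j).mul tendsto_inv_atTop_zero
  rw [zero_mul] at this
  refine this.congr' ?_
  filter_upwards [eventually_gt_atTop 0] with x hx
  field_simp

theorem tendsto_besselK_zero_atTop : Tendsto (besselK 0) atTop (𝓝 0) := by
  rw [besselK_zero_eq]; exact tendsto_coshMoment 0

theorem tendsto_besselK_one_atTop : Tendsto (besselK 1) atTop (𝓝 0) := by
  rw [besselK_one_eq]; exact tendsto_coshMoment 1

theorem tendsto_mul_besselK_zero_atTop : Tendsto (fun x => x * besselK 0 x) atTop (𝓝 0) := by
  rw [besselK_zero_eq]; exact tendsto_mul_coshMoment 0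

theorem tendsto_mul_besselK_one_atTop : Tendsto (fun x => x * besselK 1 x) atTop (𝓝 0) := by
  rw [besselK_one_eq]; exact tendsto_mul_coshMoment 1

/-- The counterpart of `besselI_ratio_bound` for `q = √x K₁`, where `q'² - Q q²` increases to its
limit `0` at infinity. -/
theorem besselK_ratio_bound {x : ℝ} (hx : 0 < x) :
    x * besselK 0 x ^ 2 + besselK 0 x * besselK 1 x - x * besselK 1 x ^ 2
      - besselK 1 x ^ 2 / (2 * x) < 0 := by
  refine neg_of_hasDerivAt_pos_of_tendsto_zero
    (E := fun x => x * besselK 0 x ^ 2 + besselK 0 x * besselK 1 x - x * besselK 1 x ^ 2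
      - besselK 1 x ^ 2 / (2 * x))
    (E' := fun x => 3 / (2 * x ^ 2) * besselK 1 x ^ 2) (fun y hy => ?_) (fun y hy => ?_) ?_ hx
  · have h0 := hasDerivAt_besselK_zero hy
    have h1 := hasDerivAt_besselK_one hy
    refine (((((hasDerivAt_id y).mul (h0.pow 2)).add (h0.mul h1)).sub
      ((hasDerivAt_id y).mul (h1.pow 2))).sub
      ((h1.pow 2).div ((hasDerivAt_id y).const_mul 2) (by simpa using hy.ne'))).congr_deriv ?_
    simp only [id, Pi.pow_apply]
    field_simp
    push_cast
    ring
  · have := besselK_one_pos hy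
    positivity
  · have h0 := tendsto_besselK_zero_atTop
    have h1 := tendsto_besselK_one_atTop
    have h := (((tendsto_mul_besselK_zero_atTop.mul h0).add (h0.mul h1)).sub
      (tendsto_mul_besselK_one_atTop.mul h1)).sub
      ((h1.pow 2).mul (tendsto_inv_atTop_zero.const_mul (1 / 2)))
    simp only [mul_zero, sub_zero, add_zero] at h
    refine h.congr fun y => ?_
    field_simp

/-- `K₁² < K₀² + K₀ K₁ / x`. -/
theorem besselK_one_sq_lt {x : ℝ} (hx : 0 < x) :
    x * besselK 1 x ^ 2 - x * besselK 0 x ^ 2 - besselK 0 x * besselK 1 x < 0 := by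
  refine neg_of_hasDerivAt_pos_of_tendsto_zero
    (E := fun x => x * besselK 1 x ^ 2 - x * besselK 0 x ^ 2 - besselK 0 x * besselK 1 x)
    (E' := fun x => besselK 0 x * besselK 1 x / x) (fun y hy => ?_) (fun y hy => ?_) ?_ hx
  · have h0 := hasDerivAt_besselK_zero hy
    have h1 := hasDerivAt_besselK_one hy
    refine ((((hasDerivAt_id y).mul (h1.pow 2)).sub ((hasDerivAt_id y).mul (h0.pow 2))).sub
      (h0.mul h1)).congr_deriv ?_
    simp only [id, Pi.pow_apply]
    field_simp
    push_cast
    ring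
  · have := besselK_one_pos hy
    have := besselK_zero_pos hy
    positivity
  · have h0 := tendsto_besselK_zero_atTop
    have h1 := tendsto_besselK_one_atTop
    have h := ((tendsto_mul_besselK_one_atTop.mul h1).sub
      (tendsto_mul_besselK_zero_atTop.mul h0)).sub (h0.mul h1)
    simp only [mul_zero, sub_zero] at h
    refine h.congr fun y => ?_
    ring

theorem besselK_one_le {x : ℝ} (hx : 0 < x) : besselK 1 x ≤ (1 + 1 / x) * besselK 0 x := by
  have h := besselK_one_sq_lt hx
  have h0 := besselK_zero_pos hx
  have h1 := besselK_zero_le_besselK_one hx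
  by_contra hlt
  push Not at hlt
  have e : (x + 1) * besselK 0 x < x * besselK 1 x := by
    have := mul_lt_mul_of_pos_left hlt hx
    rwa [← mul_assoc, mul_add, mul_one, mul_one_div_cancel hx.ne'] at this
  nlinarith

/-! ### The function `x I₁(x) K₁(x)` -/

/-- The function `x I₁(x) K₁(x)`, in terms of which the secular equation is `k F(kR) = ω`. -/
def secular (x : ℝ) : ℝ := x * besselI 1 x * besselK 1 x

theorem secular_pos {x : ℝ} (hx : 0 < x) : 0 < secular x := by
  have := besselI_pos hx 1
  have := besselK_one_pos hx
  unfold secular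
  positivity

/-- The logarithmic derivatives `a` of `√x I₁` and `-b` of `√x K₁`. They satisfy
`a + b = 1 / F` and `b² < Q < a²` with `Q = 1 + 3/(4x²)`. -/
theorem exists_logDeriv_bounds {x : ℝ} (hx : 0 < x) : ∃ a b : ℝ, 0 < a ∧ 0 < b ∧
    HasDerivAt secular (secular x * (a - b)) x ∧ secular x * (a + b) = 1 ∧
    b ^ 2 < 1 + 3 / (4 * x ^ 2) ∧ 1 + 3 / (4 * x ^ 2) < a ^ 2 := by
  have i1 := besselI_pos hx 1
  have k0 := besselK_zero_pos hx
  have k1 := besselK_one_pos hx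
  have hI := besselI_ratio_bound hx
  have hK := besselK_ratio_bound hx
  have hW := besselWronskian hx
  have hlt := besselI_one_lt_besselI_zero hx
  refine ⟨besselI 0 x / besselI 1 x - 1 / (2 * x), besselK 0 x / besselK 1 x + 1 / (2 * x),
    ?_, by positivity, ?_, ?_, ?_, ?_⟩
  · rw [sub_pos, div_lt_div_iff₀ (by positivity) i1, one_mul]
    rw [show x * besselI 0 x ^ 2 - besselI 0 x * besselI 1 x - x * besselI 1 x ^ 2
      - besselI 1 x ^ 2 / (2 * x) = besselI 0 x * (x * besselI 0 x - besselI 1 x) - x * besselI 1 x ^ 2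
      - besselI 1 x ^ 2 / (2 * x) by ring] at hI
    have h2 : 0 < x * besselI 1 x ^ 2 + besselI 1 x ^ 2 / (2 * x) := by positivity
    have h3 : 0 < x * besselI 0 x - besselI 1 x := by
      by_contra hle
      push Not at hle
      have := besselI_zero_pos x
      nlinarith
    have := besselI_zero_pos x
    nlinarith
  · refine (((hasDerivAt_id x).mul (hasDerivAt_besselI_one hx.ne')).mul
      (hasDerivAt_besselK_one hx)).congr_deriv ?_
    simp only [id, Pi.mul_apply, secular]
    field_simp
    ring
  · rw [← hW, secular]
    field_simp
    ring
  · rw [← sub_pos]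
    have e : 1 + 3 / (4 * x ^ 2) - (besselK 0 x / besselK 1 x + 1 / (2 * x)) ^ 2 =
        -(x * besselK 0 x ^ 2 + besselK 0 x * besselK 1 x - x * besselK 1 x ^ 2
      - besselK 1 x ^ 2 / (2 * x)) / (x * besselK 1 x ^ 2) := by
      field_simp
      ring
    rw [e]
    exact div_pos (by linarith) (by positivity)
  · rw [← sub_pos]
    have e : (besselI 0 x / besselI 1 x - 1 / (2 * x)) ^ 2 - (1 + 3 / (4 * x ^ 2)) =
        (x * besselI 0 x ^ 2 - besselI 0 x * besselI 1 x - x * besselI 1 x ^ 2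
      - besselI 1 x ^ 2 / (2 * x)) / (x * besselI 1 x ^ 2) := by
      field_simp
      ring
    rw [e]
    exact div_pos hI (by positivity)

theorem continuousOn_secular : ContinuousOn secular (Ioi 0) := fun x hx => by
  obtain ⟨a, b, -, -, h, -⟩ := exists_logDeriv_bounds (mem_Ioi.1 hx)
  exact h.continuousAt.continuousWithinAt

theorem strictMonoOn_secular : StrictMonoOn secular (Ioi 0) := by
  refine strictMonoOn_of_deriv_pos (convex_Ioi 0) continuousOn_secular fun x hx => ?_
  rw [interior_Ioi] at hx
  obtain ⟨a, b, ha, hb, h, -, h1, h2⟩ := exists_logDeriv_bounds (mem_Ioi.1 hx)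
  rw [h.deriv]
  have : b < a := lt_of_pow_lt_pow_left₀ 2 ha.le (h1.trans h2)
  exact mul_pos (secular_pos hx) (by linarith)

theorem tendsto_secular_zero : Tendsto secular (𝓝[>] 0) (𝓝 0) := by
  have h := tendsto_besselI_one_nhdsGT.mul tendsto_mul_besselK_one
  rw [zero_mul] at h
  refine h.congr fun x => ?_
  rw [secular]; ring

theorem secular_lt_one {x : ℝ} (hx : 0 < x) : secular x < 1 := by
  rw [← besselWronskian hx, secular, mul_assoc]
  have := besselI_pos hx 1
  have := besselK_zero_pos hx
  have := besselK_one_pos hx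
  have := besselI_one_lt_besselI_zero hx
  nlinarith [mul_pos (besselI_pos hx 1) (besselK_zero_pos hx),
    mul_lt_mul_of_pos_right (besselI_one_lt_besselI_zero hx) (besselK_one_pos hx)]

/-- If `a - b` stayed above `ε`, the derivative `F (a - b)` of the bounded increasing function `F`
would be bounded below. -/
theorem exists_secular_slope_lt {ε : ℝ} (hε : 0 < ε) (x₀ : ℝ) :
    ∃ x > x₀, ∃ a b : ℝ, 0 < x ∧ 0 < a ∧ 0 < b ∧ a - b < ε ∧ secular x * (a + b) = 1 ∧
      b ^ 2 < 1 + 3 / (4 * x ^ 2) ∧ 1 + 3 / (4 * x ^ 2) < a ^ 2 := by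
  by_contra hcon
  push Not at hcon
  set x₁ := max x₀ 0 + 1 with hx₁
  have hx₁0 : 0 < x₁ := by have := le_max_right x₀ 0; linarith
  have hx₁1 : x₀ < x₁ := by have := le_max_left x₀ 0; linarith
  set δ := secular x₁ * ε with hδ
  have hδ0 : 0 < δ := mul_pos (secular_pos hx₁0) hε
  have hgrow : ∀ y ≥ x₁, secular x₁ + δ * (y - x₁) ≤ secular y := by
    intro y hy
    have := (convex_Ici x₁).mul_sub_le_image_sub_of_le_deriv (f := secular) (C := δ)
      (continuousOn_secular.mono fun z hz => hx₁0.trans_le hz)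
      (fun z hz => ?_) (fun z hz => ?_) x₁ self_mem_Ici y hy hy
    · linarith
    · rw [interior_Ici] at hz
      obtain ⟨a, b, -, -, h, -⟩ := exists_logDeriv_bounds (hx₁0.trans hz)
      exact h.differentiableAt.differentiableWithinAt
    · rw [interior_Ici] at hz
      have hz0 : 0 < z := hx₁0.trans hz
      obtain ⟨a, b, ha, hb, h, h1, h2, h3⟩ := exists_logDeriv_bounds hz0
      rw [h.deriv, hδ]
      have hab : ε ≤ a - b := by
        by_contra hlt
        push Not at hlt
        exact absurd h3 (not_lt.2 (hcon z (hx₁1.trans hz) a b hz0 ha hb hlt h1 h2))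
      have hs := strictMonoOn_secular (mem_Ioi.2 hx₁0) (mem_Ioi.2 hz0) hz
      exact mul_le_mul hs.le hab hε.le (hx₁0.trans hz |> secular_pos).le
  have hy : x₁ ≤ x₁ + 1 / δ := by have : 0 < 1 / δ := by positivity
                                  linarith
  have h1 := hgrow _ hy
  have h2 := secular_lt_one (hx₁0.trans_le hy)
  have h3 := secular_pos hx₁0
  rw [add_sub_cancel_left, mul_one_div_cancel hδ0.ne'] at h1
  linarith

theorem secular_lt_half {x : ℝ} (hx : 0 < x) : secular x < 1 / 2 := by
  -- If `F(x) ≥ 1/2` then `F > 1/2 + η` on `(x + 1, ∞)`, where `a + b > 2 - η` somewhere.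
  by_contra hge
  push Not at hge
  have hmono := strictMonoOn_secular (mem_Ioi.2 hx) (mem_Ioi.2 (by linarith : (0:ℝ) < x + 1)) (by linarith)
  set η := secular (x + 1) - 1 / 2 with hη
  have hη0 : 0 < η := by linarith
  obtain ⟨y, hy, a, b, hy0, ha, hb, hab, h1, h2, h3⟩ :=
    exists_secular_slope_lt hη0 (x + 1)
  have hm := strictMonoOn_secular (mem_Ioi.2 (by linarith : (0:ℝ) < x + 1)) (mem_Ioi.2 hy0) hy
  have ha1 : 1 < a := by
    have : (0:ℝ) < 3 / (4 * y ^ 2) := by positivity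
    nlinarith
  have hlt1 := secular_lt_one hy0
  have hs := secular_pos hy0
  nlinarith

theorem tendsto_secular_atTop : Tendsto secular atTop (𝓝 (1 / 2)) := by
  refine tendsto_order.2 ⟨fun l hl => ?_, fun u hu => ?_⟩
  · set ε := min ((1 / 2 - l)) (1 / 2) with hε
    have hε0 : 0 < ε := lt_min (by linarith) (by norm_num)
    obtain ⟨y, hy, a, b, hy0, ha, hb, hab, h1, h2, h3⟩ :=
      exists_secular_slope_lt hε0 (1 / ε)
    have hly : l < secular y := by
      have he : ε ≤ 1 / 2 - l := min_le_left _ _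
      have hy1 : 1 < ε * y := by
        have := mul_lt_mul_of_pos_left hy hε0
        rwa [mul_one_div_cancel hε0.ne'] at this
      have hy2 : 1 / y < ε := by rw [div_lt_iff₀ hy0]; linarith
      have hb1 : b < 1 + ε := by
        have h4 : b ^ 2 < (1 + ε) ^ 2 := by
          refine h2.trans ?_
          have : 3 / (4 * y ^ 2) = 3 / 4 * (1 / y) ^ 2 := by field_simp
          have h5 : 0 < 1 / y := by positivity
          rw [this]
          nlinarith
        exact lt_of_pow_lt_pow_left₀ 2 (by positivity) h4
      have hs := secular_pos hy0
      have : secular y * (2 + 3 * ε) > 1 := by nlinarith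
      nlinarith
    filter_upwards [eventually_ge_atTop y] with z hz
    exact hly.trans_le (strictMonoOn_secular.monotoneOn hy0 (hy0.trans_le hz) hz)
  · filter_upwards [eventually_gt_atTop 0] with x hx using (secular_lt_half hx).trans hu

/-! ### The secular equation -/

theorem strictMonoOn_mul_secular {R : ℝ} (hR : 0 < R) :
    StrictMonoOn (fun x => x * secular (x * R)) (Ioi 0) := fun x hx y hy hxy => by
  have hx : 0 < x := hx
  have hy : 0 < y := hy
  have h := strictMonoOn_secular (mem_Ioi.2 (mul_pos hx hR)) (mem_Ioi.2 (mul_pos hy hR))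
    (mul_lt_mul_of_pos_right hxy hR)
  exact mul_lt_mul hxy h.le (secular_pos (mul_pos hx hR)) hy.le

theorem continuousAt_secular {x : ℝ} (hx : 0 < x) : ContinuousAt secular x :=
  continuousOn_secular.continuousAt (Ioi_mem_nhds hx)

theorem exists_mul_secular_eq {ω R : ℝ} (hω : 0 < ω) (hR : 0 < R) :
    ∃ x, 0 < x ∧ x * secular (x * R) = ω := by
  have hF := secular_pos hR
  have hb : ω < (1 + ω + ω / secular R) * secular ((1 + ω + ω / secular R) * R) := by
    have hq : 0 < ω / secular R := by positivity
    have hm : secular R ≤ secular ((1 + ω + ω / secular R) * R) :=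
      strictMonoOn_secular.monotoneOn (mem_Ioi.2 hR) (mem_Ioi.2 (by positivity)) (by nlinarith)
    calc ω = ω / secular R * secular R := by field_simp
      _ < (1 + ω + ω / secular R) * secular R := by gcongr; linarith
      _ ≤ _ := by gcongr
  have ha : ω * secular (ω * R) < ω := by
    have := secular_lt_half (mul_pos hω hR)
    nlinarith
  have hab : ω ≤ 1 + ω + ω / secular R := by have : 0 < ω / secular R := by positivity
                                             linarith
  have hc : ContinuousOn (fun x => x * secular (x * R)) (Icc ω (1 + ω + ω / secular R)) :=
    fun x hx => by
      have hx0 : 0 < x := hω.trans_le hx.1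
      exact (continuousAt_id.mul (ContinuousAt.comp (f := fun x => x * R)
        (continuousAt_secular (mul_pos hx0 hR)) (by fun_prop))).continuousWithinAt
  obtain ⟨x, hx, hxe⟩ := intermediate_value_Icc hab hc ⟨ha.le, hb.le⟩
  exact ⟨x, hω.trans_le hx.1, hxe⟩

open Classical in
/-- The positive solution `x` of the secular equation `x² R I₁(xR) K₁(xR) = ω`. -/
def secularRoot (ω R : ℝ) : ℝ :=
  if h : ∃ x, 0 < x ∧ x * secular (x * R) = ω then h.choose else 0

theorem secularRoot_pos {ω R : ℝ} (hω : 0 < ω) (hR : 0 < R) : 0 < secularRoot ω R := by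
  have h := exists_mul_secular_eq hω hR
  rw [secularRoot, dif_pos h]
  exact h.choose_spec.1

theorem mul_secular_secularRoot {ω R : ℝ} (hω : 0 < ω) (hR : 0 < R) : secularRoot ω R * secular (secularRoot ω R * R) = ω := by
  have h := exists_mul_secular_eq hω hR
  rw [secularRoot, dif_pos h]
  exact h.choose_spec.2

theorem lt_mul_secular_iff {ω R : ℝ} (hω : 0 < ω) (hR : 0 < R) {x : ℝ}
    (hx : 0 < x) :
    ω < x * secular (x * R) ↔ secularRoot ω R < x := by
  conv_lhs => rw [← mul_secular_secularRoot hω hR]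
  exact (strictMonoOn_mul_secular hR).lt_iff_lt (secularRoot_pos hω hR) hx

theorem mul_secular_lt_iff {ω R : ℝ} (hω : 0 < ω) (hR : 0 < R) {x : ℝ}
    (hx : 0 < x) :
    x * secular (x * R) < ω ↔ x < secularRoot ω R := by
  conv_lhs => rw [← mul_secular_secularRoot hω hR]
  exact (strictMonoOn_mul_secular hR).lt_iff_lt hx (secularRoot_pos hω hR)

theorem mul_secular_eq_iff {ω R : ℝ} (hω : 0 < ω) (hR : 0 < R) {x : ℝ}
    (hx : 0 < x) :
    x * secular (x * R) = ω ↔ x = secularRoot ω R := by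
  conv_lhs => rw [← mul_secular_secularRoot hω hR]
  exact (strictMonoOn_mul_secular hR).eq_iff_eq hx (secularRoot_pos hω hR)

theorem continuousOn_secularRoot {ω : ℝ} (hω : 0 < ω) :
    ContinuousOn (secularRoot ω) (Ioi 0) := by
  intro R hR
  have hR : 0 < R := hR
  have hc : ∀ x, 0 < x → ContinuousAt (fun R => x * secular (x * R)) R := fun x hx =>
    continuousAt_const.mul (ContinuousAt.comp (f := fun R => x * R)
      (continuousAt_secular (mul_pos hx hR)) (by fun_prop))
  have hpos : ∀ᶠ r in 𝓝 R, 0 < r := Ioi_mem_nhds hR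
  suffices h : Tendsto (secularRoot ω) (𝓝 R) (𝓝 (secularRoot ω R)) from
    ContinuousAt.continuousWithinAt h
  refine tendsto_order.2 ⟨fun l hl => ?_, fun u hu => ?_⟩
  · rcases le_or_gt l 0 with hl0 | hl0
    · filter_upwards [hpos] with r hr using hl0.trans_lt (secularRoot_pos hω hr)
    · filter_upwards [hpos, (hc l hl0).tendsto.eventually_lt_const
        ((mul_secular_lt_iff hω hR hl0).2 hl)] with r hr h using (mul_secular_lt_iff hω hr hl0).1 h
  · have hu0 : 0 < u := (secularRoot_pos hω hR).trans hu
    filter_upwards [hpos, (hc u hu0).tendsto.eventually_const_lt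
      ((lt_mul_secular_iff hω hR hu0).2 hu)] with r hr h using (lt_mul_secular_iff hω hr hu0).1 h

theorem strictAntiOn_secularRoot {ω : ℝ} (hω : 0 < ω) :
    StrictAntiOn (secularRoot ω) (Ioi 0) := by
  intro R hR S hS hRS
  have hR : 0 < R := hR
  have hk := secularRoot_pos hω hR
  rw [← lt_mul_secular_iff hω hS hk]
  nth_rw 1 [← mul_secular_secularRoot hω hR]
  exact mul_lt_mul_of_pos_left (strictMonoOn_secular (mem_Ioi.2 (mul_pos hk hR))
    (mem_Ioi.2 (mul_pos hk hS)) (by gcongr)) hk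

theorem tendsto_secularRoot_zero {ω : ℝ} (hω : 0 < ω) :
    Tendsto (secularRoot ω) (𝓝[>] 0) atTop := by
  refine tendsto_atTop.2 fun b => ?_
  set u := max b 1
  have hu : 0 < u := lt_max_of_lt_right one_pos
  have h1 : Tendsto (fun R => u * R) (𝓝[>] 0) (𝓝[>] 0) := by
    refine tendsto_nhdsWithin_iff.2 ⟨?_, ?_⟩
    · have : ContinuousAt (fun R => u * R) 0 := by fun_prop
      simpa [ContinuousAt] using this.tendsto.mono_left nhdsWithin_le_nhds
    · filter_upwards [self_mem_nhdsWithin] with R hR using mul_pos hu hR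
  have h2 := (tendsto_secular_zero.comp h1).const_mul u
  rw [mul_zero] at h2
  filter_upwards [self_mem_nhdsWithin, h2.eventually_lt_const hω] with R hR h
  exact (le_max_left b 1).trans ((mul_secular_lt_iff hω hR hu).1 h).le

theorem tendsto_secularRoot_atTop {ω : ℝ} (hω : 0 < ω) :
    Tendsto (secularRoot ω) atTop (𝓝 (2 * ω)) := by
  have hlim : ∀ u, 0 < u → Tendsto (fun R => u * secular (u * R)) atTop (𝓝 (u * (1 / 2))) :=
    fun u hu => (tendsto_secular_atTop.comp (tendsto_id.const_mul_atTop hu)).const_mul u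
  refine tendsto_order.2 ⟨fun l hl => ?_, fun u hu => ?_⟩
  · rcases le_or_gt l 0 with hl0 | hl0
    · filter_upwards [eventually_gt_atTop 0] with r hr using hl0.trans_lt (secularRoot_pos hω hr)
    · filter_upwards [eventually_gt_atTop 0, (hlim l hl0).eventually_lt_const
        (by linarith : l * (1 / 2) < ω)] with r hr h using (mul_secular_lt_iff hω hr hl0).1 h
  · have hu0 : 0 < u := by linarith
    filter_upwards [eventually_gt_atTop 0, (hlim u hu0).eventually_const_lt
        (by linarith : ω < u * (1 / 2))] with r hr h using (lt_mul_secular_iff hω hr hu0).1 h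

/-! ### Polar coordinates and the divergence theorem for radial fields -/

/-- The point with polar coordinates `(r, θ)`. -/
def polarPoint (r θ : ℝ) : Plane := !₂[r * Real.cos θ, r * Real.sin θ]

theorem continuous_polarPoint : Continuous fun p : ℝ × ℝ => polarPoint p.1 p.2 := by
  unfold polarPoint
  refine (PiLp.continuous_toLp 2 _).comp (continuous_pi fun i => ?_)
  fin_cases i <;> simp <;> fun_prop

theorem continuous_polarPoint_right (r : ℝ) : Continuous (polarPoint r) :=
  continuous_polarPoint.comp (by fun_prop : Continuous fun θ : ℝ => (r, θ))

theorem norm_polarPoint (r θ : ℝ) : ‖polarPoint r θ‖ = |r| := by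
  rw [EuclideanSpace.norm_eq, ← Real.sqrt_sq_eq_abs]
  congr 1
  simp only [polarPoint, Fin.sum_univ_two, Real.norm_eq_abs, sq_abs, PiLp.toLp_apply,
    Matrix.cons_val_zero, Matrix.cons_val_one]
  linear_combination r ^ 2 * Real.cos_sq_add_sin_sq θ

theorem polarPoint_periodic (r : ℝ) : Function.Periodic (polarPoint r) (2 * Real.pi) := fun θ => by
  simp [polarPoint]

theorem polarPoint_eq_smul (r θ : ℝ) : polarPoint r θ = r • polarPoint 1 θ := by
  ext i; fin_cases i <;> simp [polarPoint]

/-- The volume-preserving identification of the plane with `ℝ × ℝ`. -/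
def planeEquiv : Plane ≃ᵐ ℝ × ℝ :=
  (MeasurableEquiv.toLp 2 (Fin 2 → ℝ)).symm.trans MeasurableEquiv.finTwoArrow

theorem measurePreserving_planeEquiv : MeasurePreserving planeEquiv volume volume :=
  (EuclideanSpace.volume_preserving_symm_measurableEquiv_toLp (Fin 2)).trans
    (volume_preserving_finTwoArrow ℝ)

theorem planeEquiv_symm_polarCoord (p : ℝ × ℝ) :
    planeEquiv.symm (polarCoord.symm p) = polarPoint p.1 p.2 := by
  rw [MeasurableEquiv.symm_apply_eq]
  simp [planeEquiv, polarPoint, polarCoord, MeasurableEquiv.finTwoArrow]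

theorem integral_eq_polar {h : Plane → ℂ} (hh : Integrable h) :
    ∫ x, h x = ∫ θ in Ioc 0 (2 * Real.pi), ∫ r in Ioi (0 : ℝ), r • h (polarPoint r θ) := by
  have hs := measurePreserving_planeEquiv.symm
  have h1 : ∫ x, h x = ∫ p : ℝ × ℝ, h (planeEquiv.symm p) :=
    (hs.integral_comp planeEquiv.symm.measurableEmbedding h).symm
  have hi : Integrable (fun p : ℝ × ℝ => h (planeEquiv.symm p)) :=
    (hs.integrable_comp_emb planeEquiv.symm.measurableEmbedding).2 hh
  have hi2 : IntegrableOn (fun p : ℝ × ℝ => p.1 • h (polarPoint p.1 p.2)) polarCoord.target := by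
    have h2 := (integrableOn_image_iff_integrableOn_abs_det_fderiv_smul volume
      polarCoord.open_target.measurableSet
      (fun p _ => (hasFDerivAt_polarCoord_symm p).hasFDerivWithinAt) polarCoord.symm.injOn
      (fun p : ℝ × ℝ => h (planeEquiv.symm p))).1 hi.integrableOn
    refine h2.congr_fun (fun p hp => ?_) polarCoord.open_target.measurableSet
    have hp1 : 0 < p.1 := hp.1
    simp only [det_fderivPolarCoordSymm, abs_of_pos hp1, planeEquiv_symm_polarCoord]
  rw [h1, ← integral_comp_polarCoord_symm]
  simp only [planeEquiv_symm_polarCoord]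
  have hpt : polarCoord.target = Ioi (0 : ℝ) ×ˢ Ioo (-Real.pi) Real.pi := rfl
  rw [IntegrableOn, hpt, Measure.volume_eq_prod, ← Measure.prod_restrict] at hi2
  rw [hpt, Measure.volume_eq_prod, ← Measure.prod_restrict, integral_prod_symm _ hi2]
  rw [← integral_Ioc_eq_integral_Ioo, ← intervalIntegral.integral_of_le (by linarith [Real.pi_pos]),
    ← intervalIntegral.integral_of_le (by linarith [Real.pi_pos])]
  have hper : Function.Periodic (fun θ => ∫ r in Ioi (0 : ℝ), r • h (polarPoint r θ))
      (2 * Real.pi) := fun θ => by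
    simp only [polarPoint_periodic _ θ]
  have := hper.intervalIntegral_add_eq (-Real.pi) 0
  rw [zero_add, show -Real.pi + 2 * Real.pi = Real.pi by ring] at this
  exact this

theorem integral_arcLength {R : ℝ} (hR : 0 ≤ R) {g : Plane → ℂ} (hg : Continuous g) :
    ∫ x, g x ∂arcLength R = R • ∫ θ in Ioc 0 (2 * Real.pi), g (polarPoint R θ) := by
  have hm : arcLength R = ENNReal.ofReal R •
    Measure.map (polarPoint R) (volume.restrict (Ioc 0 (2 * Real.pi))) := rfl
  rw [hm, integral_smul_measure, ENNReal.toReal_ofReal hR,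
    integral_map (continuous_polarPoint_right R).aemeasurable hg.aestronglyMeasurable]

instance isFiniteMeasure_arcLength (R : ℝ) : IsFiniteMeasure (arcLength R) := by
  have hm : arcLength R = ENNReal.ofReal R •
    Measure.map (polarPoint R) (volume.restrict (Ioc 0 (2 * Real.pi))) := rfl
  rw [hm]
  constructor
  rw [Measure.smul_apply, Measure.map_apply (continuous_polarPoint_right R).measurable .univ]
  simp only [preimage_univ, Measure.restrict_apply MeasurableSet.univ, univ_inter,
    Real.volume_Ioc, smul_eq_mul]
  exact ENNReal.mul_lt_top ENNReal.ofReal_lt_top ENNReal.ofReal_lt_top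

theorem ae_norm_eq_arcLength {R : ℝ} (hR : 0 ≤ R) : ∀ᵐ x ∂arcLength R, ‖x‖ = R := by
  have hm : arcLength R = ENNReal.ofReal R •
    Measure.map (polarPoint R) (volume.restrict (Ioc 0 (2 * Real.pi))) := rfl
  rw [hm]
  refine Measure.ae_smul_measure ?_ _
  rw [ae_map_iff (continuous_polarPoint_right R).aemeasurable
    (measurableSet_eq_fun (by fun_prop) (by fun_prop))]
  exact ae_of_all _ fun θ => by rw [norm_polarPoint, abs_of_nonneg hR]

/-- The radial vector field of magnitude `f(|x|)`. -/
def radialField (f : ℝ → ℝ) (i : Fin 2) (x : Plane) : ℝ := f ‖x‖ * (x i / ‖x‖)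

theorem abs_coord_div_norm_le (x : Plane) (i : Fin 2) : |x i / ‖x‖| ≤ 1 := by
  rw [abs_div, abs_norm]
  exact div_le_one_of_le₀ (by simpa using PiLp.norm_apply_le x i) (norm_nonneg x)

theorem radialField_polarPoint {r : ℝ} (hr : 0 < r) (f : ℝ → ℝ) (i : Fin 2) (θ : ℝ) :
    radialField f i (polarPoint r θ) = f r * polarPoint 1 θ i := by
  rw [radialField, norm_polarPoint, abs_of_pos hr, polarPoint_eq_smul r θ]
  simp only [PiLp.smul_apply, smul_eq_mul]
  field_simp

/-- `X` is a bounded vector field on `Ω` with `div X + |X|² = κ²`, in the integrated form given by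
the divergence theorem: `c` is the constant value on the circle of radius `R` of the normal
component of `X` pointing out of `Ω`. -/
structure IsRiccatiField (Ω : Set Plane) (R κ c : ℝ) (X : Fin 2 → Plane → ℝ) : Prop where
  measurable : ∀ i, AEStronglyMeasurable (X i) (volume.restrict Ω)
  bounded : ∃ B, ∀ i, ∀ x ∈ Ω, |X i x| ≤ B
  divergence : ∀ ψ : Plane → ℂ, ContDiff ℝ 1 ψ → HasCompactSupport ψ →
    ∫ x in Ω, (∑ i, X i x • pderiv i ψ x + (κ ^ 2 - ∑ i, X i x ^ 2) • ψ x)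
      = c • ∫ x, ψ x ∂arcLength R

theorem continuous_pderiv {ψ : Plane → ℂ} (hψ : ContDiff ℝ 1 ψ) (i : Fin 2) :
    Continuous (pderiv i ψ) :=
  (hψ.continuous_fderiv one_ne_zero).clm_apply continuous_const

theorem hasCompactSupport_pderiv {F : Type*} [NormedAddCommGroup F] [NormedSpace ℝ F]
    {ψ : Plane → F} (hψ : HasCompactSupport ψ) (i : Fin 2) :
    HasCompactSupport (pderiv i ψ) :=
  hψ.fderiv_apply (𝕜 := ℝ) _

theorem radialField_aestronglyMeasurable {f : ℝ → ℝ} {Ω : Set Plane} (hΩ : MeasurableSet Ω)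
    (hf : ContinuousOn (fun x : Plane => f ‖x‖) Ω) (i : Fin 2) :
    AEStronglyMeasurable (radialField f i) (volume.restrict Ω) :=
  (hf.aestronglyMeasurable hΩ).mul
    (by fun_prop : Measurable fun x : Plane => x i / ‖x‖).aestronglyMeasurable

theorem norm_radialField_le {f : ℝ → ℝ} {B : ℝ} {x : Plane} (hB : |f ‖x‖| ≤ B) (i : Fin 2) :
    |radialField f i x| ≤ B := by
  rw [radialField, abs_mul]
  calc _ ≤ |f ‖x‖| * 1 := by gcongr; exact abs_coord_div_norm_le x i
    _ ≤ B := by rwa [mul_one]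

theorem integrableOn_mul_of_bounded {Ω : Set Plane} (hΩ : MeasurableSet Ω) {a : Plane → ℝ}
    (ha : AEStronglyMeasurable a (volume.restrict Ω)) {B : ℝ} (hB : ∀ x ∈ Ω, |a x| ≤ B)
    {ψ : Plane → ℂ} (hψ : Integrable ψ) : IntegrableOn (fun x => a x • ψ x) Ω := by
  refine Integrable.mono' (hψ.norm.integrableOn.const_mul B) (ha.smul hψ.aestronglyMeasurable.restrict) ?_
  filter_upwards [ae_restrict_mem hΩ] with x hx
  rw [norm_smul, Real.norm_eq_abs]
  gcongr
  exact hB x hx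

theorem sum_polarPoint_smul_pderiv (ψ : Plane → ℂ) (x : Plane) (θ : ℝ) :
    ∑ i, polarPoint 1 θ i • pderiv i ψ x = fderiv ℝ ψ x (polarPoint 1 θ) := by
  have : polarPoint 1 θ = ∑ i, polarPoint 1 θ i • EuclideanSpace.single i (1 : ℝ) := by
    ext j; fin_cases j <;> simp [polarPoint]
  conv_rhs => rw [this, map_sum]
  simp [pderiv]

theorem sum_sq_polarPoint_one (θ : ℝ) : ∑ i, polarPoint 1 θ i ^ 2 = 1 := by
  simp [polarPoint, Fin.sum_univ_two]

/-- The integrand of the divergence theorem along a ray is `d/dr (r f(r) ψ)`. -/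
theorem hasDerivAt_ray {f : ℝ → ℝ} {κ r : ℝ} (hr : 0 < r)
    (hf : HasDerivAt (fun s => s * f s) (r * (κ ^ 2 - f r ^ 2)) r)
    {ψ : Plane → ℂ} (hψ : ContDiff ℝ 1 ψ) (θ : ℝ) :
    HasDerivAt (fun s => (s * f s) • ψ (polarPoint s θ))
      (r • (∑ i, radialField f i (polarPoint r θ) • pderiv i ψ (polarPoint r θ)
        + (κ ^ 2 - ∑ i, radialField f i (polarPoint r θ) ^ 2) • ψ (polarPoint r θ))) r := by
  have hp : HasDerivAt (fun s => polarPoint s θ) (polarPoint 1 θ) r := by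
    have := (hasDerivAt_id r).smul_const (polarPoint 1 θ)
    rw [one_smul] at this
    refine this.congr_of_eventuallyEq (Eventually.of_forall fun s => polarPoint_eq_smul s θ)
  have h2 := ((hψ.differentiable one_ne_zero) (polarPoint r θ)).hasFDerivAt.comp_hasDerivAt r hp
  refine (hf.smul h2).congr_deriv ?_
  simp only [radialField_polarPoint hr, mul_smul, ← Finset.smul_sum, sum_polarPoint_smul_pderiv,
    mul_pow, ← Finset.mul_sum, sum_sq_polarPoint_one, mul_one, Function.comp_apply, smul_add]

theorem integrableOn_divergence_integrand {Ω : Set Plane} (hΩ : MeasurableSet Ω) {κ : ℝ}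
    {X : Fin 2 → Plane → ℝ} (hX : ∀ i, AEStronglyMeasurable (X i) (volume.restrict Ω))
    {B : ℝ} (hB : ∀ i, ∀ x ∈ Ω, |X i x| ≤ B) {ψ : Plane → ℂ} (hψ : ContDiff ℝ 1 ψ)
    (hc : HasCompactSupport ψ) :
    IntegrableOn (fun x => ∑ i, X i x • pderiv i ψ x + (κ ^ 2 - ∑ i, X i x ^ 2) • ψ x) Ω := by
  refine Integrable.add (integrable_finsetSum _ fun i _ => ?_) ?_
  · exact integrableOn_mul_of_bounded hΩ (hX i) (hB i)
      ((continuous_pderiv hψ i).integrable_of_hasCompactSupport (hasCompactSupport_pderiv hc i))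
  · refine integrableOn_mul_of_bounded hΩ (B := κ ^ 2 + 2 * B ^ 2) ?_ (fun x hx => ?_)
      (hψ.continuous.integrable_of_hasCompactSupport hc)
    · simp only [Fin.sum_univ_two]
      exact aestronglyMeasurable_const.sub (((hX 0).pow 2).add ((hX 1).pow 2))
    · have h0 := sq_le_sq' (neg_le_of_abs_le (hB 0 x hx)) (le_of_abs_le (hB 0 x hx))
      have h1 := sq_le_sq' (neg_le_of_abs_le (hB 1 x hx)) (le_of_abs_le (hB 1 x hx))
      rw [Fin.sum_univ_two, abs_le]
      constructor <;> nlinarith [sq_nonneg (X 0 x), sq_nonneg (X 1 x), sq_nonneg κ]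

theorem measurableSet_disk (R : ℝ) : MeasurableSet (disk R) :=
  (isOpen_lt continuous_norm continuous_const).measurableSet

theorem measurableSet_exterior (R : ℝ) : MeasurableSet (exterior R) :=
  (isOpen_lt continuous_const continuous_norm).measurableSet

theorem isOpen_disk (R : ℝ) : IsOpen (disk R) := isOpen_lt continuous_norm continuous_const

theorem isOpen_exterior (R : ℝ) : IsOpen (exterior R) := isOpen_lt continuous_const continuous_norm

/-- Along almost every ray, integration over `Ω` reduces to integration over a set of radii. -/
theorem setIntegral_eq_polar {Ω : Set Plane} (hΩ : MeasurableSet Ω) {s : Set ℝ}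
    (hs : MeasurableSet s) (hs0 : s ⊆ Ioi 0)
    (hΩs : ∀ r > 0, ∀ θ, polarPoint r θ ∈ Ω ↔ r ∈ s) {h : Plane → ℂ} (hh : IntegrableOn h Ω) :
    ∫ x in Ω, h x = ∫ θ in Ioc 0 (2 * Real.pi), ∫ r in s, r • h (polarPoint r θ) := by
  rw [← integral_indicator hΩ, integral_eq_polar ((integrable_indicator_iff hΩ).2 hh)]
  congr 1
  funext θ
  have : ∀ r ∈ Ioi (0 : ℝ), r • Ω.indicator h (polarPoint r θ)
      = s.indicator (fun r => r • h (polarPoint r θ)) r := fun r hr => by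
    by_cases hrs : r ∈ s
    · rw [indicator_of_mem hrs, indicator_of_mem ((hΩs r hr θ).2 hrs)]
    · rw [indicator_of_notMem hrs, indicator_of_notMem (fun h => hrs ((hΩs r hr θ).1 h)), smul_zero]
  rw [setIntegral_congr_fun measurableSet_Ioi this, setIntegral_indicator hs,
    inter_eq_right.2 hs0]

/-- The hypothesis `hf` is the equation `div X + |X|² = κ²` for the radial field `X` of magnitude `f`,
namely `(r f)' = r (κ² - f²)`. Since `r f` vanishes at the origin, only the circle contributes to
the divergence theorem. -/
theorem isRiccatiField_disk {f : ℝ → ℝ} {R κ : ℝ} (hR : 0 < R) (hc : Continuous f)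
    (hf : ∀ r > 0, HasDerivAt (fun s => s * f s) (r * (κ ^ 2 - f r ^ 2)) r) :
    IsRiccatiField (disk R) R κ (f R) (radialField f) := by
  obtain ⟨B, hB⟩ := isCompact_Icc.exists_bound_of_continuousOn (hc.continuousOn (s := Icc 0 R))
  have hmeas := radialField_aestronglyMeasurable (f := f) (measurableSet_disk R)
    (hc.comp continuous_norm).continuousOn
  have hbd : ∀ i, ∀ x ∈ disk R, |radialField f i x| ≤ B := fun i x hx =>
    norm_radialField_le (hB _ ⟨norm_nonneg x, le_of_lt hx⟩) i
  refine ⟨hmeas, ⟨B, hbd⟩, fun ψ hψ hcs => ?_⟩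
  rw [setIntegral_eq_polar (measurableSet_disk R) measurableSet_Ioo (s := Ioo 0 R) (fun r hr => hr.1)
    (fun r hr θ => by
      simp only [disk, mem_ofPred_eq, norm_polarPoint, abs_of_pos hr, mem_Ioo]
      exact ⟨fun h => ⟨hr, h⟩, fun h => h.2⟩)
    (integrableOn_divergence_integrand (measurableSet_disk R) hmeas hbd hψ hcs),
    integral_arcLength hR.le hψ.continuous, smul_smul, ← integral_smul]
  congr 1
  funext θ
  have hcont : ContinuousOn (fun s => (s * f s) • ψ (polarPoint s θ)) (Icc 0 R) := by
    refine Continuous.continuousOn ?_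
    exact (continuous_id.mul hc).smul (hψ.continuous.comp
      (continuous_polarPoint.comp (by fun_prop : Continuous fun s : ℝ => (s, θ))))
  have hint : IntegrableOn (fun r => r • (∑ i, radialField f i (polarPoint r θ) • pderiv i ψ (polarPoint r θ)
        + (κ ^ 2 - ∑ i, radialField f i (polarPoint r θ) ^ 2) • ψ (polarPoint r θ))) (Ioo 0 R) := by
    have hg : Continuous fun r => r • (f r • fderiv ℝ ψ (polarPoint r θ) (polarPoint 1 θ)
        + (κ ^ 2 - f r ^ 2) • ψ (polarPoint r θ)) := by
      have hp : Continuous fun s => polarPoint s θ :=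
        continuous_polarPoint.comp (by fun_prop : Continuous fun s : ℝ => (s, θ))
      have h1 : Continuous fun r => fderiv ℝ ψ (polarPoint r θ) (polarPoint 1 θ) :=
        ((hψ.continuous_fderiv one_ne_zero).comp hp).clm_apply continuous_const
      exact continuous_id.smul ((hc.smul h1).add ((continuous_const.sub (hc.pow 2)).smul (hψ.continuous.comp hp)))
    refine ((hg.integrableOn_Icc (a := 0) (b := R)).mono_set Ioo_subset_Icc_self).congr_fun
      (fun r hr => ?_) measurableSet_Ioo
    simp only [radialField_polarPoint hr.1, mul_smul, ← Finset.smul_sum, sum_polarPoint_smul_pderiv,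
      mul_pow, ← Finset.mul_sum, sum_sq_polarPoint_one, mul_one]
  have := intervalIntegral.integral_eq_sub_of_hasDerivAt_of_le hR.le hcont
    (fun r hr => hasDerivAt_ray hr.1 (hf r hr.1) hψ θ)
    ((intervalIntegrable_iff_integrableOn_Ioo_of_le hR.le).2 hint)
  rw [intervalIntegral.integral_of_le hR.le, integral_Ioc_eq_integral_Ioo] at this
  rw [this, zero_mul, zero_smul, sub_zero, mul_comm]

/-- The counterpart of `isRiccatiField_disk` on the exterior, where the outward normal points to the
origin. -/
theorem isRiccatiField_exterior {f : ℝ → ℝ} {R κ B : ℝ} (hR : 0 < R) (hc : ContinuousOn f (Ioi 0))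
    (hf : ∀ r > 0, HasDerivAt (fun s => s * f s) (r * (κ ^ 2 - f r ^ 2)) r)
    (hB : ∀ r ≥ R, |f r| ≤ B) :
    IsRiccatiField (exterior R) R κ (-f R) (radialField f) := by
  have hmeas := radialField_aestronglyMeasurable (f := f) (measurableSet_exterior R)
    (hc.comp continuous_norm.continuousOn fun x hx => hR.trans hx)
  have hbd : ∀ i, ∀ x ∈ exterior R, |radialField f i x| ≤ B := fun i x hx =>
    norm_radialField_le (hB _ (le_of_lt hx)) i
  refine ⟨hmeas, ⟨B, hbd⟩, fun ψ hψ hcs => ?_⟩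
  rw [setIntegral_eq_polar (measurableSet_exterior R) measurableSet_Ioi (s := Ioi R)
    (fun r hr => hR.trans hr)
    (fun r hr θ => by
      simp only [exterior, mem_ofPred_eq, norm_polarPoint, abs_of_pos hr, mem_Ioi])
    (integrableOn_divergence_integrand (measurableSet_exterior R) hmeas hbd hψ hcs),
    integral_arcLength hR.le hψ.continuous, smul_smul, ← integral_smul]
  congr 1
  funext θ
  have hp : Continuous fun s => polarPoint s θ :=
    continuous_polarPoint.comp (by fun_prop : Continuous fun s : ℝ => (s, θ))
  obtain ⟨M, hM⟩ := hcs.isCompact.isBounded.exists_norm_le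
  have hout : ∀ r, max M R < r → ψ =ᶠ[𝓝 (polarPoint r θ)] 0 := fun r hr => by
    refine notMem_tsupport_iff_eventuallyEq.1 fun hmem => ?_
    have := hM _ hmem
    rw [norm_polarPoint] at this
    have h1 := le_abs_self r
    have h2 := (le_max_left M R).trans_lt hr
    linarith
  have hint : IntegrableOn (fun r => r • (∑ i, radialField f i (polarPoint r θ) • pderiv i ψ (polarPoint r θ)
        + (κ ^ 2 - ∑ i, radialField f i (polarPoint r θ) ^ 2) • ψ (polarPoint r θ))) (Ioi R) := by
    have hg : ContinuousOn (fun r => r • (f r • fderiv ℝ ψ (polarPoint r θ) (polarPoint 1 θ)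
        + (κ ^ 2 - f r ^ 2) • ψ (polarPoint r θ))) (Icc R (max M R)) := by
      have hc' : ContinuousOn f (Icc R (max M R)) := hc.mono fun r hr => hR.trans_le hr.1
      have h1 : Continuous fun r => fderiv ℝ ψ (polarPoint r θ) (polarPoint 1 θ) :=
        ((hψ.continuous_fderiv one_ne_zero).comp hp).clm_apply continuous_const
      exact continuousOn_id.smul ((hc'.smul h1.continuousOn).add
        ((continuousOn_const.sub (hc'.pow 2)).smul (hψ.continuous.comp hp).continuousOn))
    have h1 := ((hg.integrableOn_Icc (μ := volume)).mono_set (Ioc_subset_Icc_self (a := R) (b := max M R))).congr_fun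
      (f := _) (g := fun r => r • (∑ i, radialField f i (polarPoint r θ) • pderiv i ψ (polarPoint r θ)
        + (κ ^ 2 - ∑ i, radialField f i (polarPoint r θ) ^ 2) • ψ (polarPoint r θ)))
      (fun r hr => by
        simp only [radialField_polarPoint (hR.trans hr.1), mul_smul, ← Finset.smul_sum,
          sum_polarPoint_smul_pderiv, mul_pow, ← Finset.mul_sum, sum_sq_polarPoint_one, mul_one])
      measurableSet_Ioc
    have h2 : IntegrableOn (fun r => r • (∑ i, radialField f i (polarPoint r θ) • pderiv i ψ (polarPoint r θ)
        + (κ ^ 2 - ∑ i, radialField f i (polarPoint r θ) ^ 2) • ψ (polarPoint r θ))) (Ioi (max M R)) := by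
      refine (integrableOn_zero (s := Ioi (max M R))).congr_fun (fun r hr => ?_) measurableSet_Ioi
      have h3 := hout r hr
      simp only [pderiv, h3.fderiv_eq, h3.eq_of_nhds]
      simp
    rw [← Ioc_union_Ioi_eq_Ioi (le_max_right M R)]
    exact h1.union h2
  have := integral_Ioi_of_hasDerivAt_of_tendsto' (a := R) (m := 0)
    (fun r hr => hasDerivAt_ray (hR.trans_le hr) (hf r (hR.trans_le hr)) hψ θ) hint ?_
  · rw [this, zero_sub, ← neg_smul]
    congr 1
    ring
  · refine tendsto_const_nhds.congr' ?_
    filter_upwards [eventually_gt_atTop (max M R)] with r hr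
    rw [(hout r hr).eq_of_nhds]
    simp

/-! ### Radial fields from Bessel functions -/

/-- The logarithmic derivative of `r ↦ I₀(κr)`. -/
def logDerivI (κ r : ℝ) : ℝ := κ * (besselI 1 (κ * r) / besselI 0 (κ * r))

/-- The logarithmic derivative of `r ↦ K₀(κr)`. -/
def logDerivK (κ r : ℝ) : ℝ := -(κ * (besselK 1 (κ * r) / besselK 0 (κ * r)))

theorem continuous_logDerivI (κ : ℝ) : Continuous (logDerivI κ) := by
  unfold logDerivI
  have h0 := continuous_besselI_zero
  have h1 := continuous_besselI_one
  exact continuous_const.mul ((h1.comp (by fun_prop)).div (h0.comp (by fun_prop))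
    fun r => (besselI_zero_pos _).ne')

theorem hasDerivAt_mul_logDerivI {κ r : ℝ} (hκ : 0 < κ) (hr : 0 < r) :
    HasDerivAt (fun s => s * logDerivI κ s) (r * (κ ^ 2 - logDerivI κ r ^ 2)) r := by
  have hs : HasDerivAt (fun s => κ * s) κ r := by simpa using (hasDerivAt_id r).const_mul κ
  have hpos : 0 < κ * r := by positivity
  have h0 := (hasDerivAt_besselI_zero (κ * r)).comp r hs
  have h1 := (hasDerivAt_besselI_one hpos.ne').comp r hs
  have hne := (besselI_zero_pos (κ * r)).ne'
  refine ((hasDerivAt_id r).mul ((h1.div h0 hne).const_mul κ)).congr_deriv ?_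
  simp only [logDerivI, id, Function.comp_apply, Pi.div_apply]
  field_simp
  ring

theorem continuousOn_logDerivK {κ : ℝ} (hκ : 0 < κ) : ContinuousOn (logDerivK κ) (Ioi 0) := by
  intro r hr
  have hr : 0 < r := hr
  have hpos : 0 < κ * r := by positivity
  have h0 : ContinuousAt (fun s => besselK 0 (κ * s)) r := ContinuousAt.comp (f := fun s => κ * s)
    (hasDerivAt_besselK_zero hpos).continuousAt (by fun_prop)
  have h1 : ContinuousAt (fun s => besselK 1 (κ * s)) r := ContinuousAt.comp (f := fun s => κ * s)
    (hasDerivAt_besselK_one hpos).continuousAt (by fun_prop)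
  exact (continuousAt_const.mul (h1.div h0 (besselK_zero_pos hpos).ne')).neg.continuousWithinAt

theorem hasDerivAt_mul_logDerivK {κ r : ℝ} (hκ : 0 < κ) (hr : 0 < r) :
    HasDerivAt (fun s => s * logDerivK κ s) (r * (κ ^ 2 - logDerivK κ r ^ 2)) r := by
  have hs : HasDerivAt (fun s => κ * s) κ r := by simpa using (hasDerivAt_id r).const_mul κ
  have hpos : 0 < κ * r := by positivity
  have h0 := (hasDerivAt_besselK_zero hpos).comp r hs
  have h1 := (hasDerivAt_besselK_one hpos).comp r hs
  have hne := (besselK_zero_pos hpos).ne'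
  refine ((hasDerivAt_id r).mul ((h1.div h0 hne).const_mul κ).neg).congr_deriv ?_
  simp only [logDerivK, id, Function.comp_apply, Pi.div_apply, Pi.neg_apply]
  field_simp
  ring

theorem abs_logDerivK_le {κ R r : ℝ} (hκ : 0 < κ) (hR : 0 < R) (hr : R ≤ r) :
    |logDerivK κ r| ≤ κ * (1 + 1 / (κ * R)) := by
  have hr0 : 0 < r := hR.trans_le hr
  have hpos : 0 < κ * r := by positivity
  have h0 := besselK_zero_pos hpos
  have h1 := besselK_one_pos hpos
  rw [logDerivK, abs_neg, abs_of_pos (by positivity)]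
  gcongr
  rw [div_le_iff₀ h0]
  refine (besselK_one_le hpos).trans ?_
  gcongr

theorem isRiccatiField_logDerivI {κ R : ℝ} (hκ : 0 < κ) (hR : 0 < R) :
    IsRiccatiField (disk R) R κ (logDerivI κ R) (radialField (logDerivI κ)) :=
  isRiccatiField_disk hR (continuous_logDerivI κ) fun _ hr => hasDerivAt_mul_logDerivI hκ hr

theorem isRiccatiField_logDerivK {κ R : ℝ} (hκ : 0 < κ) (hR : 0 < R) :
    IsRiccatiField (exterior R) R κ (-logDerivK κ R) (radialField (logDerivK κ)) :=
  isRiccatiField_exterior hR (continuousOn_logDerivK hκ) (fun _ hr => hasDerivAt_mul_logDerivK hκ hr)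
    fun _ hr => abs_logDerivK_le hκ hR hr

theorem logDerivI_pos {κ r : ℝ} (hκ : 0 < κ) (hr : 0 < r) : 0 < logDerivI κ r := by
  have := besselI_pos (mul_pos hκ hr) 1
  have := besselI_zero_pos (κ * r)
  unfold logDerivI
  positivity

theorem neg_logDerivK_pos {κ r : ℝ} (hκ : 0 < κ) (hr : 0 < r) : 0 < -logDerivK κ r := by
  have := besselK_one_pos (mul_pos hκ hr)
  have := besselK_zero_pos (mul_pos hκ hr)
  rw [logDerivK, neg_neg]
  positivity

/-- Let `c = (log I₀(κr))'` and `d = -(log K₀(κr))'` at `r = R`, the outward normal components of the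
two Riccati fields. By the Wronskian, `1/c + 1/d = 1 / (κ F(κR))`. -/
theorem inv_logDeriv_add {κ R : ℝ} (hκ : 0 < κ) (hR : 0 < R) :
    κ * secular (κ * R) * ((logDerivI κ R)⁻¹ + (-logDerivK κ R)⁻¹) = 1 := by
  have hpos := mul_pos hκ hR
  have h1 := besselI_pos hpos 1
  have h2 := besselI_zero_pos (κ * R)
  have h3 := besselK_one_pos hpos
  have h4 := besselK_zero_pos hpos
  rw [← besselWronskian hpos, logDerivI, logDerivK, neg_neg, secular]
  field_simp

/-! ### Convergence in `L²` -/

theorem eLpNorm_two_sq {α E : Type*} [MeasurableSpace α] [NormedAddCommGroup E] (μ : Measure α)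
    (f : α → E) : eLpNorm f 2 μ ^ 2 = ∫⁻ x, ‖f x‖ₑ ^ 2 ∂μ := by
  have := eLpNorm_nnreal_pow_eq_lintegral (f := f) (μ := μ) (p := 2) two_ne_zero
  simpa using! this

/-- Convergence of a sequence of functions in `L²(μ)`. -/
def L2Tendsto (μ : Measure Plane) (a : ℕ → Plane → ℂ) (b : Plane → ℂ) : Prop :=
  Tendsto (fun n => eLpNorm (fun x => a n x - b x) 2 μ) atTop (𝓝 0)

theorem L2Tendsto.congr_ae {μ : Measure Plane} {a a' : ℕ → Plane → ℂ} {b b' : Plane → ℂ}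
    (h : L2Tendsto μ a b) (ha : ∀ n, a n =ᵐ[μ] a' n) (hb : b =ᵐ[μ] b') : L2Tendsto μ a' b' := by
  refine Tendsto.congr (fun n => eLpNorm_congr_ae ?_) h
  filter_upwards [ha n, hb] with x h1 h2
  rw [h1, h2]

theorem L2Tendsto.mono_measure {μ ν : Measure Plane} {a : ℕ → Plane → ℂ} {b : Plane → ℂ}
    (h : L2Tendsto μ a b) (hle : ν ≤ μ) : L2Tendsto ν a b :=
  tendsto_of_tendsto_of_tendsto_of_le_of_le tendsto_const_nhds h (fun _ => zero_le)
    fun _ => eLpNorm_mono_measure _ hle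

theorem l2Tendsto_of_le {μ : Measure Plane} {a : ℕ → Plane → ℂ} {b : Plane → ℂ} {ε : ℕ → ℝ≥0∞}
    (hε : Tendsto ε atTop (𝓝 0)) (h : ∀ n, eLpNorm (fun x => a n x - b x) 2 μ ≤ ε n) :
    L2Tendsto μ a b :=
  tendsto_of_tendsto_of_tendsto_of_le_of_le tendsto_const_nhds hε (fun _ => zero_le) h

theorem L2Tendsto.add {μ : Measure Plane} {a a' : ℕ → Plane → ℂ} {b b' : Plane → ℂ}
    (h : L2Tendsto μ a b) (h' : L2Tendsto μ a' b')
    (hm : ∀ n, AEStronglyMeasurable (a n) μ) (hm' : ∀ n, AEStronglyMeasurable (a' n) μ)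
    (hb : AEStronglyMeasurable b μ) (hb' : AEStronglyMeasurable b' μ) :
    L2Tendsto μ (fun n x => a n x + a' n x) (fun x => b x + b' x) := by
  have hs := Tendsto.add h h'
  rw [add_zero] at hs
  refine l2Tendsto_of_le hs fun n => ?_
  refine le_trans (le_of_eq ?_) (eLpNorm_add_le ((hm n).sub hb) ((hm' n).sub hb') (by norm_num))
  congr 1
  funext x
  simp only [Pi.add_apply]
  ring

theorem L2Tendsto.mul_bounded {μ : Measure Plane} {a : ℕ → Plane → ℂ} {b : Plane → ℂ}
    (h : L2Tendsto μ a b) {w : Plane → ℂ} {B : ℝ} (hB : ∀ᵐ x ∂μ, ‖w x‖ ≤ B) :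
    L2Tendsto μ (fun n x => w x * a n x) (fun x => w x * b x) := by
  have hs := ENNReal.Tendsto.const_mul (a := ENNReal.ofReal B) h (Or.inr ENNReal.ofReal_ne_top)
  rw [mul_zero] at hs
  refine l2Tendsto_of_le hs fun n => ?_
  refine eLpNorm_le_mul_eLpNorm_of_ae_le_mul ?_ 2
  filter_upwards [hB] with x hx
  rw [← mul_sub, norm_mul]
  gcongr

/-- Dominated convergence in `L²`. -/
theorem l2Tendsto_of_dominated {μ : Measure Plane} {a : ℕ → Plane → ℂ} {b : Plane → ℂ}
    (bound : Plane → ℝ) (hbd : MemLp bound 2 μ)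
    (ham : ∀ n, AEStronglyMeasurable (a n) μ) (hbm : AEStronglyMeasurable b μ)
    (hle : ∀ n, ∀ᵐ x ∂μ, ‖a n x - b x‖ ≤ bound x)
    (hlim : ∀ᵐ x ∂μ, Tendsto (fun n => a n x) atTop (𝓝 (b x))) : L2Tendsto μ a b := by
  have key : Tendsto (fun n => ∫⁻ x, ‖a n x - b x‖ₑ ^ 2 ∂μ) atTop (𝓝 (∫⁻ _, 0 ∂μ)) := by
    refine tendsto_lintegral_of_dominated_convergence' (fun x => ‖bound x‖ₑ ^ 2)
      (fun n => ((ham n).sub hbm).enorm.pow_const 2) (fun n => ?_) ?_ ?_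
    · filter_upwards [hle n] with x hx
      gcongr
      exact enorm_le_iff_norm_le.2 (hx.trans (le_abs_self _))
    · rw [← eLpNorm_two_sq]
      exact ENNReal.pow_ne_top hbd.eLpNorm_ne_top
    · filter_upwards [hlim] with x hx
      have h1 : Tendsto (fun n => a n x - b x) atTop (𝓝 0) := by
        simpa using hx.sub_const (b x)
      have h2 := (ENNReal.continuous_pow 2).tendsto _ |>.comp h1.enorm
      simpa [Function.comp_def] using h2
  simp only [lintegral_zero, ← eLpNorm_two_sq] at key
  have h3 := (ENNReal.continuous_rpow_const (y := 1 / 2)).tendsto _ |>.comp key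
  rw [ENNReal.zero_rpow_of_pos (by norm_num)] at h3
  refine h3.congr fun n => ?_
  rw [Function.comp_apply, ← ENNReal.rpow_natCast, ← ENNReal.rpow_mul]
  norm_num

/-- The `L²` pairing `∫ a b̄`. -/
def pairing (μ : Measure Plane) (a b : Plane → ℂ) : ℂ := ∫ x, a x * starRingEnd ℂ (b x) ∂μ

theorem pairing_eq_inner {μ : Measure Plane} {a b : Plane → ℂ} (ha : MemLp a 2 μ) (hb : MemLp b 2 μ) :
    pairing μ a b = inner ℂ (hb.toLp b) (ha.toLp a) := by
  rw [L2.inner_def, pairing]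
  refine integral_congr_ae ?_
  filter_upwards [ha.coeFn_toLp, hb.coeFn_toLp] with x h1 h2
  rw [h1, h2]
  simp

theorem integrable_pairing {μ : Measure Plane} {a b : Plane → ℂ} (ha : MemLp a 2 μ)
    (hb : MemLp b 2 μ) : Integrable (fun x => a x * starRingEnd ℂ (b x)) μ := by
  have hb' : MemLp (fun x => starRingEnd ℂ (b x)) 2 μ := hb.star
  exact ha.integrable_mul hb'

theorem L2Tendsto.tendsto_toLp {μ : Measure Plane} {a : ℕ → Plane → ℂ} {b : Plane → ℂ}
    (h : L2Tendsto μ a b) (ha : ∀ n, MemLp (a n) 2 μ) (hb : MemLp b 2 μ) :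
    Tendsto (fun n => (ha n).toLp (a n)) atTop (𝓝 (hb.toLp b)) :=
  (Lp.tendsto_Lp_iff_tendsto_eLpNorm'' a ha b hb).2 h

theorem L2Tendsto.pairing {μ : Measure Plane} {a a' : ℕ → Plane → ℂ} {b b' : Plane → ℂ}
    (h : L2Tendsto μ a b) (h' : L2Tendsto μ a' b') (ha : ∀ n, MemLp (a n) 2 μ) (hb : MemLp b 2 μ)
    (ha' : ∀ n, MemLp (a' n) 2 μ) (hb' : MemLp b' 2 μ) :
    Tendsto (fun n => pairing μ (a n) (a' n)) atTop (𝓝 (pairing μ b b')) := by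
  simp only [fun n => pairing_eq_inner (ha n) (ha' n), pairing_eq_inner hb hb']
  exact (h'.tendsto_toLp ha' hb').inner (h.tendsto_toLp ha hb)

/-! ### Smoothing operators -/

/-- Jensen's inequality for the square of the norm and a probability density. -/
theorem enorm_integral_smul_sq_le {η : Plane → ℝ} (hη : Measurable η) (hη0 : ∀ t, 0 ≤ η t)
    (hη1 : ∫⁻ t, ENNReal.ofReal (η t) = 1) {F : Plane → ℂ} (hF : AEStronglyMeasurable F volume) :
    ‖∫ t, η t • F t‖ₑ ^ 2 ≤ ∫⁻ t, ENNReal.ofReal (η t) * ‖F t‖ₑ ^ 2 := by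
  set μ' := (volume : Measure Plane).withDensity fun t => ENNReal.ofReal (η t) with hμ'
  have hprob : IsProbabilityMeasure μ' := ⟨by rw [hμ', withDensity_apply _ .univ]; simpa using hη1⟩
  have hF' : AEStronglyMeasurable F μ' := hF.mono_ac (withDensity_absolutelyContinuous _ _)
  have hd : Measurable fun t => ENNReal.ofReal (η t) := hη.ennreal_ofReal
  have h1 : ‖∫ t, η t • F t‖ₑ ≤ eLpNorm F 1 μ' := by
    refine (enorm_integral_le_lintegral_enorm _).trans (le_of_eq ?_)
    rw [eLpNorm_one_eq_lintegral_enorm, hμ', lintegral_withDensity_eq_lintegral_mul₀ hd.aemeasurable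
      hF.enorm]
    refine lintegral_congr fun t => ?_
    rw [enorm_smul, Real.enorm_eq_ofReal (hη0 t), Pi.mul_apply]
  calc ‖∫ t, η t • F t‖ₑ ^ 2 ≤ eLpNorm F 2 μ' ^ 2 := by
        gcongr
        exact h1.trans (eLpNorm_le_eLpNorm_of_exponent_le (by norm_num) hF')
    _ = _ := by
        rw [eLpNorm_two_sq, hμ', lintegral_withDensity_eq_lintegral_mul₀ hd.aemeasurable
          (hF.enorm.pow_const 2)]
        rfl

/-- The mollification of `f` by the normalised bump function `φ`. -/
def mollify (φ : ContDiffBump (0 : Plane)) (f : Plane → ℂ) : Plane → ℂ :=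
  φ.normed volume ⋆[ContinuousLinearMap.lsmul ℝ ℝ, volume] f

theorem mollify_apply (φ : ContDiffBump (0 : Plane)) (f : Plane → ℂ) (x : Plane) :
    mollify φ f x = ∫ t, φ.normed volume t • f (x - t) := rfl

theorem mollify_apply_swap (φ : ContDiffBump (0 : Plane)) (f : Plane → ℂ) (x : Plane) :
    mollify φ f x = ∫ z, φ.normed volume (x - z) • f z := by
  rw [mollify, convolution_eq_swap]
  rfl

theorem contDiff_mollify (φ : ContDiffBump (0 : Plane)) {f : Plane → ℂ}
    (hf : LocallyIntegrable f) : ContDiff ℝ (⊤ : ℕ∞) (mollify φ f) :=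
  φ.hasCompactSupport_normed.contDiff_convolution_left _ φ.contDiff_normed hf

theorem mollify_sub (φ : ContDiffBump (0 : Plane)) {f g : Plane → ℂ}
    (hf : LocallyIntegrable f) (hg : LocallyIntegrable g) :
    mollify φ (fun x => f x - g x) = fun x => mollify φ f x - mollify φ g x := by
  funext x
  have hc : Continuous (φ.normed volume) := (φ.contDiff_normed (n := 0)).continuous
  have h1 := φ.hasCompactSupport_normed.convolutionExists_left
    (ContinuousLinearMap.lsmul ℝ ℝ) hc hf x
  have h2 := φ.hasCompactSupport_normed.convolutionExists_left
    (ContinuousLinearMap.lsmul ℝ ℝ) hc hg x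
  simp only [mollify_apply, smul_sub]
  exact integral_sub h1 h2

theorem eLpNorm_mollify_le (φ : ContDiffBump (0 : Plane)) {f : Plane → ℂ} (hf : MemLp f 2 volume) :
    eLpNorm (mollify φ f) 2 volume ≤ eLpNorm f 2 volume := by
  have hc : Continuous (φ.normed volume) := (φ.contDiff_normed (n := 0)).continuous
  have hη1 : ∫⁻ t, ENNReal.ofReal (φ.normed volume t) = 1 := by
    rw [← ofReal_integral_eq_lintegral_ofReal φ.integrable_normed
      (ae_of_all _ φ.nonneg_normed), φ.integral_normed, ENNReal.ofReal_one]
  have hsq : eLpNorm (mollify φ f) 2 volume ^ 2 ≤ eLpNorm f 2 volume ^ 2 := by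
    rw [eLpNorm_two_sq, eLpNorm_two_sq]
    calc ∫⁻ x, ‖mollify φ f x‖ₑ ^ 2
        ≤ ∫⁻ x, ∫⁻ t, ENNReal.ofReal (φ.normed volume t) * ‖f (x - t)‖ₑ ^ 2 := by
          refine lintegral_mono fun x => ?_
          refine enorm_integral_smul_sq_le hc.measurable φ.nonneg_normed hη1 ?_
          exact hf.aestronglyMeasurable.comp_quasiMeasurePreserving
            (quasiMeasurePreserving_sub_left volume x)
      _ = ∫⁻ t, ∫⁻ x, ENNReal.ofReal (φ.normed volume t) * ‖f (x - t)‖ₑ ^ 2 := by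
          refine lintegral_lintegral_swap ?_
          have h1 : AEStronglyMeasurable (fun p : Plane × Plane => f (p.1 - p.2))
              (volume.prod volume) :=
            hf.aestronglyMeasurable.comp_quasiMeasurePreserving
              (quasiMeasurePreserving_sub volume volume)
          exact ((hc.measurable.comp measurable_snd).ennreal_ofReal.aemeasurable).mul
            (h1.enorm.pow_const 2)
      _ = ∫⁻ t, ENNReal.ofReal (φ.normed volume t) * ∫⁻ x, ‖f x‖ₑ ^ 2 := by
          refine lintegral_congr fun t => ?_
          rw [lintegral_const_mul' _ _ ENNReal.ofReal_ne_top,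
            lintegral_sub_right_eq_self (fun x => ‖f x‖ₑ ^ 2) t]
      _ = ∫⁻ x, ‖f x‖ₑ ^ 2 := by
          rw [lintegral_mul_const _ hc.measurable.ennreal_ofReal, hη1, one_mul]
  exact (ENNReal.pow_le_pow_left_iff two_ne_zero).1 hsq

theorem norm_mollify_le_of_ball (φ : ContDiffBump (0 : Plane)) {g : Plane → ℂ} (hg : Continuous g)
    {y : Plane} {M : ℝ} (hM : ∀ z ∈ Metric.closedBall y φ.rOut, ‖g z‖ ≤ M) :
    ‖mollify φ g y‖ ≤ 3 * M := by
  have hy := hM y (Metric.mem_closedBall_self φ.rOut_pos.le)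
  have h := φ.dist_normed_convolution_le (μ := volume) (x₀ := y) (ε := 2 * M)
    hg.aestronglyMeasurable fun z hz => by
      have := hM z (Metric.ball_subset_closedBall hz)
      rw [dist_eq_norm]
      linarith [norm_sub_le (g z) (g y)]
  have h2 := norm_le_norm_add_norm_sub' (mollify φ g y) (g y)
  rw [dist_eq_norm] at h
  change ‖mollify φ g y - g y‖ ≤ 2 * M at h
  linarith

theorem eLpNorm_comp_smul {a : ℝ} (ha : 0 < a) (f : Plane → ℂ) :
    eLpNorm (fun x => f (a • x)) 2 volume = ENNReal.ofReal a⁻¹ * eLpNorm f 2 volume := by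
  have hsq : eLpNorm (fun x => f (a • x)) 2 volume ^ 2
      = (ENNReal.ofReal a⁻¹ * eLpNorm f 2 volume) ^ 2 := by
    rw [mul_pow, eLpNorm_two_sq, eLpNorm_two_sq]
    have hmap := Measure.map_addHaar_smul (volume : Measure Plane) ha.ne'
    have he : MeasurableEmbedding fun x : Plane => a • x :=
      (Homeomorph.smulOfNeZero a ha.ne').measurableEmbedding
    have h := he.lintegral_map (μ := volume) fun x => ‖f x‖ₑ ^ 2
    rw [hmap, lintegral_smul_measure] at h
    rw [← h, smul_eq_mul, ← ENNReal.ofReal_pow (by positivity)]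
    congr 2
    rw [finrank_euclideanSpace_fin, abs_of_pos (by positivity), inv_pow]
  exact (ENNReal.pow_right_strictMono two_ne_zero).injective hsq

/-- The radii `1/(n+3)` of the mollifiers, in units of the radius of the circle. -/
def smoothScale (n : ℕ) : ℝ := 1 / ((n : ℝ) + 3)

theorem smoothScale_pos (n : ℕ) : 0 < smoothScale n := by unfold smoothScale; positivity

theorem smoothScale_le (n : ℕ) : smoothScale n ≤ 1 / 3 := by
  unfold smoothScale
  gcongr
  have : (0 : ℝ) ≤ n := n.cast_nonneg
  linarith

theorem tendsto_smoothScale : Tendsto smoothScale atTop (𝓝 0) := by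
  have : Tendsto (fun n : ℕ => (n : ℝ) + 3) atTop atTop :=
    tendsto_atTop_add_const_right _ _ tendsto_natCast_atTop_atTop
  exact (tendsto_inv_atTop_zero.comp this).congr fun n => by simp [smoothScale]

/-- A bump function supported in the ball of radius `R/(n+3)`. -/
def smoothBump {R : ℝ} (hR : 0 < R) (n : ℕ) : ContDiffBump (0 : Plane) where
  rIn := smoothScale n * R / 2
  rOut := smoothScale n * R
  rIn_pos := by have := smoothScale_pos n; positivity
  rIn_lt_rOut := half_lt_self (mul_pos (smoothScale_pos n) hR)

/-- A fixed bump function, equal to one on the unit ball. -/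
def unitBump : ContDiffBump (0 : Plane) := ⟨1, 2, one_pos, one_lt_two⟩

/-- A smooth function equal to one on the ball of radius `n + 1`. -/
def cutoff (n : ℕ) (x : Plane) : ℝ := unitBump (((n : ℝ) + 1)⁻¹ • x)

theorem contDiff_cutoff (n : ℕ) : ContDiff ℝ (⊤ : ℕ∞) (cutoff n) :=
  unitBump.contDiff.comp (contDiff_const_smul _)

theorem hasCompactSupport_cutoff (n : ℕ) : HasCompactSupport (cutoff n) :=
  unitBump.hasCompactSupport.comp_smul (by positivity)

theorem abs_cutoff_le (n : ℕ) (x : Plane) : |cutoff n x| ≤ 1 := by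
  rw [cutoff, abs_of_nonneg unitBump.nonneg]
  exact unitBump.le_one

theorem cutoff_eq_one {n : ℕ} {x : Plane} (hx : ‖x‖ ≤ n + 1) : cutoff n x = 1 := by
  refine unitBump.one_of_mem_closedBall ?_
  rw [mem_closedBall_zero_iff, norm_smul, norm_inv, Real.norm_of_nonneg (by positivity),
    inv_mul_le_iff₀ (by positivity)]
  simpa [unitBump] using hx

theorem eventually_cutoff_eq_one (x : Plane) : ∀ᶠ n in atTop, cutoff n x = 1 := by
  obtain ⟨N, hN⟩ := exists_nat_ge ‖x‖
  filter_upwards [eventually_ge_atTop N] with n hn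
  refine cutoff_eq_one (hN.trans ?_)
  have : (N : ℝ) ≤ n := by exact_mod_cast hn
  linarith

theorem exists_pderiv_cutoff_le : ∃ C : ℝ, 0 ≤ C ∧ ∀ (i : Fin 2) (n : ℕ) (x : Plane),
    |pderiv i (cutoff n) x| ≤ C * ((n : ℝ) + 1)⁻¹ := by
  have hc : Continuous (fderiv ℝ unitBump) :=
    (unitBump.contDiff (n := 1)).continuous_fderiv one_ne_zero
  obtain ⟨C, hC⟩ := (unitBump.hasCompactSupport.fderiv ℝ).exists_bound_of_continuous hc
  refine ⟨C, (norm_nonneg _).trans (hC 0), fun i n x => ?_⟩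
  have h1 : HasFDerivAt (cutoff n)
      ((fderiv ℝ unitBump (((n : ℝ) + 1)⁻¹ • x)).comp
        (((n : ℝ) + 1)⁻¹ • ContinuousLinearMap.id ℝ Plane)) x :=
    ((unitBump.contDiff (n := 1)).differentiable one_ne_zero _).hasFDerivAt.comp x
      (f := fun y : Plane => ((n : ℝ) + 1)⁻¹ • y) ((hasFDerivAt_id x).const_smul (((n : ℝ) + 1)⁻¹))
  rw [pderiv, h1.fderiv]
  simp only [ContinuousLinearMap.comp_apply, FunLike.coe_smul, Pi.smul_apply,
    ContinuousLinearMap.id_apply, map_smul, smul_eq_mul]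
  rw [abs_mul, abs_of_pos (by positivity), mul_comm]
  gcongr
  refine ((fderiv ℝ unitBump (((n : ℝ) + 1)⁻¹ • x)).le_opNorm _).trans ?_
  simpa using hC _

/-- The smoothing operators `f ↦ χₙ · (ηₙ * f)(aₙ ·)` with `aₙ = 1 + 2s/(n+3)`: mollification at
scale `R/(n+3)`, composed with a dilation of the plane and cut off near infinity. With `s = -1` the
values on a disk of radius `R`, and with `s = 1` the values on its exterior, depend only on the
values of `f` in the open set itself, because the dilation leaves room for the mollification. -/
def smoothing {R : ℝ} (hR : 0 < R) (s : ℝ) (n : ℕ) (f : Plane → ℂ) (x : Plane) : ℂ :=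
  cutoff n x • mollify (smoothBump hR n) f ((1 + s * (2 * smoothScale n)) • x)

theorem dilation_bounds {s : ℝ} (hs : |s| ≤ 1) (n : ℕ) :
    1 / 3 ≤ 1 + s * (2 * smoothScale n) ∧ 1 + s * (2 * smoothScale n) ≤ 2 := by
  obtain ⟨h1, h2⟩ := abs_le.1 hs
  have h3 := smoothScale_pos n
  have h4 := smoothScale_le n
  constructor <;> nlinarith

theorem contDiff_smoothing {R : ℝ} (hR : 0 < R) (s : ℝ) (n : ℕ) {f : Plane → ℂ}
    (hf : LocallyIntegrable f) : ContDiff ℝ (⊤ : ℕ∞) (smoothing hR s n f) :=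
  (contDiff_cutoff n).smul ((contDiff_mollify _ hf).comp (contDiff_const_smul _))

theorem hasCompactSupport_smoothing {R : ℝ} (hR : 0 < R) (s : ℝ) (n : ℕ) (f : Plane → ℂ) :
    HasCompactSupport (smoothing hR s n f) :=
  (hasCompactSupport_cutoff n).smul_right

theorem eLpNorm_mollify_dilation_le {R : ℝ} (hR : 0 < R) {s : ℝ} (hs : |s| ≤ 1) (n : ℕ)
    {f : Plane → ℂ} (hf : MemLp f 2 volume) :
    eLpNorm (fun x => mollify (smoothBump hR n) f ((1 + s * (2 * smoothScale n)) • x)) 2 volume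
      ≤ 3 * eLpNorm f 2 volume := by
  have ha := (dilation_bounds hs n).1
  rw [eLpNorm_comp_smul (by linarith)]
  refine mul_le_mul' ?_ (eLpNorm_mollify_le _ hf)
  refine ENNReal.ofReal_le_of_le_toReal ?_
  rw [inv_le_comm₀ (by linarith) (by norm_num)]
  simpa using ha

theorem eLpNorm_smoothing_le {R : ℝ} (hR : 0 < R) {s : ℝ} (hs : |s| ≤ 1) (n : ℕ)
    {f : Plane → ℂ} (hf : MemLp f 2 volume) :
    eLpNorm (smoothing hR s n f) 2 volume ≤ 3 * eLpNorm f 2 volume := by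
  refine (eLpNorm_mono fun x => ?_).trans (eLpNorm_mollify_dilation_le hR hs n hf)
  rw [smoothing, norm_smul]
  exact mul_le_of_le_one_left (norm_nonneg _) (abs_cutoff_le n x)

theorem tendsto_dilation (s : ℝ) (x : Plane) :
    Tendsto (fun n => (1 + s * (2 * smoothScale n)) • x) atTop (𝓝 x) := by
  have h := (((tendsto_smoothScale.const_mul 2).const_mul s).const_add 1).smul_const x
  simpa using h

theorem tendsto_smoothing_of_continuous {R : ℝ} (hR : 0 < R) (s : ℝ) {g : Plane → ℂ}
    (hg : Continuous g) (x : Plane) :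
    Tendsto (fun n => smoothing hR s n g x) atTop (𝓝 (g x)) := by
  have hrad : Tendsto (fun n => (smoothBump hR n).rOut) atTop (𝓝 0) := by
    simpa [smoothBump] using tendsto_smoothScale.mul_const R
  have h := ContDiffBump.convolution_tendsto_right (μ := volume) (φ := smoothBump hR)
    (g := fun _ => g) (x₀ := x) (z₀ := g x) hrad
    (Eventually.of_forall fun _ => hg.aestronglyMeasurable)
    ((hg.tendsto x).comp tendsto_snd) (tendsto_dilation s x)
  refine h.congr' ?_
  filter_upwards [eventually_cutoff_eq_one x] with n hn
  rw [smoothing, hn, one_smul]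
  rfl

theorem memLp_locallyIntegrable {f : Plane → ℂ} (hf : MemLp f 2 volume) : LocallyIntegrable f :=
  hf.locallyIntegrable (by norm_num)

theorem l2Tendsto_smoothing_of_continuous {R : ℝ} (hR : 0 < R) {s : ℝ} (hs : |s| ≤ 1)
    {g : Plane → ℂ} (hg : Continuous g) (hgc : HasCompactSupport g) :
    L2Tendsto volume (fun n => smoothing hR s n g) g := by
  obtain ⟨M, hM⟩ := hgc.exists_bound_of_continuous hg
  obtain ⟨r, hr⟩ := hgc.isCompact.isBounded.exists_norm_le
  have hM0 : 0 ≤ M := (norm_nonneg _).trans (hM 0)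
  have hr0 : 0 ≤ max r 0 := le_max_right _ _
  have hzero : ∀ z, max r 0 < ‖z‖ → g z = 0 := fun z hz => by
    by_contra hne
    exact absurd (hr z (subset_tsupport g hne)) (not_le.2 ((le_max_left _ _).trans_lt hz))
  refine l2Tendsto_of_dominated
    ((Metric.closedBall (0 : Plane) (3 * (max r 0 + R))).indicator fun _ => 4 * M) ?_
    (fun n => ((contDiff_smoothing hR s n hg.locallyIntegrable).continuous).aestronglyMeasurable)
    hg.aestronglyMeasurable (fun n => ae_of_all _ fun x => ?_)
    (ae_of_all _ fun x => tendsto_smoothing_of_continuous hR s hg x)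
  · exact memLp_indicator_const 2 measurableSet_closedBall _
      (Or.inr (measure_closedBall_lt_top).ne)
  · have h1 := (dilation_bounds hs n).1
    by_cases hx : x ∈ Metric.closedBall (0 : Plane) (3 * (max r 0 + R))
    · rw [indicator_of_mem hx]
      have hmol := norm_mollify_le_of_ball (smoothBump hR n) hg
        (y := (1 + s * (2 * smoothScale n)) • x) (M := M) fun z _ => hM z
      have h2 : ‖smoothing hR s n g x‖ ≤ 3 * M := by
        rw [smoothing, norm_smul]
        exact (mul_le_of_le_one_left (norm_nonneg _) (abs_cutoff_le n x)).trans hmol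
      linarith [norm_sub_le (smoothing hR s n g x) (g x), hM x]
    · rw [indicator_of_notMem hx]
      rw [mem_closedBall_zero_iff, not_le] at hx
      have hgx : g x = 0 := hzero x (by linarith)
      have hmol := norm_mollify_le_of_ball (smoothBump hR n) hg
        (y := (1 + s * (2 * smoothScale n)) • x) (M := 0) fun z hz => by
          rw [hzero z, norm_zero]
          rw [Metric.mem_closedBall, dist_eq_norm, norm_sub_rev] at hz
          have h2 := norm_sub_norm_le ((1 + s * (2 * smoothScale n)) • x) z
          rw [norm_smul, Real.norm_of_nonneg (by linarith)] at h2
          have h3 : (smoothBump hR n).rOut ≤ 1 / 3 * R :=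
            mul_le_mul_of_nonneg_right (smoothScale_le n) hR.le
          nlinarith
      rw [mul_zero, norm_le_zero_iff] at hmol
      rw [smoothing, hmol, hgx]
      simp

theorem smoothing_sub {R : ℝ} (hR : 0 < R) (s : ℝ) (n : ℕ) {f g : Plane → ℂ}
    (hf : LocallyIntegrable f) (hg : LocallyIntegrable g) (x : Plane) :
    smoothing hR s n (fun x => f x - g x) x = smoothing hR s n f x - smoothing hR s n g x := by
  simp only [smoothing, mollify_sub _ hf hg, smul_sub]

/-- The smoothing operators converge strongly to the identity on `L²(ℝ²)`. -/
theorem l2Tendsto_smoothing {R : ℝ} (hR : 0 < R) {s : ℝ} (hs : |s| ≤ 1)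
    {f : Plane → ℂ} (hf : MemLp f 2 volume) :
    L2Tendsto volume (fun n => smoothing hR s n f) f := by
  refine ENNReal.tendsto_nhds_zero.2 fun ε hε => ?_
  rcases eq_or_ne ε ⊤ with rfl | hε'
  · exact Eventually.of_forall fun _ => le_top
  have hε5 : ε / 5 ≠ 0 := (ENNReal.div_pos hε.ne' (by norm_num)).ne'
  obtain ⟨g, hgc, hfg, hg, hgm⟩ :=
    hf.exists_hasCompactSupport_eLpNorm_sub_le (ε := ε / 5) (by norm_num) hε5
  have hfl := memLp_locallyIntegrable hf
  have hgl := hg.locallyIntegrable (μ := (volume : Measure Plane))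
  have h1 := ENNReal.tendsto_nhds_zero.1 (l2Tendsto_smoothing_of_continuous hR hs hg hgc) (ε / 5)
    (pos_iff_ne_zero.2 hε5)
  filter_upwards [h1] with n hn
  have hS : ∀ {h : Plane → ℂ}, LocallyIntegrable h → AEStronglyMeasurable (smoothing hR s n h) volume :=
    fun hh => (contDiff_smoothing hR s n hh).continuous.aestronglyMeasurable
  have hsub : MemLp (fun x => f x - g x) 2 volume := hf.sub hgm
  have e : (fun x => smoothing hR s n f x - f x) =
      smoothing hR s n (fun x => f x - g x) + (fun x => smoothing hR s n g x - g x) - (f - g) := by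
    funext x
    simp only [Pi.add_apply, Pi.sub_apply, smoothing_sub hR s n hfl hgl]
    ring
  rw [e]
  calc _ ≤ eLpNorm (smoothing hR s n (fun x => f x - g x) + (fun x => smoothing hR s n g x - g x)) 2 volume
        + eLpNorm (f - g) 2 volume :=
        eLpNorm_sub_le ((hS (memLp_locallyIntegrable hsub)).add ((hS hgl).sub hgm.aestronglyMeasurable))
          (hf.aestronglyMeasurable.sub hgm.aestronglyMeasurable) (by norm_num)
    _ ≤ (3 * (ε / 5) + ε / 5) + ε / 5 := by
        gcongr
        refine (eLpNorm_add_le (hS (memLp_locallyIntegrable hsub))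
          ((hS hgl).sub hgm.aestronglyMeasurable) (by norm_num)).trans ?_
        refine add_le_add ((eLpNorm_smoothing_le hR hs n hsub).trans ?_) hn
        gcongr
        exact hfg
    _ = 5 * (ε / 5) := by ring
    _ = ε := ENNReal.mul_div_cancel (by norm_num) (by norm_num)

/-! ### Mollification and weak gradients -/

theorem pderiv_mollify (φ : ContDiffBump (0 : Plane)) {f : Plane → ℂ} (hf : LocallyIntegrable f)
    (i : Fin 2) (y : Plane) :
    pderiv i (mollify φ f) y = ∫ z, pderiv i (φ.normed volume) (y - z) • f z := by
  have hd : ContDiff ℝ 1 (φ.normed volume) := φ.contDiff_normed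
  have h := φ.hasCompactSupport_normed.hasFDerivAt_convolution_left
    (ContinuousLinearMap.lsmul ℝ ℝ) hd hf y (μ := volume)
  have hex := (φ.hasCompactSupport_normed.fderiv ℝ).convolutionExists_left
    ((ContinuousLinearMap.lsmul ℝ ℝ : ℝ →L[ℝ] ℂ →L[ℝ] ℂ).precompL Plane)
    (hd.continuous_fderiv one_ne_zero) hf y (μ := volume)
  rw [pderiv]
  change fderiv ℝ (φ.normed volume ⋆[ContinuousLinearMap.lsmul ℝ ℝ, volume] f) y _ = _
  rw [h.fderiv, convolution_def, ContinuousLinearMap.integral_apply hex]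
  rw [← integral_sub_left_eq_self _ volume y]
  refine integral_congr_ae (ae_of_all _ fun z => ?_)
  simp only [sub_sub_cancel]
  rfl

theorem integral_smul_indicator {Ω : Set Plane} (hΩ : MeasurableSet Ω) (w : Plane → ℝ)
    (f : Plane → ℂ) : ∫ z, w z • Ω.indicator f z = ∫ z in Ω, w z • f z := by
  rw [← integral_indicator hΩ]
  congr 1
  funext z
  by_cases hz : z ∈ Ω <;> simp [hz]

/-- The partial derivatives of the mollification of `u` are the mollifications of the weak
derivatives, at points whose distance to the boundary exceeds the mollification radius. -/
theorem pderiv_mollify_of_hasWeakGrad (φ : ContDiffBump (0 : Plane)) {Ω : Set Plane}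
    (hΩ : MeasurableSet Ω) {u : Plane → ℂ} {G : Fin 2 → Plane → ℂ} (hG : HasWeakGrad Ω u G)
    (hu : LocallyIntegrable (Ω.indicator u)) {y : Plane} (hy : Metric.closedBall y φ.rOut ⊆ Ω)
    (i : Fin 2) :
    pderiv i (mollify φ (Ω.indicator u)) y = mollify φ (Ω.indicator (G i)) y := by
  have hd : ContDiff ℝ (⊤ : ℕ∞) (φ.normed volume) := φ.contDiff_normed
  set ζ : Plane → ℝ := fun z => φ.normed volume (y - z) with hζ
  have hζd : ContDiff ℝ (⊤ : ℕ∞) ζ := hd.comp (contDiff_const.sub contDiff_id)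
  have hζs : tsupport ζ ⊆ Metric.closedBall y φ.rOut := by
    refine closure_minimal (fun z hz => ?_) Metric.isClosed_closedBall
    have : y - z ∈ Function.support (φ.normed volume) := hz
    rw [φ.support_normed_eq, mem_ball_zero_iff] at this
    rw [Metric.mem_closedBall, dist_comm, dist_eq_norm]
    exact this.le
  have hζc : HasCompactSupport ζ :=
    (isCompact_closedBall y φ.rOut).of_isClosed_subset (isClosed_tsupport ζ) hζs
  have hpd : ∀ z, pderiv i ζ z = -pderiv i (φ.normed volume) (y - z) := fun z => by
    have h1 : HasFDerivAt ζ ((fderiv ℝ (φ.normed volume) (y - z)).comp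
        (-ContinuousLinearMap.id ℝ Plane)) z :=
      (hd.differentiable (by simp) _).hasFDerivAt.comp z ((hasFDerivAt_id z).const_sub y)
    rw [pderiv, h1.fderiv]
    simp [pderiv]
  have hw := (hG i).2 ζ hζd hζc (hζs.trans hy)
  simp only [hpd, neg_smul, integral_neg, neg_inj] at hw
  rw [pderiv_mollify φ hu, mollify_apply_swap, integral_smul_indicator hΩ,
    integral_smul_indicator hΩ, hw]

/-! ### Density of smooth functions -/

/-- The dilation by `1 + 2s/(n+3)` maps the open set `Ω` and the circle of radius `R` into `Ω`, at
distance more than `R/(n+3)` from the complement, so that mollification at that scale stays inside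
`Ω`. This holds for the disk with `s = -1`, and for its exterior with `s = 1`. -/
structure IsDilationDomain (Ω : Set Plane) (R s : ℝ) : Prop where
  pos : 0 < R
  abs_le : |s| ≤ 1
  isOpen : IsOpen Ω
  ball_subset : ∀ n, ∀ x, (x ∈ Ω ∨ ‖x‖ = R) →
    Metric.closedBall ((1 + s * (2 * smoothScale n)) • x) (smoothScale n * R) ⊆ Ω

theorem isDilationDomain_disk {R : ℝ} (hR : 0 < R) : IsDilationDomain (disk R) R (-1) := by
  refine ⟨hR, by simp, isOpen_disk R, fun n x hx z hz => ?_⟩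
  have hx' : ‖x‖ ≤ R := hx.elim (fun h : ‖x‖ < R => h.le) le_of_eq
  have h1 := smoothScale_pos n
  have h2 := (dilation_bounds (s := -1) (by simp) n).1
  rw [Metric.mem_closedBall, dist_eq_norm] at hz
  have h3 := norm_le_norm_add_norm_sub' z ((1 + -1 * (2 * smoothScale n)) • x)
  rw [norm_smul, Real.norm_of_nonneg (by linarith)] at h3
  change ‖z‖ < R
  nlinarith

theorem isDilationDomain_exterior {R : ℝ} (hR : 0 < R) : IsDilationDomain (exterior R) R 1 := by
  refine ⟨hR, by simp, isOpen_exterior R, fun n x hx z hz => ?_⟩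
  have hx' : R ≤ ‖x‖ := hx.elim (fun h : R < ‖x‖ => h.le) (fun h => h.ge)
  have h1 := smoothScale_pos n
  have h2 := (dilation_bounds (s := 1) (by simp) n).1
  rw [Metric.mem_closedBall, dist_eq_norm, norm_sub_rev] at hz
  have h3 := norm_sub_norm_le ((1 + 1 * (2 * smoothScale n)) • x) z
  rw [norm_smul, Real.norm_of_nonneg (by linarith)] at h3
  change R < ‖z‖
  nlinarith

theorem pderiv_smoothing {Ω : Set Plane} {R s : ℝ} (h : IsDilationDomain Ω R s) {u : Plane → ℂ}
    {G : Fin 2 → Plane → ℂ} (hG : HasWeakGrad Ω u G)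
    (hu : LocallyIntegrable (Ω.indicator u)) (n : ℕ) (i : Fin 2) {x : Plane} (hx : x ∈ Ω) :
    pderiv i (smoothing h.pos s n (Ω.indicator u)) x =
      (1 + s * (2 * smoothScale n)) • smoothing h.pos s n (Ω.indicator (G i)) x
      + pderiv i (cutoff n) x • mollify (smoothBump h.pos n) (Ω.indicator u)
          ((1 + s * (2 * smoothScale n)) • x) := by
  set a := 1 + s * (2 * smoothScale n) with ha
  have h1 : HasFDerivAt (fun y => mollify (smoothBump h.pos n) (Ω.indicator u) (a • y))
      ((fderiv ℝ (mollify (smoothBump h.pos n) (Ω.indicator u)) (a • x)).comp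
        (a • ContinuousLinearMap.id ℝ Plane)) x :=
    ((contDiff_mollify _ hu).differentiable (by simp) _).hasFDerivAt.comp x
      (f := fun y : Plane => a • y) ((hasFDerivAt_id x).const_smul a)
  have h2 : HasFDerivAt (cutoff n) (fderiv ℝ (cutoff n) x) x :=
    ((contDiff_cutoff n).differentiable (by simp) _).hasFDerivAt
  have h3 := (h2.smul h1).fderiv
  have h4 := pderiv_mollify_of_hasWeakGrad (smoothBump h.pos n) h.isOpen.measurableSet hG hu
    (h.ball_subset n x (Or.inl hx)) i
  change fderiv ℝ (fun y => cutoff n y • mollify (smoothBump h.pos n) (Ω.indicator u) (a • y)) x _ = _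
  erw [h3]
  simp only [add_apply, FunLike.coe_smul, Pi.smul_apply,
    ContinuousLinearMap.comp_apply, ContinuousLinearMap.id_apply, map_smul,
    ContinuousLinearMap.smulRight_apply]
  rw [← ha] at h4
  rw [smoothing, ← ha, ← h4]
  simp only [pderiv, smul_comm a]

theorem mollify_congr_of_ball (φ : ContDiffBump (0 : Plane)) {Ω : Set Plane} {u v : Plane → ℂ}
    (huv : ∀ᵐ x, x ∈ Ω → u x = v x) {y : Plane} (hy : Metric.closedBall y φ.rOut ⊆ Ω) :
    mollify φ (Ω.indicator u) y = mollify φ v y := by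
  rw [mollify_apply_swap, mollify_apply_swap]
  refine integral_congr_ae ?_
  filter_upwards [huv] with z hz
  by_cases hzy : z ∈ Metric.closedBall y φ.rOut
  · rw [indicator_of_mem (hy hzy), hz (hy hzy)]
  · have : y - z ∉ Function.support (φ.normed volume) := by
      rw [φ.support_normed_eq, mem_ball_zero_iff, ← dist_eq_norm, dist_comm]
      exact fun hlt => hzy (Metric.mem_closedBall.2 hlt.le)
    rw [Function.notMem_support.1 this, zero_smul, zero_smul]

/-- Smooth functions with compact support in the plane are dense in `H¹(Ω)`. If `u` coincides on
`Ω` with a continuous function, the approximations converge to that function on the circle too. -/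
theorem exists_smooth_approx {Ω : Set Plane} {R s : ℝ} (h : IsDilationDomain Ω R s)
    {u : Plane → ℂ} {G : Fin 2 → Plane → ℂ} (hu : MemLp u 2 (volume.restrict Ω))
    (hG : HasWeakGrad Ω u G) : ∃ φ : ℕ → Plane → ℂ,
      (∀ n, ContDiff ℝ (⊤ : ℕ∞) (φ n) ∧ HasCompactSupport (φ n)) ∧
      L2Tendsto (volume.restrict Ω) φ u ∧
      (∀ i, L2Tendsto (volume.restrict Ω) (fun n => pderiv i (φ n)) (G i)) ∧
      ∀ v : Plane → ℂ, Continuous v → (∀ᵐ x, x ∈ Ω → u x = v x) → L2Tendsto (arcLength R) φ v := by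
  have hΩ := h.isOpen.measurableSet
  have hu' : MemLp (Ω.indicator u) 2 volume := (memLp_indicator_iff_restrict hΩ).2 hu
  have hG' : ∀ i, MemLp (Ω.indicator (G i)) 2 volume := fun i =>
    (memLp_indicator_iff_restrict hΩ).2 (hG i).1
  have hul := memLp_locallyIntegrable hu'
  have hsm := fun n => contDiff_smoothing h.pos s n hul
  refine ⟨fun n => smoothing h.pos s n (Ω.indicator u),
    fun n => ⟨hsm n, hasCompactSupport_smoothing _ _ _ _⟩, ?_, fun i => ?_, fun v hv huv => ?_⟩
  · refine ((l2Tendsto_smoothing h.pos h.abs_le hu').mono_measure Measure.restrict_le_self).congr_ae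
      (fun n => EventuallyEq.rfl) ?_
    filter_upwards [ae_restrict_mem hΩ] with x hx using indicator_of_mem hx u
  · have hGl := memLp_locallyIntegrable (hG' i)
    have hSG := l2Tendsto_smoothing h.pos h.abs_le (hG' i)
    have hmS : ∀ n, AEStronglyMeasurable (smoothing h.pos s n (Ω.indicator (G i))) volume :=
      fun n => (contDiff_smoothing h.pos s n hGl).continuous.aestronglyMeasurable
    have hmc : ∀ n (c : ℝ), AEStronglyMeasurable
        (fun x => c • smoothing h.pos s n (Ω.indicator (G i)) x) volume :=
      fun n c => (hmS n).const_smul c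
    -- The derivative of a smoothed function is the smoothed derivative, plus two errors: the factor
    -- by which the dilation differs from one, and the term in which the cutoff is differentiated.
    have hdil : L2Tendsto volume
        (fun n x => (s * (2 * smoothScale n)) • smoothing h.pos s n (Ω.indicator (G i)) x)
        (fun _ => 0) := by
      have hlim : Tendsto (fun n => ‖s * (2 * smoothScale n)‖ₑ * (3 * eLpNorm (Ω.indicator (G i)) 2 volume))
          atTop (𝓝 0) := by
        have h1 : Tendsto (fun n => ‖s * (2 * smoothScale n)‖ₑ) atTop (𝓝 0) := by
          simpa using ((tendsto_smoothScale.const_mul 2).const_mul s).enorm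
        have h2 := ENNReal.Tendsto.mul_const (b := 3 * eLpNorm (Ω.indicator (G i)) 2 volume) h1
          (Or.inr (ENNReal.mul_ne_top (by norm_num) (hG' i).eLpNorm_ne_top))
        rwa [zero_mul] at h2
      refine l2Tendsto_of_le hlim fun n => ?_
      simp only [sub_zero]
      have := eLpNorm_const_smul (μ := (volume : Measure Plane)) (p := 2) (s * (2 * smoothScale n))
        (smoothing h.pos s n (Ω.indicator (G i)))
      refine (le_of_eq this).trans ?_
      gcongr
      exact eLpNorm_smoothing_le h.pos h.abs_le n (hG' i)
    obtain ⟨C, hC0, hC⟩ := exists_pderiv_cutoff_le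
    have hcut : L2Tendsto volume (fun n x => pderiv i (cutoff n) x •
        mollify (smoothBump h.pos n) (Ω.indicator u) ((1 + s * (2 * smoothScale n)) • x))
        (fun _ => 0) := by
      have hlim : Tendsto (fun n : ℕ => ENNReal.ofReal (C * ((n : ℝ) + 1)⁻¹) *
          (3 * eLpNorm (Ω.indicator u) 2 volume)) atTop (𝓝 0) := by
        have h0 : Tendsto (fun n : ℕ => C * ((n : ℝ) + 1)⁻¹) atTop (𝓝 0) := by
          have := (tendsto_one_div_add_atTop_nhds_zero_nat (𝕜 := ℝ)).const_mul C
          simpa using this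
        have h1 := ENNReal.tendsto_ofReal h0
        rw [ENNReal.ofReal_zero] at h1
        have h2 := ENNReal.Tendsto.mul_const (b := 3 * eLpNorm (Ω.indicator u) 2 volume) h1
          (Or.inr (ENNReal.mul_ne_top (by norm_num) hu'.eLpNorm_ne_top))
        rwa [zero_mul] at h2
      refine l2Tendsto_of_le hlim fun n => ?_
      simp only [sub_zero]
      refine (eLpNorm_le_mul_eLpNorm_of_ae_le_mul (ae_of_all _ fun x => ?_) 2).trans
        (mul_le_mul' le_rfl (eLpNorm_mollify_dilation_le h.pos h.abs_le n hu'))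
      rw [norm_smul]
      gcongr
      exact hC i n x
    have hmm : ∀ n, AEStronglyMeasurable (fun x => pderiv i (cutoff n) x •
        mollify (smoothBump h.pos n) (Ω.indicator u) ((1 + s * (2 * smoothScale n)) • x)) volume := by
      intro n
      have h1 : Continuous (pderiv i (cutoff n)) :=
        ((contDiff_cutoff n).continuous_fderiv (by simp)).clm_apply continuous_const
      exact (h1.smul ((contDiff_mollify _ hul).continuous.comp
        (continuous_const_smul _))).aestronglyMeasurable
    have hsum := (hSG.add hdil hmS (fun n => hmc n _) (hG' i).aestronglyMeasurable
      aestronglyMeasurable_const).add hcut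
      (fun n => (hmS n).add (hmc n _)) hmm
      ((hG' i).aestronglyMeasurable.add aestronglyMeasurable_const) aestronglyMeasurable_const
    refine (hsum.mono_measure Measure.restrict_le_self).congr_ae (fun n => ?_) ?_
    · filter_upwards [ae_restrict_mem hΩ] with x hx
      rw [pderiv_smoothing h hG hul n i hx, add_smul 1 _ (smoothing _ _ _ _ _), one_smul]
    · filter_upwards [ae_restrict_mem hΩ] with x hx
      simp [hx]
  · have hball : ∀ n x, ‖x‖ = R → smoothing h.pos s n (Ω.indicator u) x = smoothing h.pos s n v x :=
      fun n x hx => by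
        rw [smoothing, smoothing, mollify_congr_of_ball _ huv (h.ball_subset n x (Or.inr hx))]
    obtain ⟨M, hM⟩ := (isCompact_closedBall (0 : Plane) (3 * R)).exists_bound_of_continuousOn
      hv.continuousOn
    have hcirc := ae_norm_eq_arcLength h.pos.le
    refine l2Tendsto_of_dominated (fun _ => 4 * M) (memLp_const _)
      (fun n => (hsm n).continuous.aestronglyMeasurable) hv.aestronglyMeasurable (fun n => ?_) ?_
    · filter_upwards [hcirc] with x hx
      rw [hball n x hx]
      have hmol := norm_mollify_le_of_ball (smoothBump h.pos n) hv
        (y := (1 + s * (2 * smoothScale n)) • x) (M := M) fun z hz => hM z (by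
          rw [mem_closedBall_zero_iff]
          rw [Metric.mem_closedBall, dist_eq_norm] at hz
          have h1 := dilation_bounds h.abs_le n
          have h3 := norm_le_norm_add_norm_sub' z ((1 + s * (2 * smoothScale n)) • x)
          rw [norm_smul, Real.norm_of_nonneg (by linarith), hx] at h3
          have h4 : (smoothBump h.pos n).rOut ≤ 1 / 3 * R :=
            mul_le_mul_of_nonneg_right (smoothScale_le n) h.pos.le
          nlinarith [h.pos])
      have h2 : ‖smoothing h.pos s n v x‖ ≤ 3 * M := by
        rw [smoothing, norm_smul]
        exact (mul_le_of_le_one_left (norm_nonneg _) (abs_cutoff_le n x)).trans hmol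
      have h5 := hM x (by rw [mem_closedBall_zero_iff, hx]; linarith [h.pos])
      linarith [norm_sub_le (smoothing h.pos s n v x) (v x)]
    · filter_upwards [hcirc] with x hx
      simp only [hball _ x hx]
      exact tendsto_smoothing_of_continuous h.pos s hv x

/-! ### Green's identity -/

theorem memLp_of_continuous {φ : Plane → ℂ} (hφ : Continuous φ) (hc : HasCompactSupport φ)
    (μ : Measure Plane) [IsFiniteMeasureOnCompacts μ] : MemLp φ 2 μ :=
  hφ.memLp_of_hasCompactSupport hc

theorem hasFDerivAt_conj {φ : Plane → ℂ} (hφ : ContDiff ℝ 1 φ) (i : Fin 2) (x : Plane) :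
    pderiv i (fun y => starRingEnd ℂ (φ y)) x = starRingEnd ℂ (pderiv i φ x) := by
  have h1 : HasFDerivAt (fun y => Complex.conjCLE (φ y))
      ((Complex.conjCLE : ℂ →L[ℝ] ℂ).comp (fderiv ℝ φ x)) x :=
    (Complex.conjCLE : ℂ →L[ℝ] ℂ).hasFDerivAt.comp x
      (hφ.differentiable one_ne_zero x).hasFDerivAt
  change fderiv ℝ (fun y => Complex.conjCLE (φ y)) x _ = _
  rw [h1.fderiv]
  rfl

theorem contDiff_conj {n : WithTop ℕ∞} {φ : Plane → ℂ} (hφ : ContDiff ℝ n φ) :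
    ContDiff ℝ n fun y => starRingEnd ℂ (φ y) :=
  (Complex.conjCLE : ℂ →L[ℝ] ℂ).contDiff.comp hφ

theorem pderiv_mul_conj {φ ψ : Plane → ℂ} (hφ : ContDiff ℝ 1 φ) (hψ : ContDiff ℝ 1 ψ) (i : Fin 2)
    (x : Plane) : pderiv i (fun y => φ y * starRingEnd ℂ (ψ y)) x =
      pderiv i φ x * starRingEnd ℂ (ψ x) + φ x * starRingEnd ℂ (pderiv i ψ x) := by
  rw [← hasFDerivAt_conj hψ]
  have h1 := (hφ.differentiable one_ne_zero x).hasFDerivAt.mul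
    ((contDiff_conj hψ).differentiable one_ne_zero x).hasFDerivAt
  rw [pderiv]
  change fderiv ℝ (φ * fun y => starRingEnd ℂ (ψ y)) x _ = _
  rw [h1.fderiv]
  simp only [add_apply, FunLike.coe_smul, Pi.smul_apply, smul_eq_mul, pderiv]
  ring

theorem IsRiccatiField.memLp_mul {Ω : Set Plane} {R κ c : ℝ} {X : Fin 2 → Plane → ℝ}
    (hX : IsRiccatiField Ω R κ c X) (hΩ : MeasurableSet Ω) {u : Plane → ℂ}
    (hu : MemLp u 2 (volume.restrict Ω)) (i : Fin 2) :
    MemLp (fun x => (X i x : ℂ) * u x) 2 (volume.restrict Ω) := by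
  obtain ⟨B, hB⟩ := hX.bounded
  refine hu.of_le_mul (c := B)
    ((Complex.continuous_ofReal.comp_aestronglyMeasurable (hX.measurable i)).mul
      hu.aestronglyMeasurable) ?_
  filter_upwards [ae_restrict_mem hΩ] with x hx
  rw [norm_mul, Complex.norm_real, Real.norm_eq_abs]
  gcongr
  exact hB i x hx

theorem IsRiccatiField.green_smooth {Ω : Set Plane} {R κ c : ℝ} {X : Fin 2 → Plane → ℝ}
    (hX : IsRiccatiField Ω R κ c X) (hΩ : MeasurableSet Ω) {φ ψ : Plane → ℂ}
    (hφ : ContDiff ℝ 1 φ) (hφc : HasCompactSupport φ)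
    (hψ : ContDiff ℝ 1 ψ) (hψc : HasCompactSupport ψ) :
    ∑ i, pairing (volume.restrict Ω) (pderiv i φ) (pderiv i ψ)
        + κ ^ 2 * pairing (volume.restrict Ω) φ ψ
      = ∑ i, pairing (volume.restrict Ω) (fun x => pderiv i φ x - X i x * φ x)
          (fun x => pderiv i ψ x - X i x * ψ x) + c * pairing (arcLength R) φ ψ := by
  have hdiv := hX.divergence (fun y => φ y * starRingEnd ℂ (ψ y)) (hφ.mul (contDiff_conj hψ))
    hφc.mul_right
  have mφ := memLp_of_continuous hφ.continuous hφc (volume.restrict Ω)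
  have mψ := memLp_of_continuous hψ.continuous hψc (volume.restrict Ω)
  have mdφ := fun i => memLp_of_continuous (continuous_pderiv hφ i)
    (hasCompactSupport_pderiv hφc i) (volume.restrict Ω)
  have mdψ := fun i => memLp_of_continuous (continuous_pderiv hψ i)
    (hasCompactSupport_pderiv hψc i) (volume.restrict Ω)
  have i0 := (integrable_pairing mφ mψ).const_mul ((κ : ℂ) ^ 2)
  have i1 := fun i => integrable_pairing (mdφ i) (mdψ i)
  have i2 : ∀ i, Integrable (fun x => (pderiv i φ x - X i x * φ x) *
      starRingEnd ℂ (pderiv i ψ x - X i x * ψ x)) (volume.restrict Ω) := fun i => integrable_pairing ((mdφ i).sub (hX.memLp_mul hΩ mφ i))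
    ((mdψ i).sub (hX.memLp_mul hΩ mψ i))
  have hlhs : ∑ i, pairing (volume.restrict Ω) (pderiv i φ) (pderiv i ψ)
        + κ ^ 2 * pairing (volume.restrict Ω) φ ψ =
      ∫ x in Ω, (∑ i, pderiv i φ x * starRingEnd ℂ (pderiv i ψ x)
        + κ ^ 2 * (φ x * starRingEnd ℂ (ψ x))) := by
    rw [integral_add (integrable_finsetSum _ fun i _ => i1 i) i0,
      integral_finsetSum _ fun i _ => i1 i, integral_const_mul]
    rfl
  have hsum : ∑ i, pairing (volume.restrict Ω) (fun x => pderiv i φ x - X i x * φ x)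
          (fun x => pderiv i ψ x - X i x * ψ x) =
      ∫ x in Ω, ∑ i, (pderiv i φ x - X i x * φ x) * starRingEnd ℂ (pderiv i ψ x - X i x * ψ x) := by
    rw [integral_finsetSum _ fun i _ => i2 i]
    rfl
  have i3 : Integrable (fun x => ∑ i, pderiv i φ x * starRingEnd ℂ (pderiv i ψ x)
      + κ ^ 2 * (φ x * starRingEnd ℂ (ψ x))) (volume.restrict Ω) :=
    (integrable_finsetSum _ fun i _ => i1 i).add i0
  rw [hlhs, hsum, pairing, ← Complex.real_smul, ← hdiv, ← sub_eq_iff_eq_add', ← integral_sub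
    i3 (integrable_finsetSum _ fun i _ => i2 i)]
  refine integral_congr_ae (ae_of_all _ fun x => ?_)
  simp only [pderiv_mul_conj hφ hψ, Fin.sum_univ_two, map_sub, map_mul, Complex.conj_ofReal,
    Complex.real_smul]
  push_cast
  ring

/-! ### Sobolev functions together with their gradients and traces -/

/-- `G` is the weak gradient and `g` the trace on the circle of radius `R` of `u ∈ H¹(Ω)`. -/
structure SobolevData (Ω : Set Plane) (R : ℝ) (u : Plane → ℂ) (G : Fin 2 → Plane → ℂ)
    (g : Plane → ℂ) : Prop where
  memLp : MemLp u 2 (volume.restrict Ω)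
  grad : HasWeakGrad Ω u G
  memLp_trace : MemLp g 2 (arcLength R)
  approx : ∃ φ : ℕ → Plane → ℂ,
    (∀ n, ContDiff ℝ (⊤ : ℕ∞) (φ n) ∧ HasCompactSupport (φ n)) ∧
    L2Tendsto (volume.restrict Ω) φ u ∧
    (∀ i, L2Tendsto (volume.restrict Ω) (fun n => pderiv i (φ n)) (G i)) ∧
    L2Tendsto (arcLength R) φ g

theorem contDiff_one_of_smooth {φ : Plane → ℂ} (h : ContDiff ℝ (⊤ : ℕ∞) φ) : ContDiff ℝ 1 φ :=
  h.of_le (by exact_mod_cast le_top)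

theorem IsRiccatiField.l2Tendsto_mul {Ω : Set Plane} {R κ c : ℝ} {X : Fin 2 → Plane → ℝ}
    (hX : IsRiccatiField Ω R κ c X) (hΩ : MeasurableSet Ω) {a : ℕ → Plane → ℂ} {u : Plane → ℂ}
    (h : L2Tendsto (volume.restrict Ω) a u) (i : Fin 2) :
    L2Tendsto (volume.restrict Ω) (fun n x => -((X i x : ℂ)) * a n x) (fun x => -((X i x : ℂ)) * u x) := by
  obtain ⟨B, hB⟩ := hX.bounded
  refine h.mul_bounded (B := B) ?_
  filter_upwards [ae_restrict_mem hΩ] with x hx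
  rw [norm_neg, Complex.norm_real, Real.norm_eq_abs]
  exact hB i x hx

/-- **Green's identity** for a field with `div X + |X|² = κ²`. -/
theorem IsRiccatiField.green {Ω : Set Plane} {R κ c : ℝ} {X : Fin 2 → Plane → ℝ}
    (hX : IsRiccatiField Ω R κ c X) (hΩ : MeasurableSet Ω) {u v g h : Plane → ℂ}
    {G H : Fin 2 → Plane → ℂ} (hu : SobolevData Ω R u G g) (hv : SobolevData Ω R v H h) :
    ∑ i, pairing (volume.restrict Ω) (G i) (H i) + κ ^ 2 * pairing (volume.restrict Ω) u v
      = ∑ i, pairing (volume.restrict Ω) (fun x => G i x - X i x * u x)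
          (fun x => H i x - X i x * v x) + c * pairing (arcLength R) g h := by
  obtain ⟨φ, hφ, hφu, hφG, hφg⟩ := hu.approx
  obtain ⟨ψ, hψ, hψv, hψH, hψh⟩ := hv.approx
  have mφ := fun n (μ : Measure Plane) [IsFiniteMeasureOnCompacts μ] =>
    memLp_of_continuous (hφ n).1.continuous (hφ n).2 μ
  have mψ := fun n (μ : Measure Plane) [IsFiniteMeasureOnCompacts μ] =>
    memLp_of_continuous (hψ n).1.continuous (hψ n).2 μ
  have mdφ := fun i n => memLp_of_continuous (continuous_pderiv (contDiff_one_of_smooth (hφ n).1) i)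
    (hasCompactSupport_pderiv (hφ n).2 i) (volume.restrict Ω)
  have mdψ := fun i n => memLp_of_continuous (continuous_pderiv (contDiff_one_of_smooth (hψ n).1) i)
    (hasCompactSupport_pderiv (hψ n).2 i) (volume.restrict Ω)
  have tsub : ∀ (i : Fin 2) (χ : ℕ → Plane → ℂ) (w : Plane → ℂ) (W : Plane → ℂ),
      (∀ n, MemLp (χ n) 2 (volume.restrict Ω)) → MemLp w 2 (volume.restrict Ω) →
      (∀ n, MemLp (pderiv i (χ n)) 2 (volume.restrict Ω)) → MemLp W 2 (volume.restrict Ω) →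
      L2Tendsto (volume.restrict Ω) χ w → L2Tendsto (volume.restrict Ω) (fun n => pderiv i (χ n)) W →
      L2Tendsto (volume.restrict Ω) (fun n x => pderiv i (χ n) x - X i x * χ n x)
        (fun x => W x - X i x * w x) := by
    intro i χ w W h1 h2 h3 h4 h5 h6
    have hn : ∀ {z : Plane → ℂ}, MemLp z 2 (volume.restrict Ω) →
        AEStronglyMeasurable (fun x => -((X i x : ℂ)) * z x) (volume.restrict Ω) := fun hz =>
      (hX.memLp_mul hΩ hz i).neg.aestronglyMeasurable.congr (ae_of_all _ fun x => by simp)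
    refine (h6.add (hX.l2Tendsto_mul hΩ h5 i) (fun n => (h3 n).aestronglyMeasurable)
      (fun n => hn (h1 n)) h4.aestronglyMeasurable (hn h2)).congr_ae
      (fun n => ae_of_all _ fun x => ?_) (ae_of_all _ fun x => ?_) <;> simp only <;> ring
  have hmsub := fun i (z W : Plane → ℂ) (hz : MemLp z 2 (volume.restrict Ω))
    (hW : MemLp W 2 (volume.restrict Ω)) => hW.sub (hX.memLp_mul hΩ hz i)
  have hL := (tendsto_finsetSum Finset.univ fun i _ => (hφG i).pairing (hψH i) (mdφ i)
    (hu.grad i).1 (mdψ i) (hv.grad i).1).add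
    ((hφu.pairing hψv (fun n => mφ n _) hu.memLp (fun n => mψ n _) hv.memLp).const_mul ((κ : ℂ) ^ 2))
  have hR := (tendsto_finsetSum Finset.univ fun i _ =>
    (tsub i φ u (G i) (fun n => mφ n _) hu.memLp (mdφ i) (hu.grad i).1 hφu (hφG i)).pairing
      (tsub i ψ v (H i) (fun n => mψ n _) hv.memLp (mdψ i) (hv.grad i).1 hψv (hψH i))
      (fun n => hmsub i _ _ (mφ n _) (mdφ i n)) (hmsub i _ _ hu.memLp (hu.grad i).1)
      (fun n => hmsub i _ _ (mψ n _) (mdψ i n)) (hmsub i _ _ hv.memLp (hv.grad i).1)).add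
    ((hφg.pairing hψh (fun n => mφ n _) hu.memLp_trace (fun n => mψ n _)
      hv.memLp_trace).const_mul (c : ℂ))
  refine tendsto_nhds_unique hL (hR.congr fun n => ?_)
  exact (hX.green_smooth hΩ (contDiff_one_of_smooth (hφ n).1) (hφ n).2
    (contDiff_one_of_smooth (hψ n).1) (hψ n).2).symm

/-- The squared `L²` norm. -/
def normSq (μ : Measure Plane) (a : Plane → ℂ) : ℝ := ∫ x, ‖a x‖ ^ 2 ∂μ

theorem normSq_nonneg (μ : Measure Plane) (a : Plane → ℂ) : 0 ≤ normSq μ a :=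
  integral_nonneg fun _ => by positivity

theorem pairing_self (μ : Measure Plane) (a : Plane → ℂ) : pairing μ a a = normSq μ a := by
  rw [pairing, normSq, ← integral_complex_ofReal]
  congr 1
  funext x
  rw [Complex.mul_conj, Complex.normSq_eq_norm_sq]

theorem ae_eq_zero_of_normSq {μ : Measure Plane} {a : Plane → ℂ} (ha : MemLp a 2 μ)
    (h : normSq μ a = 0) : a =ᵐ[μ] 0 := by
  have h1 := (integral_eq_zero_iff_of_nonneg (fun _ => by positivity) (ha.integrable_norm_pow two_ne_zero)).1 h
  filter_upwards [h1] with x hx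
  simpa using hx

theorem normSq_congr_ae {μ : Measure Plane} {a b : Plane → ℂ} (h : a =ᵐ[μ] b) :
    normSq μ a = normSq μ b := by
  refine integral_congr_ae ?_
  filter_upwards [h] with x hx
  rw [hx]

theorem normSq_eq_norm_toLp {μ : Measure Plane} {a : Plane → ℂ} (ha : MemLp a 2 μ) :
    normSq μ a = ‖ha.toLp a‖ ^ 2 := by
  have h1 := pairing_eq_inner ha ha
  rw [pairing_self, inner_self_eq_norm_sq_to_K] at h1
  exact Complex.ofReal_injective (by simpa using h1)

theorem IsRiccatiField.green_normSq {Ω : Set Plane} {R κ c : ℝ} {X : Fin 2 → Plane → ℝ}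
    (hX : IsRiccatiField Ω R κ c X) (hΩ : MeasurableSet Ω) {u g : Plane → ℂ}
    {G : Fin 2 → Plane → ℂ} (hu : SobolevData Ω R u G g) :
    ∑ i, normSq (volume.restrict Ω) (G i) + κ ^ 2 * normSq (volume.restrict Ω) u
      = ∑ i, normSq (volume.restrict Ω) (fun x => G i x - X i x * u x)
        + c * normSq (arcLength R) g := by
  have h := hX.green hΩ hu hu
  simp only [pairing_self] at h
  exact_mod_cast h

/-- The weak gradient is determined almost everywhere by the class of the function. -/
theorem HasWeakGrad.ae_eq {Ω : Set Plane} (hΩ : IsOpen Ω) {u u' : Plane → ℂ}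
    {G G' : Fin 2 → Plane → ℂ} (h : HasWeakGrad Ω u G) (h' : HasWeakGrad Ω u' G')
    (huu : u =ᵐ[volume.restrict Ω] u') (i : Fin 2) : G i =ᵐ[volume.restrict Ω] G' i := by
  have hl : ∀ {w : Plane → ℂ}, MemLp w 2 (volume.restrict Ω) → LocallyIntegrableOn w Ω := fun hw =>
    locallyIntegrableOn_of_locallyIntegrable_restrict (hw.locallyIntegrable (by norm_num))
  have key := hΩ.ae_eq_zero_of_integral_contDiff_smul_eq_zero (μ := volume)
    ((hl (h i).1).sub (hl (h' i).1)) fun φ hφ hφc hφs => ?_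
  · refine (ae_restrict_iff' hΩ.measurableSet).2 ?_
    filter_upwards [key] with x hx hxΩ
    exact sub_eq_zero.1 (hx hxΩ)
  · have h1 := (h i).2 φ hφ hφc hφs
    have h2 := (h' i).2 φ hφ hφc hφs
    have h3 : ∫ x in Ω, pderiv i φ x • u x = ∫ x in Ω, pderiv i φ x • u' x := by
      refine integral_congr_ae ?_
      filter_upwards [huu] with x hx
      rw [hx]
    have hφm : MemLp φ 2 (volume.restrict Ω) := hφ.continuous.memLp_of_hasCompactSupport hφc
    have hi : ∀ {w : Plane → ℂ}, MemLp w 2 (volume.restrict Ω) →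
        Integrable (fun x => φ x • w x) (volume.restrict Ω) := fun hw =>
      memLp_one_iff_integrable.1 (hw.smul hφm)
    have h4 : ∫ x in Ω, φ x • G i x = ∫ x in Ω, φ x • G' i x := by
      rw [h1, h2, neg_inj] at h3
      exact h3
    rw [← setIntegral_eq_integral_of_forall_compl_eq_zero (s := Ω) fun x hx => by
      have : x ∉ tsupport φ := fun hm => hx (hφs hm)
      rw [image_eq_zero_of_notMem_tsupport this, zero_smul]]
    simp only [Pi.sub_apply, smul_sub]
    rw [integral_sub (hi (h i).1) (hi (h' i).1), h4, sub_self]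

/-! ### Existence and uniqueness of traces -/

/-- A domain with a dilation into itself and a field giving Green's identity. The dilation makes
smooth functions dense in `H¹(Ω)`; by Green's identity, whose boundary term has a positive
coefficient, the `H¹` norm bounds the trace. -/
structure IsTraceDomain (Ω : Set Plane) (R : ℝ) : Prop where
  dilation : ∃ s, IsDilationDomain Ω R s
  field : ∃ κ c X, 0 < c ∧ IsRiccatiField Ω R κ c X

theorem isTraceDomain_disk {R : ℝ} (hR : 0 < R) : IsTraceDomain (disk R) R :=
  ⟨⟨_, isDilationDomain_disk hR⟩,
    ⟨1, _, _, logDerivI_pos one_pos hR, isRiccatiField_logDerivI one_pos hR⟩⟩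

theorem isTraceDomain_exterior {R : ℝ} (hR : 0 < R) : IsTraceDomain (exterior R) R :=
  ⟨⟨_, isDilationDomain_exterior hR⟩,
    ⟨1, _, _, neg_logDerivK_pos one_pos hR, isRiccatiField_logDerivK one_pos hR⟩⟩

theorem IsTraceDomain.isOpen {Ω : Set Plane} {R : ℝ} (h : IsTraceDomain Ω R) : IsOpen Ω :=
  let ⟨_, hs⟩ := h.dilation; hs.isOpen

theorem pderiv_sub {φ ψ : Plane → ℂ} (hφ : ContDiff ℝ 1 φ) (hψ : ContDiff ℝ 1 ψ) (i : Fin 2) :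
    pderiv i (fun y => φ y - ψ y) = fun x => pderiv i φ x - pderiv i ψ x := by
  funext x
  have := ((hφ.differentiable one_ne_zero x).hasFDerivAt.sub
    (hψ.differentiable one_ne_zero x).hasFDerivAt)
  rw [pderiv]
  change fderiv ℝ (φ - ψ) x _ = _
  rw [this.fderiv]
  rfl

theorem pderiv_const_mul_add {φ ψ : Plane → ℂ} (hφ : ContDiff ℝ 1 φ) (hψ : ContDiff ℝ 1 ψ) (c : ℂ)
    (i : Fin 2) : pderiv i (fun y => c * φ y + ψ y) = fun x => c * pderiv i φ x + pderiv i ψ x := by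
  funext x
  have := (((hφ.differentiable one_ne_zero x).hasFDerivAt.const_mul c).add
    (hψ.differentiable one_ne_zero x).hasFDerivAt)
  rw [pderiv]
  erw [this.fderiv]
  rfl

/-- Green's identity with the square dropped bounds the boundary values by the `H¹` norm. -/
theorem IsRiccatiField.trace_le_smooth {Ω : Set Plane} {R κ c : ℝ} {X : Fin 2 → Plane → ℝ}
    (hX : IsRiccatiField Ω R κ c X) (hΩ : MeasurableSet Ω) {φ : Plane → ℂ}
    (hφ : ContDiff ℝ 1 φ) (hφc : HasCompactSupport φ) :
    c * normSq (arcLength R) φ ≤ ∑ i, normSq (volume.restrict Ω) (pderiv i φ)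
      + κ ^ 2 * normSq (volume.restrict Ω) φ := by
  have h := hX.green_smooth hΩ hφ hφc hφ hφc
  simp only [pairing_self] at h
  have h' : ∑ i, normSq (volume.restrict Ω) (pderiv i φ) + κ ^ 2 * normSq (volume.restrict Ω) φ
      = ∑ i, normSq (volume.restrict Ω) (fun x => pderiv i φ x - X i x * φ x)
        + c * normSq (arcLength R) φ := by exact_mod_cast h
  rw [h']
  exact le_add_of_nonneg_left (Finset.sum_nonneg fun i _ => normSq_nonneg _ _)

/-- **Trace theorem**: every element of `H¹(Ω)` has a trace. -/
theorem IsTraceDomain.exists_trace {Ω : Set Plane} {R : ℝ} (h : IsTraceDomain Ω R)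
    {u : Plane → ℂ} {G : Fin 2 → Plane → ℂ} (hu : MemLp u 2 (volume.restrict Ω))
    (hG : HasWeakGrad Ω u G) : ∃ g, SobolevData Ω R u G g ∧
      ∀ v : Plane → ℂ, Continuous v → (∀ᵐ x, x ∈ Ω → u x = v x) → g =ᵐ[arcLength R] v := by
  obtain ⟨s, hs⟩ := h.dilation
  obtain ⟨κ, c, X, hc, hX⟩ := h.field
  obtain ⟨φ, hφ, hφu, hφG, hφv⟩ := exists_smooth_approx hs hu hG
  have mφ := fun n (μ : Measure Plane) [IsFiniteMeasureOnCompacts μ] =>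
    memLp_of_continuous (hφ n).1.continuous (hφ n).2 μ
  have mdφ := fun i n => memLp_of_continuous (continuous_pderiv (contDiff_one_of_smooth (hφ n).1) i)
    (hasCompactSupport_pderiv (hφ n).2 i) (volume.restrict Ω)
  have key : ∀ n m, c * dist ((mφ n (arcLength R)).toLp _) ((mφ m (arcLength R)).toLp _) ^ 2 ≤
      ∑ i, dist ((mdφ i n).toLp _) ((mdφ i m).toLp _) ^ 2
        + κ ^ 2 * dist ((mφ n (volume.restrict Ω)).toLp _) ((mφ m (volume.restrict Ω)).toLp _) ^ 2 := by
    intro n m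
    have h1 := hX.trace_le_smooth h.isOpen.measurableSet (φ := fun x => φ n x - φ m x)
      ((contDiff_one_of_smooth (hφ n).1).sub (contDiff_one_of_smooth (hφ m).1))
      ((hφ n).2.sub (hφ m).2)
    simp only [pderiv_sub (contDiff_one_of_smooth (hφ n).1) (contDiff_one_of_smooth (hφ m).1)] at h1
    have e : ∀ {μ : Measure Plane} {a b : Plane → ℂ} (ha : MemLp a 2 μ) (hb : MemLp b 2 μ),
        normSq μ (fun x => a x - b x) = dist (ha.toLp a) (hb.toLp b) ^ 2 := fun ha hb => by
      rw [dist_eq_norm, ← MemLp.toLp_sub ha hb]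
      exact normSq_eq_norm_toLp (ha.sub hb)
    rw [e (mφ n (arcLength R)) (mφ m (arcLength R)),
      e (mφ n (volume.restrict Ω)) (mφ m (volume.restrict Ω))] at h1
    simpa only [fun i => e (mdφ i n) (mdφ i m)] using h1
  have c1 := cauchySeq_iff_tendsto_dist_atTop_0.1
    (hφu.tendsto_toLp (fun n => mφ n _) hu).cauchySeq
  have c2 := fun i => cauchySeq_iff_tendsto_dist_atTop_0.1
    ((hφG i).tendsto_toLp (mdφ i) (hG i).1).cauchySeq
  have hcau : CauchySeq fun n => (mφ n (arcLength R)).toLp (φ n) := by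
    rw [cauchySeq_iff_tendsto_dist_atTop_0]
    have hlim := (((tendsto_finsetSum Finset.univ fun i _ => (c2 i).pow 2).add
      ((c1.pow 2).const_mul (κ ^ 2))).const_mul c⁻¹).sqrt
    simp only [ne_eq, OfNat.ofNat_ne_zero, not_false_eq_true, zero_pow, Finset.sum_const_zero,
      mul_zero, add_zero, Real.sqrt_zero] at hlim
    refine squeeze_zero (fun _ => dist_nonneg) (fun p => Real.le_sqrt_of_sq_le ?_) hlim
    rw [le_inv_mul_iff₀ hc]
    exact key p.1 p.2
  obtain ⟨g, hg⟩ := cauchySeq_tendsto_of_complete hcau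
  have hgt : L2Tendsto (arcLength R) φ g := by
    have := (Lp.tendsto_Lp_iff_tendsto_eLpNorm' _ _).1 hg
    refine this.congr fun n => eLpNorm_congr_ae ?_
    filter_upwards [(mφ n (arcLength R)).coeFn_toLp] with x hx
    rw [Pi.sub_apply, hx]
  refine ⟨g, ⟨hu, hG, Lp.memLp g, φ, hφ, hφu, hφG, hgt⟩, fun v hv huv => ?_⟩
  have hvt := hφv v hv huv
  have hvm : MemLp v 2 (arcLength R) := by
    obtain ⟨M, hM⟩ := (isCompact_closedBall (0 : Plane) R).exists_bound_of_continuousOn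
      hv.continuousOn
    refine MemLp.of_bound hv.aestronglyMeasurable M ?_
    filter_upwards [ae_norm_eq_arcLength hs.pos.le] with x hx
    exact hM x (by rw [mem_closedBall_zero_iff, hx])
  have := tendsto_nhds_unique hg (hvt.tendsto_toLp (fun n => mφ n _) hvm)
  rw [this]
  exact hvm.coeFn_toLp

theorem HasWeakGrad.const_mul_add {Ω : Set Plane} {u v : Plane → ℂ} {G H : Fin 2 → Plane → ℂ}
    (hu : MemLp u 2 (volume.restrict Ω)) (hv : MemLp v 2 (volume.restrict Ω))
    (hG : HasWeakGrad Ω u G) (hH : HasWeakGrad Ω v H) (c : ℂ) :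
    HasWeakGrad Ω (fun x => c * u x + v x) (fun i x => c * G i x + H i x) := by
  refine fun i => ⟨((hG i).1.const_mul c).add (hH i).1, fun φ hφ hφc hφs => ?_⟩
  have hi : ∀ {w : Plane → ℂ} {χ : Plane → ℝ}, Continuous χ → HasCompactSupport χ →
      MemLp w 2 (volume.restrict Ω) →
      Integrable (fun x => χ x • w x) (volume.restrict Ω) := fun hχ hχc hw =>
    memLp_one_iff_integrable.1 (hw.smul (hχ.memLp_of_hasCompactSupport (p := 2) hχc))
  have hdc : Continuous (pderiv i φ) :=
    (hφ.continuous_fderiv (by simp)).clm_apply continuous_const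
  have hds := hasCompactSupport_pderiv hφc i
  have e : ∀ (χ : Plane → ℝ) (w z : Plane → ℂ), (fun x => χ x • (c * w x + z x))
      = fun x => c * (χ x • w x) + χ x • z x := fun χ w z => by
    funext x
    rw [smul_add, mul_smul_comm]
  rw [e, e, integral_add ((hi hdc hds hu).const_mul c) (hi hdc hds hv),
    integral_add ((hi hφ.continuous hφc (hG i).1).const_mul c) (hi hφ.continuous hφc (hH i).1),
    integral_const_mul, integral_const_mul, (hG i).2 φ hφ hφc hφs, (hH i).2 φ hφ hφc hφs]
  ring

theorem L2Tendsto.const_mul_add {μ : Measure Plane} {a a' : ℕ → Plane → ℂ} {b b' : Plane → ℂ}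
    (h : L2Tendsto μ a b) (h' : L2Tendsto μ a' b') (c : ℂ)
    (hm : ∀ n, AEStronglyMeasurable (a n) μ) (hm' : ∀ n, AEStronglyMeasurable (a' n) μ)
    (hb : AEStronglyMeasurable b μ) (hb' : AEStronglyMeasurable b' μ) :
    L2Tendsto μ (fun n x => c * a n x + a' n x) (fun x => c * b x + b' x) :=
  (h.mul_bounded (w := fun _ => c) (ae_of_all _ fun _ => le_rfl)).add h'
    (fun n => (hm n).const_mul c) hm' (hb.const_mul c) hb'

theorem SobolevData.const_mul_add {Ω : Set Plane} {R : ℝ} {u v g h : Plane → ℂ}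
    {G H : Fin 2 → Plane → ℂ} (hu : SobolevData Ω R u G g) (hv : SobolevData Ω R v H h) (c : ℂ) :
    SobolevData Ω R (fun x => c * u x + v x) (fun i x => c * G i x + H i x)
      (fun x => c * g x + h x) := by
  obtain ⟨φ, hφ, hφu, hφG, hφg⟩ := hu.approx
  obtain ⟨ψ, hψ, hψv, hψH, hψh⟩ := hv.approx
  have sm : ∀ {χ : Plane → ℂ} {μ : Measure Plane}, ContDiff ℝ (⊤ : ℕ∞) χ →
    AEStronglyMeasurable χ μ := fun h => h.continuous.aestronglyMeasurable
  have sd : ∀ {χ : Plane → ℂ} {μ : Measure Plane} (i : Fin 2), ContDiff ℝ (⊤ : ℕ∞) χ →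
    AEStronglyMeasurable (pderiv i χ) μ := fun i h =>
      (continuous_pderiv (contDiff_one_of_smooth h) i).aestronglyMeasurable
  refine ⟨(hu.memLp.const_mul c).add hv.memLp, hu.grad.const_mul_add hu.memLp hv.memLp hv.grad c,
    (hu.memLp_trace.const_mul c).add hv.memLp_trace, fun n x => c * φ n x + ψ n x,
    fun n => ⟨(contDiff_const.mul (hφ n).1).add (hψ n).1, ((hφ n).2.mul_left).add (hψ n).2⟩,
    hφu.const_mul_add hψv c (fun n => sm (hφ n).1) (fun n => sm (hψ n).1)
      hu.memLp.aestronglyMeasurable hv.memLp.aestronglyMeasurable, fun i => ?_,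
    hφg.const_mul_add hψh c (fun n => sm (hφ n).1) (fun n => sm (hψ n).1)
      hu.memLp_trace.aestronglyMeasurable hv.memLp_trace.aestronglyMeasurable⟩
  simp only [fun n => pderiv_const_mul_add (contDiff_one_of_smooth (hφ n).1)
    (contDiff_one_of_smooth (hψ n).1) c i]
  exact (hφG i).const_mul_add (hψH i) c (fun n => sd i (hφ n).1) (fun n => sd i (hψ n).1)
    (hu.grad i).1.aestronglyMeasurable (hv.grad i).1.aestronglyMeasurable

/-- The trace is determined almost everywhere by the function. -/
theorem SobolevData.trace_unique {Ω : Set Plane} {R : ℝ} (hΩ : IsTraceDomain Ω R)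
    {u v g h : Plane → ℂ} {G H : Fin 2 → Plane → ℂ} (hu : SobolevData Ω R u G g)
    (hv : SobolevData Ω R v H h) (huv : u =ᵐ[volume.restrict Ω] v) : g =ᵐ[arcLength R] h := by
  obtain ⟨κ, c, X, hc, hX⟩ := hΩ.field
  have hd := hu.const_mul_add hv (-1)
  have hG := fun i => hu.grad.ae_eq hΩ.isOpen hv.grad huv i
  have hgreen := hX.green_normSq hΩ.isOpen.measurableSet hd
  have e0 : normSq (volume.restrict Ω) (fun x => -1 * u x + v x) = 0 := by
    rw [normSq_congr_ae (b := 0) (by filter_upwards [huv] with x hx; simp [hx])]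
    simp [normSq]
  have e1 : ∀ i, normSq (volume.restrict Ω) (fun x => -1 * G i x + H i x) = 0 := fun i => by
    rw [normSq_congr_ae (b := 0) (by filter_upwards [hG i] with x hx; simp [hx])]
    simp [normSq]
  simp only [e0, e1, Finset.sum_const_zero, mul_zero, add_zero] at hgreen
  have h1 : 0 ≤ ∑ i, normSq (volume.restrict Ω) (fun x => (-1 * G i x + H i x)
      - X i x * (-1 * u x + v x)) := Finset.sum_nonneg fun i _ => normSq_nonneg _ _
  have h2 : normSq (arcLength R) (fun x => -1 * g x + h x) = 0 := by
    have := normSq_nonneg (arcLength R) (fun x => -1 * g x + h x)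
    nlinarith
  filter_upwards [ae_eq_zero_of_normSq hd.memLp_trace h2] with x hx
  have : -1 * g x + h x = 0 := hx
  linear_combination -this

theorem SobolevData.congr {Ω : Set Plane} {R : ℝ}
    {u v g : Plane → ℂ} {G : Fin 2 → Plane → ℂ} (hu : SobolevData Ω R u G g)
    (huv : u =ᵐ[volume.restrict Ω] v) : SobolevData Ω R v G g := by
  obtain ⟨φ, hφ, hφu, hφG, hφg⟩ := hu.approx
  refine ⟨hu.memLp.ae_eq huv, fun i => ⟨(hu.grad i).1, fun ψ hψ hψc hψs => ?_⟩, hu.memLp_trace,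
    φ, hφ, hφu.congr_ae (fun _ => EventuallyEq.rfl) huv, hφG, hφg⟩
  rw [← (hu.grad i).2 ψ hψ hψc hψs]
  refine integral_congr_ae ?_
  filter_upwards [huv] with x hx
  rw [hx]

theorem hasWeakGrad_weakGrad {Ω : Set Plane} {u : Plane → ℂ} (h : MemH1 Ω u) :
    HasWeakGrad Ω u (weakGrad Ω u) := by
  rw [weakGrad, dif_pos h.2]
  exact h.2.choose_spec

theorem IsTraceDomain.sobolevData {Ω : Set Plane} {R : ℝ} (hΩ : IsTraceDomain Ω R)
    {u : Plane → ℂ} (h : MemH1 Ω u) :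
    SobolevData Ω R u (weakGrad Ω u) (trace Ω (arcLength R) u) := by
  have hG := hasWeakGrad_weakGrad h
  have hex : ∃ g, IsTrace Ω (arcLength R) u g := by
    obtain ⟨g, hg, -⟩ := hΩ.exists_trace h.1 hG
    exact ⟨g, hg.memLp_trace, hg.approx⟩
  have hs : IsTrace Ω (arcLength R) u (trace Ω (arcLength R) u) := by
    rw [trace, dif_pos hex]
    exact hex.choose_spec
  exact ⟨h.1, hG, hs.1, hs.2⟩

/-! ### The quadratic form -/

theorem ae_mem_disk_or_exterior (R : ℝ) :
    ∀ᵐ x : Plane, x ∈ disk R ∨ x ∈ exterior R := by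
  have h := Measure.addHaar_sphere (volume : Measure Plane) 0 R
  refine (measure_eq_zero_iff_ae_notMem.1 h).mono fun x hx => ?_
  rcases lt_trichotomy ‖x‖ R with h1 | h1 | h1
  · exact Or.inl h1
  · exact absurd (mem_sphere_zero_iff_norm.2 h1) hx
  · exact Or.inr h1

theorem integral_disk_add_exterior (R : ℝ) {f : Plane → ℂ} (hf : Integrable f) :
    (∫ x in disk R, f x) + ∫ x in exterior R, f x = ∫ x, f x := by
  have hd : Disjoint (disk R) (exterior R) := by
    rw [Set.disjoint_left]
    intro x (hx : ‖x‖ < R) (hx' : R < ‖x‖)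
    exact lt_asymm hx hx'
  rw [← setIntegral_union hd (measurableSet_exterior R) hf.integrableOn hf.integrableOn]
  conv_rhs => rw [← setIntegral_univ (μ := volume)]
  refine setIntegral_congr_set ?_
  filter_upwards [ae_mem_disk_or_exterior R] with x hx
  exact propext ⟨fun _ => mem_univ x, fun _ => hx⟩

theorem pairing_disk_add_exterior (R : ℝ) {a b : Plane → ℂ} (ha : MemLp a 2 volume)
    (hb : MemLp b 2 volume) : pairing (volume.restrict (disk R)) a b
      + pairing (volume.restrict (exterior R)) a b = pairing volume a b :=
  integral_disk_add_exterior R (integrable_pairing ha hb)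

theorem norm_sub_sq_add {c d : ℝ} (hc : 0 < c) (hd : 0 < d) (a b : ℂ) :
    ‖a - b‖ ^ 2 + (c * d)⁻¹ * ‖c * a + d * b‖ ^ 2
      = (c⁻¹ + d⁻¹) * (c * ‖a‖ ^ 2 + d * ‖b‖ ^ 2) := by
  simp only [← Complex.normSq_eq_norm_sq, Complex.normSq_apply, Complex.sub_re, Complex.sub_im,
    Complex.add_re, Complex.add_im, Complex.re_ofReal_mul, Complex.im_ofReal_mul]
  field_simp
  ring

/-- The Cauchy–Schwarz inequality for a difference, with its defect. -/
theorem normSq_sub_add {μ : Measure Plane} {c d : ℝ} (hc : 0 < c) (hd : 0 < d) {a b : Plane → ℂ}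
    (ha : MemLp a 2 μ) (hb : MemLp b 2 μ) :
    normSq μ (fun x => a x - b x) + (c * d)⁻¹ * normSq μ (fun x => c * a x + d * b x)
      = (c⁻¹ + d⁻¹) * (c * normSq μ a + d * normSq μ b) := by
  have ia := ha.integrable_norm_pow two_ne_zero
  have ib := hb.integrable_norm_pow two_ne_zero
  have i1 := (ha.sub hb).integrable_norm_pow two_ne_zero
  have i2 := ((ha.const_mul (c : ℂ)).add (hb.const_mul (d : ℂ))).integrable_norm_pow two_ne_zero
  simp only [normSq, ← integral_const_mul]
  rw [← integral_add (ia.const_mul c) (ib.const_mul d), ← integral_const_mul]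
  refine (integral_add i1 (i2.const_mul _)).symm.trans ?_
  exact integral_congr_ae (ae_of_all _ fun x => norm_sub_sq_add hc hd (a x) (b x))

theorem SobolevData.congr_grad {Ω : Set Plane} {R : ℝ}
    {u g : Plane → ℂ} {G H : Fin 2 → Plane → ℂ} (hu : SobolevData Ω R u G g)
    (hH : HasWeakGrad Ω u H) (hGH : ∀ i, G i =ᵐ[volume.restrict Ω] H i) :
    SobolevData Ω R u H g := by
  obtain ⟨φ, hφ, hφu, hφG, hφg⟩ := hu.approx
  exact ⟨hu.memLp, hH, hu.memLp_trace, φ, hφ, hφu,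
    fun i => (hφG i).congr_ae (fun _ => EventuallyEq.rfl) (hGH i), hφg⟩

/-- The Sobolev data of `u ∈ H¹(Ω)` for any representative of the weak gradient. -/
theorem IsTraceDomain.sobolevData_of_hasWeakGrad {Ω : Set Plane} {R : ℝ} (hΩ : IsTraceDomain Ω R)
    {u : Plane → ℂ} {G : Fin 2 → Plane → ℂ} (hu : MemLp u 2 (volume.restrict Ω))
    (hG : HasWeakGrad Ω u G) :
    SobolevData Ω R u G (trace Ω (arcLength R) u) := by
  have h : MemH1 Ω u := ⟨hu, G, hG⟩
  exact (hΩ.sobolevData h).congr_grad hG fun i =>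
    (hasWeakGrad_weakGrad h).ae_eq hΩ.isOpen hG EventuallyEq.rfl i

theorem HasWeakGrad.congr {Ω : Set Plane} {u v : Plane → ℂ} {G H : Fin 2 → Plane → ℂ}
    (h : HasWeakGrad Ω u G) (huv : u =ᵐ[volume.restrict Ω] v)
    (hGH : ∀ i, G i =ᵐ[volume.restrict Ω] H i) : HasWeakGrad Ω v H := by
  refine fun i => ⟨(h i).1.ae_eq (hGH i), fun φ hφ hφc hφs => ?_⟩
  have e1 : ∫ x in Ω, pderiv i φ x • v x = ∫ x in Ω, pderiv i φ x • u x := by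
    refine integral_congr_ae ?_
    filter_upwards [huv] with x hx
    rw [hx]
  have e2 : ∫ x in Ω, φ x • H i x = ∫ x in Ω, φ x • G i x := by
    refine integral_congr_ae ?_
    filter_upwards [hGH i] with x hx
    rw [hx]
  rw [e1, e2]
  exact (h i).2 φ hφ hφc hφs

/-! ### The form domain as a Hilbert space -/

theorem memLp_restrict (f : L2Plane) (Ω : Set Plane) : MemLp f 2 (volume.restrict Ω) :=
  (Lp.memLp f).restrict Ω

/-- Triples `(u, G₀, G₁)` of square-integrable functions. -/
abbrev L2Triple := PiLp 2 fun _ : Fin 3 => L2Plane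

theorem coe_smul_add (p q : L2Triple) (c : ℂ) (j : Fin 3) (Ω : Set Plane) :
    (fun x => c * p j x + q j x) =ᵐ[volume.restrict Ω] (c • p + q) j := by
  refine ae_restrict_of_ae ?_
  filter_upwards [Lp.coeFn_add (c • p j) (q j), Lp.coeFn_smul c (p j)] with x h1 h2
  change _ = (c • p j + q j : L2Plane) x
  rw [h1, Pi.add_apply, h2]
  rfl

theorem hasWeakGrad_zero (Ω : Set Plane) :
    HasWeakGrad Ω ((0 : L2Triple) 0) (fun i => (0 : L2Triple) i.succ) := by
  have h0 : ∀ j, (0 : Plane → ℂ) =ᵐ[volume.restrict Ω] (0 : L2Triple) j := fun j =>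
    ae_restrict_of_ae (Lp.coeFn_zero _ _ _).symm
  refine HasWeakGrad.congr (u := 0) (G := fun _ => 0) (fun i => ⟨MemLp.zero, fun φ _ _ _ => ?_⟩)
    (h0 0) fun i => h0 i.succ
  simp

theorem HasWeakGrad.smul_add_triple {Ω : Set Plane} {p q : L2Triple}
    (hp : HasWeakGrad Ω (p 0) (fun i => p i.succ)) (hq : HasWeakGrad Ω (q 0) (fun i => q i.succ))
    (c : ℂ) : HasWeakGrad Ω ((c • p + q) 0) (fun i => (c • p + q) i.succ) :=
  (hp.const_mul_add (memLp_restrict _ _) (memLp_restrict _ _) hq c).congr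
    (coe_smul_add p q c 0 Ω) fun i => coe_smul_add p q c i.succ Ω

/-- The space `H¹(ℝ² ∖ C_R)`, as the closed subspace of the triples `(u, G₀, G₁)` in which
`(G₀, G₁)` is the weak gradient of `u` on the disk and on its exterior. -/
def formSpace (R : ℝ) : Submodule ℂ L2Triple where
  carrier := {p | HasWeakGrad (disk R) (p 0) (fun i => p i.succ) ∧
    HasWeakGrad (exterior R) (p 0) (fun i => p i.succ)}
  add_mem' {p q} hp hq := by
    have h1 := hp.1.smul_add_triple hq.1 1
    have h2 := hp.2.smul_add_triple hq.2 1
    rw [one_smul] at h1 h2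
    exact ⟨h1, h2⟩
  zero_mem' := ⟨hasWeakGrad_zero _, hasWeakGrad_zero _⟩
  smul_mem' c p hp := by
    have h1 := hp.1.smul_add_triple (hasWeakGrad_zero _) c
    have h2 := hp.2.smul_add_triple (hasWeakGrad_zero _) c
    rw [add_zero] at h1 h2
    exact ⟨h1, h2⟩

theorem continuous_setIntegral_smul {Ω : Set Plane} (hΩ : MeasurableSet Ω) {w : Plane → ℝ}
    (hw : Continuous w) (hwc : HasCompactSupport w) :
    Continuous fun f : L2Plane => ∫ x in Ω, w x • f x := by
  have hW : MemLp (Ω.indicator fun x => (w x : ℂ)) 2 volume := by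
    refine (memLp_indicator_iff_restrict hΩ).2 ?_
    exact (Complex.continuous_ofReal.comp hw).memLp_of_hasCompactSupport
      (hwc.comp_left Complex.ofReal_zero)
  have e : (fun f : L2Plane => ∫ x in Ω, w x • f x) = fun f => inner ℂ (hW.toLp _) f := by
    funext f
    rw [L2.inner_def, ← integral_indicator hΩ]
    refine integral_congr_ae ?_
    filter_upwards [hW.coeFn_toLp] with x hx
    rw [hx]
    by_cases hxΩ : x ∈ Ω <;> simp [hxΩ, mul_comm]
  rw [e]
  exact continuous_const.inner continuous_id

theorem isClosed_hasWeakGrad {Ω : Set Plane} (hΩ : MeasurableSet Ω) :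
    IsClosed {p : L2Triple | HasWeakGrad Ω (p 0) (fun i => p i.succ)} := by
  have e : {p : L2Triple | HasWeakGrad Ω (p 0) (fun i => p i.succ)} =
      ⋂ (i : Fin 2) (φ : Plane → ℝ) (_ : ContDiff ℝ (⊤ : ℕ∞) φ) (_ : HasCompactSupport φ)
        (_ : tsupport φ ⊆ Ω), {p : L2Triple | ∫ x in Ω, pderiv i φ x • p 0 x =
          -∫ x in Ω, φ x • p i.succ x} := by
    ext p
    simp only [mem_iInter, mem_ofPred_eq, HasWeakGrad]
    exact ⟨fun h i => (h i).2, fun h i => ⟨memLp_restrict _ _, h i⟩⟩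
  rw [e]
  refine isClosed_iInter fun i => isClosed_iInter fun φ => isClosed_iInter fun hφ =>
    isClosed_iInter fun hφc => isClosed_iInter fun _ => isClosed_eq ?_ ?_
  · exact (continuous_setIntegral_smul hΩ ((hφ.continuous_fderiv (by simp)).clm_apply
      continuous_const) (hasCompactSupport_pderiv hφc i)).comp (PiLp.continuous_apply 2 _ 0)
  · exact ((continuous_setIntegral_smul hΩ hφ.continuous hφc).comp
      (PiLp.continuous_apply 2 _ i.succ)).neg

instance completeSpace_formSpace (R : ℝ) : CompleteSpace (formSpace R) := by
  refine (IsClosed.isComplete ?_).completeSpace_coe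
  exact (isClosed_hasWeakGrad (measurableSet_disk R)).inter
    (isClosed_hasWeakGrad (measurableSet_exterior R))

theorem formSpace_mem_formDomain {R : ℝ} (p : formSpace R) : (p : L2Triple) 0 ∈ formDomain R :=
  ⟨⟨memLp_restrict _ _, _, p.2.1⟩, ⟨memLp_restrict _ _, _, p.2.2⟩⟩

theorem exists_formSpace_of_mem_formDomain {R : ℝ} {u : L2Plane} (hu : u ∈ formDomain R) :
    ∃ p : formSpace R, (p : L2Triple) 0 = u := by
  have hd := hasWeakGrad_weakGrad hu.1
  have he := hasWeakGrad_weakGrad hu.2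
  have hm : ∀ i, MemLp ((disk R).indicator (weakGrad (disk R) u i)
      + (exterior R).indicator (weakGrad (exterior R) u i)) 2 volume := fun i =>
    ((memLp_indicator_iff_restrict (measurableSet_disk R)).2 (hd i).1).add
      ((memLp_indicator_iff_restrict (measurableSet_exterior R)).2 (he i).1)
  refine ⟨⟨WithLp.toLp 2 (Fin.cons u fun i => (hm i).toLp _), ?_, ?_⟩, rfl⟩
  · refine hd.congr EventuallyEq.rfl fun i => ?_
    filter_upwards [ae_restrict_of_ae (hm i).coeFn_toLp, ae_restrict_mem (measurableSet_disk R)]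
      with x h1 (h2 : ‖x‖ < R)
    refine Eq.trans ?_ h1.symm
    have h3 : x ∉ exterior R := fun (h : R < ‖x‖) => lt_asymm h h2
    simp [Set.indicator_of_notMem h3, Set.indicator_of_mem (show x ∈ disk R from h2)]
  · refine he.congr EventuallyEq.rfl fun i => ?_
    filter_upwards [ae_restrict_of_ae (hm i).coeFn_toLp, ae_restrict_mem (measurableSet_exterior R)]
      with x h1 (h2 : R < ‖x‖)
    refine Eq.trans ?_ h1.symm
    have h3 : x ∉ disk R := fun (h : ‖x‖ < R) => lt_asymm h h2
    simp [Set.indicator_of_notMem h3, Set.indicator_of_mem (show x ∈ exterior R from h2)]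

theorem sobolevData_disk {R : ℝ} (hR : 0 < R) (p : formSpace R) :
    SobolevData (disk R) R ((p : L2Triple) 0) (fun i => (p : L2Triple) i.succ)
      (trace (disk R) (arcLength R) ((p : L2Triple) 0)) :=
  (isTraceDomain_disk hR).sobolevData_of_hasWeakGrad (memLp_restrict _ _) p.2.1

theorem sobolevData_exterior {R : ℝ} (hR : 0 < R) (p : formSpace R) :
    SobolevData (exterior R) R ((p : L2Triple) 0) (fun i => (p : L2Triple) i.succ)
      (trace (exterior R) (arcLength R) ((p : L2Triple) 0)) :=
  (isTraceDomain_exterior hR).sobolevData_of_hasWeakGrad (memLp_restrict _ _) p.2.2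

theorem memLp_jump {R : ℝ} (hR : 0 < R) (p : formSpace R) :
    MemLp (jump R ((p : L2Triple) 0)) 2 (arcLength R) :=
  (sobolevData_disk hR p).memLp_trace.sub (sobolevData_exterior hR p).memLp_trace

theorem jump_smul_add {R : ℝ} (hR : 0 < R) (c : ℂ) (p q : formSpace R) :
    jump R (((c • p + q : formSpace R) : L2Triple) 0) =ᵐ[arcLength R]
      fun x => c * jump R ((p : L2Triple) 0) x + jump R ((q : L2Triple) 0) x := by
  have hd := (sobolevData_disk hR (c • p + q)).trace_unique (isTraceDomain_disk hR)
    ((sobolevData_disk hR p).const_mul_add (sobolevData_disk hR q) c)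
    (coe_smul_add p q c 0 _).symm
  have he := (sobolevData_exterior hR (c • p + q)).trace_unique (isTraceDomain_exterior hR)
    ((sobolevData_exterior hR p).const_mul_add (sobolevData_exterior hR q) c)
    (coe_smul_add p q c 0 _).symm
  filter_upwards [hd, he] with x h1 h2
  rw [jump, h1, h2, jump, jump]
  ring

theorem normSq_coeFn (f : L2Plane) : normSq volume f = ‖f‖ ^ 2 := by
  rw [normSq_eq_norm_toLp (Lp.memLp f), Lp.toLp_coeFn]

theorem pairing_coeFn (f g : L2Plane) : pairing volume f g = inner ℂ g f := by
  rw [pairing_eq_inner (Lp.memLp f) (Lp.memLp g), Lp.toLp_coeFn, Lp.toLp_coeFn]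

theorem normSq_disk_add_exterior (R : ℝ) (f : L2Plane) :
    normSq (volume.restrict (disk R)) f + normSq (volume.restrict (exterior R)) f = ‖f‖ ^ 2 := by
  have h := pairing_disk_add_exterior R (Lp.memLp f) (Lp.memLp f)
  simp only [pairing_self, normSq_coeFn] at h
  exact_mod_cast h

/-- The part of the energy by which `u` fails to solve `∇u = X u` on `Ω`. -/
def riccatiDefect (Ω : Set Plane) (X : Fin 2 → Plane → ℝ) (p : L2Triple) : ℝ :=
  ∑ i, normSq (volume.restrict Ω) fun x => p (Fin.succ i) x - X i x * p 0 x

theorem riccatiDefect_nonneg (Ω : Set Plane) (X : Fin 2 → Plane → ℝ) (p : L2Triple) :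
    0 ≤ riccatiDefect Ω X p := Finset.sum_nonneg fun _ _ => normSq_nonneg _ _

/-- The energy as a sum of squares: the defects on both sides of the circle, the jump of the
traces, and the defect in the Cauchy–Schwarz inequality for the jump. -/
theorem energy_identity {κ R : ℝ} (hκ : 0 < κ) (hR : 0 < R) (p : formSpace R) :
    ‖(p : L2Triple) 1‖ ^ 2 + ‖(p : L2Triple) 2‖ ^ 2 + κ ^ 2 * ‖(p : L2Triple) 0‖ ^ 2 =
      riccatiDefect (disk R) (radialField (logDerivI κ)) p
      + riccatiDefect (exterior R) (radialField (logDerivK κ)) p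
      + κ * secular (κ * R) * (normSq (arcLength R) (jump R ((p : L2Triple) 0))
        + (logDerivI κ R * -logDerivK κ R)⁻¹ * normSq (arcLength R) fun x =>
          ((logDerivI κ R : ℝ) : ℂ) * trace (disk R) (arcLength R) ((p : L2Triple) 0) x
          + ((-logDerivK κ R : ℝ) : ℂ) * trace (exterior R) (arcLength R) ((p : L2Triple) 0) x) := by
  have sd := sobolevData_disk hR p
  have se := sobolevData_exterior hR p
  have gd := (isRiccatiField_logDerivI hκ hR).green_normSq (measurableSet_disk R) sd
  have ge := (isRiccatiField_logDerivK hκ hR).green_normSq (measurableSet_exterior R) se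
  have hj := normSq_sub_add (logDerivI_pos hκ hR) (neg_logDerivK_pos hκ hR) sd.memLp_trace
    se.memLp_trace
  change normSq (arcLength R) (jump R ((p : L2Triple) 0)) + _ = _ at hj
  rw [hj, ← mul_assoc, inv_logDeriv_add hκ hR, one_mul]
  have h0 := normSq_disk_add_exterior R ((p : L2Triple) 0)
  have h1 := normSq_disk_add_exterior R ((p : L2Triple) 1)
  have h2 := normSq_disk_add_exterior R ((p : L2Triple) 2)
  rw [← h0, ← h1, ← h2, riccatiDefect, riccatiDefect]
  simp only [Fin.sum_univ_two, Fin.succ_zero_eq_one, Fin.succ_one_eq_two] at gd ge ⊢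
  linarith

/-- The sharp trace inequality for the jump: the largest constant is `κ * secular (κ * R)`. -/
theorem jump_le {κ R : ℝ} (hκ : 0 < κ) (hR : 0 < R) (p : formSpace R) :
    κ * secular (κ * R) * normSq (arcLength R) (jump R ((p : L2Triple) 0)) ≤
      ‖(p : L2Triple) 1‖ ^ 2 + ‖(p : L2Triple) 2‖ ^ 2 + κ ^ 2 * ‖(p : L2Triple) 0‖ ^ 2 := by
  rw [energy_identity hκ hR, mul_add]
  have h1 := riccatiDefect_nonneg (disk R) (radialField (logDerivI κ)) p
  have h2 := riccatiDefect_nonneg (exterior R) (radialField (logDerivK κ)) p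
  have h3 : 0 < κ * secular (κ * R) := mul_pos hκ (secular_pos (mul_pos hκ hR))
  have h4 := inv_pos.2 (mul_pos (logDerivI_pos hκ hR) (neg_logDerivK_pos hκ hR))
  have h5 := mul_nonneg h3.le (mul_nonneg h4.le (normSq_nonneg (arcLength R) fun x =>
    ((logDerivI κ R : ℝ) : ℂ) * trace (disk R) (arcLength R) ((p : L2Triple) 0) x
    + ((-logDerivK κ R : ℝ) : ℂ) * trace (exterior R) (arcLength R) ((p : L2Triple) 0) x))
  linarith

theorem norm_sq_formSpace {R : ℝ} (p : formSpace R) :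
    ‖p‖ ^ 2 = ‖(p : L2Triple) 0‖ ^ 2 + ‖(p : L2Triple) 1‖ ^ 2 + ‖(p : L2Triple) 2‖ ^ 2 := by
  rw [Submodule.coe_norm, PiLp.norm_sq_eq_of_L2, Fin.sum_univ_three]

/-- The jump of the traces, as an element of `L²(C_R)`. -/
def jumpLp {R : ℝ} (hR : 0 < R) (p : formSpace R) : Lp ℂ 2 (arcLength R) :=
  (memLp_jump hR p).toLp (jump R ((p : L2Triple) 0))

theorem jumpLp_smul_add {R : ℝ} (hR : 0 < R) (c : ℂ) (p q : formSpace R) :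
    jumpLp hR (c • p + q) = c • jumpLp hR p + jumpLp hR q := by
  rw [jumpLp, jumpLp, jumpLp, ← MemLp.toLp_const_smul, ← MemLp.toLp_add]
  exact MemLp.toLp_congr _ _ (jump_smul_add hR c p q)

theorem norm_jumpLp_sq {R : ℝ} (hR : 0 < R) (p : formSpace R) :
    ‖jumpLp hR p‖ ^ 2 = normSq (arcLength R) (jump R ((p : L2Triple) 0)) :=
  (normSq_eq_norm_toLp (memLp_jump hR p)).symm

theorem norm_jumpLp_le {R : ℝ} (hR : 0 < R) (p : formSpace R) :
    ‖jumpLp hR p‖ ≤ Real.sqrt (secular R)⁻¹ * ‖p‖ := by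
  have hs : 0 < secular R := secular_pos hR
  have h := jump_le one_pos hR p
  rw [one_mul, one_mul, one_pow, one_mul, ← norm_jumpLp_sq hR] at h
  rw [← Real.sqrt_sq (norm_nonneg p), ← Real.sqrt_mul (inv_pos.2 hs).le]
  refine Real.le_sqrt_of_sq_le ?_
  rw [le_inv_mul_iff₀ hs, norm_sq_formSpace]
  refine h.trans (le_of_eq (by ring))

theorem jumpLp_zero {R : ℝ} (hR : 0 < R) : jumpLp hR (0 : formSpace R) = 0 := by
  have h := jumpLp_smul_add hR 1 0 0
  rw [one_smul, one_smul, add_zero] at h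
  exact left_eq_add.1 h

/-- The jump of the traces as a bounded operator `H¹(ℝ² ∖ C_R) → L²(C_R)`. -/
def jumpOp {R : ℝ} (hR : 0 < R) : formSpace R →L[ℂ] Lp ℂ 2 (arcLength R) :=
  LinearMap.mkContinuous
    { toFun := jumpLp hR
      map_add' := fun p q => by
        have h := jumpLp_smul_add hR 1 p q
        rwa [one_smul, one_smul] at h
      map_smul' := fun c p => by
        have h := jumpLp_smul_add hR c p 0
        rwa [add_zero, jumpLp_zero, add_zero] at h }
    (Real.sqrt (secular R)⁻¹) (norm_jumpLp_le hR)

theorem norm_jumpOp_sq {R : ℝ} (hR : 0 < R) (p : formSpace R) :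
    ‖jumpOp hR p‖ ^ 2 = normSq (arcLength R) (jump R ((p : L2Triple) 0)) :=
  norm_jumpLp_sq hR p

theorem dirichlet_eq_pairing {Ω : Set Plane} (hΩ : IsOpen Ω) {u v : Plane → ℂ} {G H : Fin 2 → Plane → ℂ}
    (hu : MemLp u 2 (volume.restrict Ω)) (hv : MemLp v 2 (volume.restrict Ω))
    (hG : HasWeakGrad Ω u G) (hH : HasWeakGrad Ω v H) :
    dirichlet Ω u v = ∑ i, pairing (volume.restrict Ω) (G i) (H i) := by
  refine Finset.sum_congr rfl fun i _ => integral_congr_ae ?_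
  filter_upwards [(hasWeakGrad_weakGrad ⟨hu, G, hG⟩).ae_eq hΩ hG EventuallyEq.rfl i,
    (hasWeakGrad_weakGrad ⟨hv, H, hH⟩).ae_eq hΩ hH EventuallyEq.rfl i] with x h1 h2
  rw [h1, h2]

theorem form_eq_inner {R : ℝ} (hR : 0 < R) (ω : ℝ) (p q : formSpace R) :
    form ω R ((p : L2Triple) 0) ((q : L2Triple) 0) =
      inner ℂ ((q : L2Triple) 1) ((p : L2Triple) 1) + inner ℂ ((q : L2Triple) 2) ((p : L2Triple) 2)
        - ω * inner ℂ (jumpOp hR q) (jumpOp hR p) := by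
  have hJ : ∫ x, jump R ((p : L2Triple) 0) x * starRingEnd ℂ (jump R ((q : L2Triple) 0) x)
      ∂arcLength R = inner ℂ (jumpOp hR q) (jumpOp hR p) :=
    pairing_eq_inner (memLp_jump hR p) (memLp_jump hR q)
  rw [form, hJ, dirichlet_eq_pairing (isOpen_disk R) (memLp_restrict _ _) (memLp_restrict _ _) p.2.1
    q.2.1, dirichlet_eq_pairing (isOpen_exterior R) (memLp_restrict _ _) (memLp_restrict _ _) p.2.2
    q.2.2, ← pairing_coeFn, ← pairing_coeFn,
    ← pairing_disk_add_exterior R (Lp.memLp ((p : L2Triple) 1)) (Lp.memLp ((q : L2Triple) 1)),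
    ← pairing_disk_add_exterior R (Lp.memLp ((p : L2Triple) 2)) (Lp.memLp ((q : L2Triple) 2))]
  simp only [Fin.sum_univ_two, Fin.succ_zero_eq_one, Fin.succ_one_eq_two]
  ring

/-- The defining identity of the operator, in terms of the Hilbert space of the form. -/
theorem opEq_iff {R : ℝ} (hR : 0 < R) (ω : ℝ) (p : formSpace R) (f : L2Plane) :
    OpEq ω R ((p : L2Triple) 0) f ↔ ∀ q : formSpace R,
      inner ℂ ((q : L2Triple) 1) ((p : L2Triple) 1) + inner ℂ ((q : L2Triple) 2) ((p : L2Triple) 2)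
        - ω * inner ℂ (jumpOp hR q) (jumpOp hR p) = inner ℂ ((q : L2Triple) 0) f := by
  constructor
  · intro h q
    rw [← form_eq_inner, h.2 _ (formSpace_mem_formDomain q), ← pairing_coeFn]
    rfl
  · refine fun h => ⟨formSpace_mem_formDomain p, fun v hv => ?_⟩
    obtain ⟨q, rfl⟩ := exists_formSpace_of_mem_formDomain hv
    rw [form_eq_inner hR, h q, ← pairing_coeFn]
    rfl

/-! ### The resolvent below the ground state energy -/

/-- The bounded operator that represents the form
`⟪P₁ p, P₁ q⟫ + ⟪P₂ p, P₂ q⟫ + s ⟪P₀ p, P₀ q⟫ - t ⟪J p, J q⟫`. -/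
def formOp {H K L : Type*} [NormedAddCommGroup H] [InnerProductSpace ℂ H] [CompleteSpace H]
    [NormedAddCommGroup K] [InnerProductSpace ℂ K] [CompleteSpace K]
    [NormedAddCommGroup L] [InnerProductSpace ℂ L] [CompleteSpace L]
    (P : Fin 3 → H →L[ℂ] K) (J : H →L[ℂ] L) (s t : ℝ) : H →L[ℂ] H :=
  (P 1).adjoint.comp (P 1) + (P 2).adjoint.comp (P 2) + (s : ℂ) • (P 0).adjoint.comp (P 0)
    - (t : ℂ) • J.adjoint.comp J

theorem inner_formOp {H K L : Type*} [NormedAddCommGroup H] [InnerProductSpace ℂ H]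
    [CompleteSpace H] [NormedAddCommGroup K] [InnerProductSpace ℂ K] [CompleteSpace K]
    [NormedAddCommGroup L] [InnerProductSpace ℂ L] [CompleteSpace L]
    (P : Fin 3 → H →L[ℂ] K) (J : H →L[ℂ] L) (s t : ℝ) (p q : H) :
    inner ℂ q (formOp P J s t p) = inner ℂ (P 1 q) (P 1 p) + inner ℂ (P 2 q) (P 2 p)
      + s * inner ℂ (P 0 q) (P 0 p) - t * inner ℂ (J q) (J p) := by
  simp only [formOp, sub_apply, add_apply, smul_apply, ContinuousLinearMap.comp_apply,
    inner_sub_right, inner_add_right, inner_smul_right, ContinuousLinearMap.adjoint_inner_right]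

/-- The **Lax–Milgram** resolvent of the operator associated with a coercive form. -/
theorem exists_resolvent {H K L : Type*} [NormedAddCommGroup H] [InnerProductSpace ℂ H]
    [CompleteSpace H] [NormedAddCommGroup K] [InnerProductSpace ℂ K] [CompleteSpace K]
    [NormedAddCommGroup L] [InnerProductSpace ℂ L] [CompleteSpace L]
    (P : Fin 3 → H →L[ℂ] K) (J : H →L[ℂ] L) (s t : ℝ) {c : ℝ} (hc : 0 < c)
    (h : ∀ p, c * ‖p‖ ^ 2 ≤
      ‖P 1 p‖ ^ 2 + ‖P 2 p‖ ^ 2 + s * ‖P 0 p‖ ^ 2 - t * ‖J p‖ ^ 2) :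
    ∃ T : K →L[ℂ] K, ∀ u f, (∃ p, P 0 p = u ∧ ∀ q,
      inner ℂ (P 1 q) (P 1 p) + inner ℂ (P 2 q) (P 2 p) - t * inner ℂ (J q) (J p)
        = inner ℂ (P 0 q) (((-s : ℝ) : ℂ) • u + f)) ↔ u = T f := by
  have hself : ∀ p, inner ℂ p (formOp P J s t p) =
      ((‖P 1 p‖ ^ 2 + ‖P 2 p‖ ^ 2 + s * ‖P 0 p‖ ^ 2 - t * ‖J p‖ ^ 2 : ℝ) : ℂ) := fun p => by
    rw [inner_formOp]
    simp only [inner_self_eq_norm_sq_to_K, Complex.coe_algebraMap]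
    push_cast
    ring
  have hunit : IsUnit (formOp P J s t) := by
    refine ContinuousLinearMap.isUnit_of_forall_le_norm_inner_map _ (c := ⟨c, hc.le⟩) hc fun p => ?_
    rw [norm_inner_symm, hself, Complex.norm_real, Real.norm_eq_abs, mul_comm]
    exact (h p).trans (le_abs_self _)
  have hiff : ∀ p f, (∀ q,
      inner ℂ (P 1 q) (P 1 p) + inner ℂ (P 2 q) (P 2 p) - t * inner ℂ (J q) (J p)
        = inner ℂ (P 0 q) (((-s : ℝ) : ℂ) • P 0 p + f)) ↔
      formOp P J s t p = (P 0).adjoint f := fun p f => by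
    rw [ext_iff_inner_left ℂ]
    refine forall_congr' fun q => ?_
    rw [inner_formOp, ContinuousLinearMap.adjoint_inner_right, inner_add_right, inner_smul_right]
    push_cast
    constructor <;> intro h <;> linear_combination h
  obtain ⟨B, hB⟩ := hunit.exists_right_inv
  obtain ⟨C, hC⟩ := hunit.exists_left_inv
  have h1 : ∀ p, formOp P J s t (B p) = p := fun p => congrArg (fun D : H →L[ℂ] H => D p) hB
  have h2 : ∀ p, C (formOp P J s t p) = p := fun p => congrArg (fun D : H →L[ℂ] H => D p) hC
  refine ⟨((P 0).comp B).comp (P 0).adjoint, fun u f => ⟨?_, ?_⟩⟩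
  · rintro ⟨p, rfl, hp⟩
    have h3 := (hiff p f).1 hp
    have h4 : B ((P 0).adjoint f) = p := by
      rw [← h2 (B ((P 0).adjoint f)), h1, ← h3, h2]
    rw [ContinuousLinearMap.comp_apply, ContinuousLinearMap.comp_apply, h4]
  · rintro rfl
    exact ⟨B ((P 0).adjoint f), rfl, (hiff _ f).2 (h1 _)⟩

/-- The components of the triple `(u, ∂₀u, ∂₁u)`. -/
def component (R : ℝ) (j : Fin 3) : formSpace R →L[ℂ] L2Plane :=
  (PiLp.proj 2 (fun _ : Fin 3 => L2Plane) j).comp (formSpace R).subtypeL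

/-- By `jump_le` the jump term is at most the fraction `ω / (κ F(κR)) < 1` of the energy. -/
theorem formSpace_coercive {ω κ R : ℝ} (hω : 0 < ω) (hκ : 0 < κ) (hR : 0 < R)
    (h : ω < κ * secular (κ * R)) (p : formSpace R) :
    (1 - ω / (κ * secular (κ * R))) * min 1 (κ ^ 2) * ‖p‖ ^ 2 ≤
      ‖(p : L2Triple) 1‖ ^ 2 + ‖(p : L2Triple) 2‖ ^ 2 + κ ^ 2 * ‖(p : L2Triple) 0‖ ^ 2
        - ω * ‖jumpOp hR p‖ ^ 2 := by
  have hS : 0 < κ * secular (κ * R) := hω.trans h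
  have hq : 0 < 1 - ω / (κ * secular (κ * R)) := by
    rw [sub_pos, div_lt_one hS]
    exact h
  have h1 := jump_le hκ hR p
  rw [← norm_jumpOp_sq hR] at h1
  have h2 : ω * ‖jumpOp hR p‖ ^ 2 ≤ ω / (κ * secular (κ * R)) * (‖(p : L2Triple) 1‖ ^ 2 +
      ‖(p : L2Triple) 2‖ ^ 2 + κ ^ 2 * ‖(p : L2Triple) 0‖ ^ 2) := by
    rw [div_mul_eq_mul_div, le_div_iff₀ hS, mul_assoc, mul_comm (‖_‖ ^ 2)]
    exact mul_le_mul_of_nonneg_left h1 hω.le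
  have h3 : min 1 (κ ^ 2) * ‖p‖ ^ 2 ≤ ‖(p : L2Triple) 1‖ ^ 2 +
      ‖(p : L2Triple) 2‖ ^ 2 + κ ^ 2 * ‖(p : L2Triple) 0‖ ^ 2 := by
    rw [norm_sq_formSpace]
    have e0 := mul_le_mul_of_nonneg_right (min_le_right 1 (κ ^ 2)) (sq_nonneg ‖(p : L2Triple) 0‖)
    have e1 := mul_le_mul_of_nonneg_right (min_le_left 1 (κ ^ 2)) (sq_nonneg ‖(p : L2Triple) 1‖)
    have e2 := mul_le_mul_of_nonneg_right (min_le_left 1 (κ ^ 2)) (sq_nonneg ‖(p : L2Triple) 2‖)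
    linarith
  have h4 := mul_le_mul_of_nonneg_left h3 hq.le
  linarith

/-- Below the ground state energy the operator has a bounded resolvent. -/
theorem inResolventSet_of_lt {ω κ R : ℝ} (hω : 0 < ω) (hκ : 0 < κ) (hR : 0 < R)
    (h : ω < κ * secular (κ * R)) : InResolventSet ω R ((-κ ^ 2 : ℝ) : ℂ) := by
  have hS : 0 < κ * secular (κ * R) := hω.trans h
  have hc : 0 < (1 - ω / (κ * secular (κ * R))) * min 1 (κ ^ 2) := by
    refine mul_pos ?_ (lt_min one_pos (by positivity))
    rw [sub_pos, div_lt_one hS]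
    exact h
  obtain ⟨T, hT⟩ := exists_resolvent (component R) (jumpOp hR) (κ ^ 2) ω hc
    (formSpace_coercive hω hκ hR h)
  refine ⟨T, fun u f => Iff.trans ⟨fun hu => ?_, ?_⟩ (hT u f)⟩
  · obtain ⟨p, hp⟩ := exists_formSpace_of_mem_formDomain hu.1
    rw [← hp] at hu
    refine ⟨p, hp, fun q => ?_⟩
    have := (opEq_iff hR ω p _).1 hu q
    rw [hp] at this
    exact this
  · rintro ⟨p, hp, hq⟩
    have := (opEq_iff hR ω p (((-κ ^ 2 : ℝ) : ℂ) • u + f)).2 hq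
    exact hp ▸ this

theorem mem_opSpectrum_of_isEigenfunction {ω R t : ℝ} {u : L2Plane} (h : IsEigenfunction ω R t u) :
    (t : ℂ) ∈ opSpectrum ω R := by
  rintro ⟨T, hT⟩
  have h1 := (hT u 0).1 (by rw [add_zero]; exact h.2)
  rw [map_zero] at h1
  exact h.1 h1

/-! ### Functions with vanishing weak gradient -/

theorem fderiv_eq_zero_of_pderiv {v : Plane → ℂ} {x : Plane} (h : ∀ i, pderiv i v x = 0) :
    fderiv ℝ v x = 0 := by
  refine ContinuousLinearMap.coe_injective
    ((EuclideanSpace.basisFun (Fin 2) ℝ).toBasis.ext fun i => ?_)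
  simpa [pderiv] using h i

/-- A function with vanishing weak gradient on `Ω` is constant almost everywhere, if `Ω` is the
increasing union of connected open sets `S n` at controlled distance from the boundary. -/
theorem ae_const_of_hasWeakGrad_zero {Ω : Set Plane} (hΩ : MeasurableSet Ω) {R : ℝ} (hR : 0 < R)
    {S : ℕ → Set Plane} (hSo : ∀ n, IsOpen (S n)) (hSc : ∀ n, IsPreconnected (S n))
    (hSb : ∀ n, ∀ x ∈ S n, Metric.closedBall x (smoothScale n * R) ⊆ Ω)
    (hS : ∀ x ∈ Ω, ∀ᶠ n in atTop, x ∈ S n) {v : Plane → ℂ}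
    (hv : HasWeakGrad Ω v fun _ => 0) (hl : LocallyIntegrable (Ω.indicator v)) :
    ∃ C, ∀ᵐ x, x ∈ Ω → v x = C := by
  have hrad : Tendsto (fun n => (smoothBump hR n).rOut) atTop (𝓝 0) := by
    simpa [smoothBump] using tendsto_smoothScale.mul_const R
  have hlim := ContDiffBump.ae_convolution_tendsto_right_of_locallyIntegrable (μ := volume)
    (φ := smoothBump hR) (K := 2) hrad
    (Eventually.of_forall fun n => by simp only [smoothBump]; linarith) hl
  have hconst : ∀ n, ∀ x ∈ S n, ∀ y ∈ S n, mollify (smoothBump hR n) (Ω.indicator v) x =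
      mollify (smoothBump hR n) (Ω.indicator v) y := fun n x hx y hy => by
    refine (hSo n).is_const_of_fderiv_eq_zero (hSc n) (𝕜 := ℝ)
      ((contDiff_mollify _ hl).differentiable (by simp)).differentiableOn (fun z hz => ?_) hx hy
    refine fderiv_eq_zero_of_pderiv fun i => ?_
    rw [pderiv_mollify_of_hasWeakGrad _ hΩ hv hl (hSb n z hz), mollify_apply]
    simp
  by_cases hex : ∃ x₀ ∈ Ω, Tendsto (fun n => mollify (smoothBump hR n) (Ω.indicator v) x₀) atTop
      (𝓝 (Ω.indicator v x₀))
  · obtain ⟨x₀, hx₀, h₀⟩ := hex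
    refine ⟨v x₀, ?_⟩
    filter_upwards [hlim] with x hx hxΩ
    rw [indicator_of_mem hx₀] at h₀
    rw [indicator_of_mem hxΩ] at hx
    refine tendsto_nhds_unique hx (h₀.congr' ?_)
    filter_upwards [hS x hxΩ, hS x₀ hx₀] with n h1 h2
    exact hconst n _ h2 _ h1
  · refine ⟨0, ?_⟩
    filter_upwards [hlim] with x hx hxΩ
    exact absurd ⟨x, hxΩ, hx⟩ hex

theorem isPreconnected_disk (R : ℝ) : IsPreconnected (disk R) := by
  have : disk R = Metric.ball 0 R := by ext x; simp [disk]
  rw [this]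
  exact (convex_ball _ _).isPreconnected

theorem isPreconnected_exterior (R : ℝ) : IsPreconnected (exterior R) := by
  have h : exterior R = (fun p : ℝ × ℝ => polarPoint p.1 p.2) '' (Ioi R ×ˢ univ) := by
    ext x
    constructor
    · intro (hx : R < ‖x‖)
      refine ⟨(‖x‖, Complex.arg ⟨x 0, x 1⟩), ⟨hx, mem_univ _⟩, ?_⟩
      have hn : ‖x‖ = ‖(⟨x 0, x 1⟩ : ℂ)‖ := by
        rw [EuclideanSpace.norm_eq, Fin.sum_univ_two, Complex.norm_eq_sqrt_sq_add_sq]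
        simp
      ext i
      fin_cases i
      · simp [polarPoint, hn]
      · simp [polarPoint, hn]
    · rintro ⟨p, ⟨hp, -⟩, rfl⟩
      change R < ‖polarPoint p.1 p.2‖
      rw [norm_polarPoint]
      exact lt_of_lt_of_le hp (le_abs_self _)
  rw [h]
  exact ((convex_Ioi R).isPreconnected.prod isPreconnected_univ).image _
    continuous_polarPoint.continuousOn

theorem ae_const_disk {R : ℝ} (hR : 0 < R) {v : Plane → ℂ}
    (hv : HasWeakGrad (disk R) v fun _ => 0) (hl : LocallyIntegrable ((disk R).indicator v)) :
    ∃ C, ∀ᵐ x, x ∈ disk R → v x = C := by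
  refine ae_const_of_hasWeakGrad_zero (measurableSet_disk R) hR
    (S := fun n => disk (R - smoothScale n * R)) (fun n => isOpen_disk _)
    (fun n => isPreconnected_disk _) (fun n x (hx : ‖x‖ < _) y hy => ?_) (fun x hx => ?_) hv hl
  · rw [Metric.mem_closedBall, dist_eq_norm] at hy
    have := norm_le_norm_add_norm_sub' y x
    change ‖y‖ < R
    linarith
  · have h : Tendsto (fun n => R - smoothScale n * R) atTop (𝓝 R) := by
      simpa using (tendsto_smoothScale.mul_const R).const_sub R
    exact h.eventually (lt_mem_nhds hx)

theorem ae_const_exterior {R : ℝ} (hR : 0 < R) {v : Plane → ℂ}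
    (hv : HasWeakGrad (exterior R) v fun _ => 0)
    (hl : LocallyIntegrable ((exterior R).indicator v)) :
    ∃ C, ∀ᵐ x, x ∈ exterior R → v x = C := by
  refine ae_const_of_hasWeakGrad_zero (measurableSet_exterior R) hR
    (S := fun n => exterior (R + smoothScale n * R)) (fun n => isOpen_exterior _)
    (fun n => isPreconnected_exterior _) (fun n x (hx : _ < ‖x‖) y hy => ?_) (fun x hx => ?_) hv hl
  · rw [Metric.mem_closedBall, dist_eq_norm, norm_sub_rev] at hy
    have := norm_sub_norm_le x y
    change R < ‖y‖
    linarith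
  · have h : Tendsto (fun n => R + smoothScale n * R) atTop (𝓝 R) := by
      simpa using (tendsto_smoothScale.mul_const R).const_add R
    exact h.eventually (gt_mem_nhds hx)

/-! ### Solutions of `∇u = X u` -/

theorem hasFDerivAt_ofReal_comp {w : Plane → ℝ} {L : Plane →L[ℝ] ℝ} {x : Plane}
    (h : HasFDerivAt w L x) : HasFDerivAt (fun y => (w y : ℂ)) (Complex.ofRealCLM.comp L) x :=
  Complex.ofRealCLM.hasFDerivAt.comp x h

/-- Integration by parts against a test function supported in the open set `Ω`. -/
theorem setIntegral_pderiv_smul {Ω : Set Plane} (hΩ : MeasurableSet Ω) {φ : Plane → ℝ}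
    (hφ : ContDiff ℝ (⊤ : ℕ∞) φ) (hφc : HasCompactSupport φ) (hφs : tsupport φ ⊆ Ω)
    {v H : Plane → ℂ} (i : Fin 2) (hv : Continuous v) (hd : ∀ x ∈ Ω, DifferentiableAt ℝ v x)
    (hH : ∀ x ∈ Ω, pderiv i v x = H x) (hi : IntegrableOn (fun x => φ x • H x) Ω) :
    ∫ x in Ω, pderiv i φ x • v x = -∫ x in Ω, φ x • H x := by
  have hz : ∀ x, x ∉ Ω → φ x = 0 := fun x hx => image_eq_zero_of_notMem_tsupport fun h => hx (hφs h)
  have hz' : ∀ x, x ∉ Ω → pderiv i φ x = 0 := fun x hx => by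
    have : x ∉ tsupport (fderiv ℝ φ) := fun h => hx (hφs (tsupport_fderiv_subset ℝ h))
    rw [pderiv, image_eq_zero_of_notMem_tsupport this]
    rfl
  have hdc : Continuous (pderiv i φ) :=
    (hφ.continuous_fderiv (by simp)).clm_apply continuous_const
  have e : ∀ x, φ x • fderiv ℝ v x (EuclideanSpace.single i 1) = Ω.indicator (fun x => φ x • H x) x :=
    fun x => by
      by_cases hx : x ∈ Ω
      · rw [indicator_of_mem hx, ← hH x hx]
        rfl
      · rw [indicator_of_notMem hx, hz x hx, zero_smul]
  have key := integral_smul_fderiv_eq_neg_fderiv_smul_of_integrable (μ := volume) (𝕜 := ℝ)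
    (f := φ) (g := v) (v := EuclideanSpace.single i (1 : ℝ))
    ((hdc.smul hv).integrable_of_hasCompactSupport (hasCompactSupport_pderiv hφc i).smul_right)
    (by simp only [e]; exact (integrable_indicator_iff hΩ).2 hi)
    ((hφ.continuous.smul hv).integrable_of_hasCompactSupport hφc.smul_right)
    (fun x _ => (hφ.differentiable (by simp)) x) (fun x hx => hd x (hφs hx))
  simp only [e] at key
  rw [integral_indicator hΩ] at key
  rw [key, neg_neg]
  exact setIntegral_eq_integral_of_forall_compl_eq_zero fun x hx => by rw [hz' x hx, zero_smul]

/-- A positive continuous function `w` with `∇w = X w` on `Ω`, square integrable over `Ω`, and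
equal to `b` on the circle of radius `R`. -/
structure IsProfile (Ω : Set Plane) (R b : ℝ) (X : Fin 2 → Plane → ℝ) (w : Plane → ℝ) : Prop where
  continuous : Continuous w
  pos : ∀ x, 0 < w x
  hasFDerivAt : ∀ x ∈ Ω, ∃ L : Plane →L[ℝ] ℝ, HasFDerivAt w L x ∧
    ∀ i, L (EuclideanSpace.single i 1) = X i x * w x
  memLp : MemLp w 2 (volume.restrict Ω)
  boundary : ∀ x, ‖x‖ = R → w x = b

/-- The multiples of a profile belong to `H¹(Ω)`, with the expected gradient and trace. -/
theorem IsProfile.sobolevData {Ω : Set Plane} {R b κ c : ℝ} {X : Fin 2 → Plane → ℝ} {w : Plane → ℝ}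
    (hw : IsProfile Ω R b X w) (hΩ : IsTraceDomain Ω R) (hR : 0 < R)
    (hX : IsRiccatiField Ω R κ c X) (C : ℂ) :
    SobolevData Ω R (fun x => C * w x) (fun i x => X i x * (C * w x)) (fun _ => C * b) := by
  have hm : MemLp (fun x => C * (w x : ℂ)) 2 (volume.restrict Ω) := hw.memLp.ofReal.const_mul C
  have hG : HasWeakGrad Ω (fun x => C * w x) (fun i x => X i x * (C * w x)) := by
    refine fun i => ⟨hX.memLp_mul hΩ.isOpen.measurableSet hm i, fun φ hφ hφc hφs => ?_⟩
    have hd : ∀ x ∈ Ω, ∃ L : Plane →L[ℝ] ℂ, HasFDerivAt (fun x => C * (w x : ℂ)) L x ∧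
        L (EuclideanSpace.single i 1) = X i x * (C * w x) := fun x hx => by
      obtain ⟨L, hL, hLi⟩ := hw.hasFDerivAt x hx
      refine ⟨_, (hasFDerivAt_ofReal_comp hL).const_mul C, ?_⟩
      simp [hLi i]
      ring
    refine setIntegral_pderiv_smul hΩ.isOpen.measurableSet hφ hφc hφs i
      (continuous_const.mul (Complex.continuous_ofReal.comp hw.continuous))
      (fun x hx => ?_) (fun x hx => ?_) ?_
    · obtain ⟨L, hL, -⟩ := hd x hx
      exact hL.differentiableAt
    · obtain ⟨L, hL, hLi⟩ := hd x hx
      rw [pderiv, hL.fderiv, hLi]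
    · exact memLp_one_iff_integrable.1 ((hX.memLp_mul hΩ.isOpen.measurableSet hm i).smul
        (hφ.continuous.memLp_of_hasCompactSupport (p := 2) hφc))
  obtain ⟨g, hg, hgv⟩ := hΩ.exists_trace hm hG
  have hgb : g =ᵐ[arcLength R] fun _ => C * b := by
    filter_upwards [hgv _ (continuous_const.mul (Complex.continuous_ofReal.comp hw.continuous))
      (ae_of_all _ fun x _ => rfl), ae_norm_eq_arcLength hR.le] with x h1 h2
    rw [h1]
    change C * (w x : ℂ) = _
    rw [hw.boundary x h2]
  obtain ⟨φ, hφ, hφu, hφG, hφg⟩ := hg.approx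
  exact ⟨hm, hG, hg.memLp_trace.ae_eq hgb, φ, hφ, hφu, hφG,
    hφg.congr_ae (fun _ => EventuallyEq.rfl) hgb⟩

/-- If `∇u = X u` on `Ω` and `w` is a positive solution of the same equation, then `u / w` has
vanishing gradient. -/
theorem IsProfile.hasWeakGrad_div {Ω : Set Plane} {R b κ c : ℝ} {X : Fin 2 → Plane → ℝ}
    {w : Plane → ℝ} (hw : IsProfile Ω R b X w) (hΩ : IsOpen Ω) (hX : IsRiccatiField Ω R κ c X)
    {u g : Plane → ℂ} {G : Fin 2 → Plane → ℂ} (hu : SobolevData Ω R u G g)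
    (hG : ∀ i, G i =ᵐ[volume.restrict Ω] fun x => X i x * u x) :
    HasWeakGrad Ω (fun x => (w x : ℂ)⁻¹ * u x) fun _ => 0 := by
  refine fun i => ⟨MemLp.zero, fun φ hφ hφc hφs => ?_⟩
  obtain ⟨ψ, hψ, hψu, hψG, -⟩ := hu.approx
  have hwc : Continuous fun x => (w x : ℂ)⁻¹ := (Complex.continuous_ofReal.comp hw.continuous).inv₀
    fun x => Complex.ofReal_ne_zero.2 (hw.pos x).ne'
  have hdc : Continuous (pderiv i φ) :=
    (hφ.continuous_fderiv (by simp)).clm_apply continuous_const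
  have mw : ∀ {χ : Plane → ℝ}, Continuous χ → HasCompactSupport χ →
      MemLp (fun x => (χ x : ℂ) * (w x : ℂ)⁻¹) 2 (volume.restrict Ω) := fun hχ hχc =>
    ((Complex.continuous_ofReal.comp hχ).mul hwc).memLp_of_hasCompactSupport
      ((hχc.comp_left Complex.ofReal_zero).mul_right)
  have mψ := fun n => memLp_of_continuous (hψ n).1.continuous (hψ n).2 (volume.restrict Ω)
  have mdψ := fun n => memLp_of_continuous (continuous_pderiv (contDiff_one_of_smooth (hψ n).1) i)
    (hasCompactSupport_pderiv (hψ n).2 i) (volume.restrict Ω)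
  have hlim : ∀ (χ : Plane → ℝ) (a : ℕ → Plane → ℂ) (z : Plane → ℂ), Continuous χ →
      HasCompactSupport χ → L2Tendsto (volume.restrict Ω) a z →
      (∀ n, MemLp (a n) 2 (volume.restrict Ω)) → MemLp z 2 (volume.restrict Ω) →
      Tendsto (fun n => ∫ x in Ω, χ x • ((w x : ℂ)⁻¹ * a n x)) atTop
        (𝓝 (∫ x in Ω, χ x • ((w x : ℂ)⁻¹ * z x))) := fun χ a z hχ hχc haz ha hz => by
    have e : ∀ y : Plane → ℂ, ∫ x in Ω, χ x • ((w x : ℂ)⁻¹ * y x) = pairing (volume.restrict Ω) y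
        (fun x => (χ x : ℂ) * (w x : ℂ)⁻¹) := fun y => by
      rw [pairing]
      congr 1
      funext x
      rw [Complex.real_smul, map_mul, map_inv₀, Complex.conj_ofReal, Complex.conj_ofReal]
      ring
    simp only [e]
    refine haz.pairing (a' := fun _ x => (χ x : ℂ) * (w x : ℂ)⁻¹) ?_ ha hz (fun _ => mw hχ hχc)
      (mw hχ hχc)
    simp [L2Tendsto]
  have hsub : L2Tendsto (volume.restrict Ω) (fun n x => pderiv i (ψ n) x - X i x * ψ n x)
      (fun x => G i x - X i x * u x) := by
    have hn : ∀ {z : Plane → ℂ}, MemLp z 2 (volume.restrict Ω) →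
        AEStronglyMeasurable (fun x => -((X i x : ℂ)) * z x) (volume.restrict Ω) := fun hz =>
      (hX.memLp_mul hΩ.measurableSet hz i).neg.aestronglyMeasurable.congr
        (ae_of_all _ fun x => by simp)
    refine ((hψG i).add (hX.l2Tendsto_mul hΩ.measurableSet hψu i)
      (fun n => (mdψ n).aestronglyMeasurable) (fun n => hn (mψ n))
      (hu.grad i).1.aestronglyMeasurable (hn hu.memLp)).congr_ae
      (fun n => ae_of_all _ fun x => ?_) (ae_of_all _ fun x => ?_) <;> simp only <;> ring
  have msub := fun n => (mdψ n).sub (hX.memLp_mul hΩ.measurableSet (mψ n) i)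
  have l1 := hlim (pderiv i φ) ψ u hdc (hasCompactSupport_pderiv hφc i) hψu mψ hu.memLp
  have l2 := hlim φ _ _ hφ.continuous hφc hsub msub
    ((hu.grad i).1.sub (hX.memLp_mul hΩ.measurableSet hu.memLp i))
  have e0 : ∫ x in Ω, φ x • ((w x : ℂ)⁻¹ * (G i x - X i x * u x)) = 0 := by
    rw [integral_eq_zero_of_ae]
    filter_upwards [hG i] with x hx
    simp [hx]
  rw [e0] at l2
  have e1 : -∫ x in Ω, φ x • (0 : ℂ) = -0 := by simp
  refine Eq.trans ?_ e1.symm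
  refine tendsto_nhds_unique l1 (l2.neg.congr fun n => ?_)
  have hdiv : ∀ x ∈ Ω, ∃ L : Plane →L[ℝ] ℂ, HasFDerivAt (fun x => (w x : ℂ)⁻¹ * ψ n x) L x ∧
      L (EuclideanSpace.single i 1) = (w x : ℂ)⁻¹ * (pderiv i (ψ n) x - X i x * ψ n x) :=
    fun x hx => by
      obtain ⟨L, hL, hLi⟩ := hw.hasFDerivAt x hx
      have hne : (w x : ℂ) ≠ 0 := Complex.ofReal_ne_zero.2 (hw.pos x).ne'
      have hψd := ((contDiff_one_of_smooth (hψ n).1).differentiable one_ne_zero x).hasFDerivAt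
      refine ⟨_, ((hasFDerivAt_inv hne).restrictScalars ℝ |>.comp x (hasFDerivAt_ofReal_comp hL)).mul hψd, ?_⟩
      simp [hLi i, pderiv]
      field_simp
      ring
  refine (setIntegral_pderiv_smul hΩ.measurableSet hφ hφc hφs i
    (hwc.mul (hψ n).1.continuous) (fun x hx => ?_) (fun x hx => ?_) ?_).symm
  · obtain ⟨L, hL, -⟩ := hdiv x hx
    exact hL.differentiableAt
  · obtain ⟨L, hL, hLi⟩ := hdiv x hx
    exact (congrArg (fun A : Plane →L[ℝ] ℂ => A (EuclideanSpace.single i 1)) hL.fderiv).trans hLi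
  · refine (memLp_one_iff_integrable.1 ((msub n).mul (mw hφ.continuous hφc))).congr ?_
    refine ae_of_all _ fun x => ?_
    simp only [Pi.mul_apply, Pi.sub_apply, Complex.real_smul]
    ring

/-- The solutions of `∇u = X u` are the multiples of `w`; `hconst` says that functions on `Ω` with
vanishing weak gradient are constant. -/
theorem IsProfile.exists_const_mul {Ω : Set Plane} {R b κ c : ℝ} {X : Fin 2 → Plane → ℝ}
    {w : Plane → ℝ} (hw : IsProfile Ω R b X w) (hΩ : IsOpen Ω) (hX : IsRiccatiField Ω R κ c X)
    (hconst : ∀ v : Plane → ℂ, HasWeakGrad Ω v (fun _ => 0) → LocallyIntegrable (Ω.indicator v) →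
      ∃ C, ∀ᵐ x, x ∈ Ω → v x = C)
    {u g : Plane → ℂ} {G : Fin 2 → Plane → ℂ} (hu : SobolevData Ω R u G g)
    (hG : ∀ i, G i =ᵐ[volume.restrict Ω] fun x => X i x * u x) :
    ∃ C : ℂ, u =ᵐ[volume.restrict Ω] fun x => C * w x := by
  have hl : LocallyIntegrable (Ω.indicator fun x => (w x : ℂ)⁻¹ * u x) := by
    have h1 : LocallyIntegrable (Ω.indicator u) :=
      memLp_locallyIntegrable ((memLp_indicator_iff_restrict hΩ.measurableSet).2 hu.memLp)
    have hwc : Continuous fun x => (w x : ℂ)⁻¹ :=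
      (Complex.continuous_ofReal.comp hw.continuous).inv₀
        fun x => Complex.ofReal_ne_zero.2 (hw.pos x).ne'
    have e : (Ω.indicator fun x => (w x : ℂ)⁻¹ * u x) = fun x => (w x : ℂ)⁻¹ * Ω.indicator u x := by
      funext x
      by_cases hx : x ∈ Ω <;> simp [hx]
    rw [e, ← locallyIntegrableOn_univ]
    exact (locallyIntegrableOn_univ.2 h1).continuousOn_mul hwc.continuousOn
      isOpen_univ.isLocallyClosed
  obtain ⟨C, hC⟩ := hconst _ (hw.hasWeakGrad_div hΩ hX hu hG) hl
  refine ⟨C, (ae_restrict_iff' hΩ.measurableSet).2 ?_⟩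
  filter_upwards [hC] with x hx hxΩ
  have hne : (w x : ℂ) ≠ 0 := Complex.ofReal_ne_zero.2 (hw.pos x).ne'
  rw [← hx hxΩ]
  field_simp

/-! ### The two radial solutions -/

theorem hasFDerivAt_radial {f : ℝ → ℝ} {f' : ℝ} {x : Plane} (hx : x ≠ 0)
    (hf : HasDerivAt f f' ‖x‖) : ∃ L : Plane →L[ℝ] ℝ, HasFDerivAt (fun y : Plane => f ‖y‖) L x ∧
      ∀ i, L (EuclideanSpace.single i 1) = f' * (x i / ‖x‖) := by
  have hn : ‖x‖ ≠ 0 := norm_ne_zero_iff.2 hx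
  have h1 := (hasStrictFDerivAt_norm_sq x).hasFDerivAt.sqrt (pow_ne_zero 2 hn)
  simp only [Real.sqrt_sq (norm_nonneg _)] at h1
  refine ⟨_, hf.comp_hasFDerivAt x h1, fun i => ?_⟩
  simp only [one_div, mul_inv, smul_apply, innerSL_apply_apply, EuclideanSpace.inner_single_right,
    nsmul_eq_mul, smul_eq_mul, conj_trivial, one_mul]
  field_simp
  simp

/-- A radial function with vanishing derivative at the origin is differentiable there. -/
theorem hasFDerivAt_radial_zero {f : ℝ → ℝ} (hf : HasDerivAt f 0 0) :
    HasFDerivAt (fun y : Plane => f ‖y‖) (0 : Plane →L[ℝ] ℝ) 0 := by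
  have h := hasDerivAt_iff_isLittleO_nhds_zero.1 hf
  have hn : Tendsto (fun y : Plane => ‖y‖) (𝓝 0) (𝓝 0) := by
    simpa using (continuous_norm (E := Plane)).tendsto 0
  refine hasFDerivAt_iff_isLittleO_nhds_zero.2 ?_
  refine ((h.comp_tendsto hn).congr_left fun y => ?_).trans_isBigO
    (Asymptotics.isBigO_refl _ _).norm_left
  simp

/-- The solution `K₁(kR) I₀(k|x|)` on the disk. -/
def innerProfile (k R : ℝ) (x : Plane) : ℝ := besselK 1 (k * R) * besselI 0 (k * ‖x‖)

/-- The solution `I₁(kR) K₀(k|x|)` on the exterior, extended by a constant to the disk. -/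
def outerProfile (k R : ℝ) (x : Plane) : ℝ := besselI 1 (k * R) * besselK 0 (k * max ‖x‖ R)

theorem isProfile_innerProfile {k R : ℝ} (hk : 0 < k) (hR : 0 < R) :
    IsProfile (disk R) R (besselK 1 (k * R) * besselI 0 (k * R)) (radialField (logDerivI k))
      (innerProfile k R) := by
  have hc : Continuous (innerProfile k R) :=
    continuous_const.mul (continuous_besselI_zero.comp (continuous_const.mul continuous_norm))
  have hK := besselK_one_pos (mul_pos hk hR)
  have hd : ∀ r, HasDerivAt (fun r => besselK 1 (k * R) * besselI 0 (k * r))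
      (besselK 1 (k * R) * (besselI 1 (k * r) * k)) r := fun r =>
    ((hasDerivAt_besselI_zero (k * r)).comp r
      (by simpa using (hasDerivAt_id r).const_mul k)).const_mul _
  refine ⟨hc, fun x => mul_pos hK (besselI_zero_pos _), fun x _ => ?_, ?_, fun x hx => ?_⟩
  · rcases eq_or_ne x 0 with rfl | hx
    · refine ⟨0, hasFDerivAt_radial_zero (f := fun r => besselK 1 (k * R) * besselI 0 (k * r)) ?_,
        fun i => by simp [radialField]⟩
      simpa [besselI_one_zero] using hd 0
    · obtain ⟨L, hL, hLi⟩ := hasFDerivAt_radial hx (hd ‖x‖)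
      refine ⟨L, hL, fun i => ?_⟩
      have h0 := (besselI_zero_pos (k * ‖x‖)).ne'
      rw [hLi, radialField, logDerivI, innerProfile]
      field_simp
  · have hfin : IsFiniteMeasure (volume.restrict (disk R)) := by
      have : disk R = Metric.ball 0 R := by ext x; simp [disk]
      refine ⟨?_⟩
      rw [Measure.restrict_apply_univ, this]
      exact measure_ball_lt_top
    obtain ⟨M, hM⟩ := (isCompact_closedBall (0 : Plane) R).exists_bound_of_continuousOn
      hc.continuousOn
    refine MemLp.of_bound hc.aestronglyMeasurable M ?_
    filter_upwards [ae_restrict_mem (measurableSet_disk R)] with x (hx : ‖x‖ < R)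
    exact hM x (by rw [mem_closedBall_zero_iff]; exact hx.le)
  · rw [innerProfile, hx]

theorem memLp_exp_neg_norm {k : ℝ} (hk : 0 < k) :
    MemLp (fun x : Plane => Real.exp (-(k * ‖x‖))) 2 volume := by
  have hc : Continuous fun x : Plane => Real.exp (-(k * ‖x‖)) := by fun_prop
  refine (memLp_two_iff_integrable_sq hc.aestronglyMeasurable).2 ?_
  refine (integrable_fun_norm_addHaar volume (f := fun r => Real.exp (-(k * r)) ^ 2)).2 ?_
  have h := integrableOn_rpow_mul_exp_neg_mul_rpow (p := 1) (s := 1) (b := 2 * k) (by norm_num)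
    one_pos (by positivity)
  refine h.congr_fun (fun r _ => ?_) measurableSet_Ioi
  simp only [Real.rpow_one, finrank_euclideanSpace_fin, Nat.add_one_sub_one, pow_one, smul_eq_mul,
    ← Real.exp_nat_mul]
  congr 2
  push_cast
  ring

theorem isProfile_outerProfile {k R : ℝ} (hk : 0 < k) (hR : 0 < R) :
    IsProfile (exterior R) R (besselI 1 (k * R) * besselK 0 (k * R)) (radialField (logDerivK k))
      (outerProfile k R) := by
  have hm : ∀ x : Plane, 0 < k * max ‖x‖ R := fun x => mul_pos hk (lt_max_of_lt_right hR)
  have hc : Continuous (outerProfile k R) := by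
    refine continuous_const.mul (continuous_iff_continuousAt.2 fun x => ?_)
    exact ContinuousAt.comp (f := fun x : Plane => k * max ‖x‖ R)
      (hasDerivAt_besselK_zero (hm x)).continuousAt
      (continuous_const.mul (continuous_norm.max continuous_const)).continuousAt
  have hI := besselI_pos (mul_pos hk hR) 1
  have hd : ∀ r, 0 < r → HasDerivAt (fun r => besselI 1 (k * R) * besselK 0 (k * r))
      (besselI 1 (k * R) * (-besselK 1 (k * r) * k)) r := fun r hr =>
    ((hasDerivAt_besselK_zero (mul_pos hk hr)).comp r
      (by simpa using (hasDerivAt_id r).const_mul k)).const_mul _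
  refine ⟨hc, fun x => mul_pos hI (besselK_zero_pos (hm x)), fun x (hx : R < ‖x‖) => ?_, ?_,
    fun x hx => ?_⟩
  · have hx0 : 0 < ‖x‖ := hR.trans hx
    obtain ⟨L, hL, hLi⟩ := hasFDerivAt_radial (norm_pos_iff.1 hx0) (hd ‖x‖ hx0)
    refine ⟨L, hL.congr_of_eventuallyEq ?_, fun i => ?_⟩
    · filter_upwards [(isOpen_exterior R).mem_nhds hx] with y (hy : R < ‖y‖)
      rw [outerProfile, max_eq_left hy.le]
    · have h0 := (besselK_zero_pos (mul_pos hk hx0)).ne'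
      rw [hLi, radialField, logDerivK, outerProfile, max_eq_left hx.le]
      field_simp
  · refine ((memLp_exp_neg_norm hk).restrict (exterior R)).of_le_mul
      (c := besselI 1 (k * R) * (Real.exp (k * R) * besselK 0 (k * R))) hc.aestronglyMeasurable ?_
    filter_upwards [ae_restrict_mem (measurableSet_exterior R)] with x (hx : R < ‖x‖)
    have hpos : 0 < outerProfile k R x := mul_pos hI (besselK_zero_pos (hm x))
    rw [Real.norm_of_nonneg hpos.le,
      Real.norm_of_nonneg (Real.exp_pos _).le, outerProfile, max_eq_left hx.le, mul_assoc]
    refine mul_le_mul_of_nonneg_left ?_ hI.le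
    have h := coshMoment_le_exp (mul_pos hk hR) (mul_le_mul_of_nonneg_left hx.le hk.le) 0
    rw [← besselK_zero_eq] at h
    refine h.trans (le_of_eq ?_)
    rw [neg_sub, sub_eq_add_neg, Real.exp_add]
    ring
  · rw [outerProfile, hx, max_self]

/-! ### The ground state -/

theorem memLp_groundState {k R : ℝ} (hk : 0 < k) (hR : 0 < R) :
    MemLp (fun x => (groundState k R x : ℂ)) 2 volume := by
  have h1 := (memLp_indicator_iff_restrict (measurableSet_disk R)).2
    (isProfile_innerProfile hk hR).memLp
  have h2 := (memLp_indicator_iff_restrict (measurableSet_exterior R)).2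
    (isProfile_outerProfile hk hR).memLp
  suffices h : MemLp (groundState k R) 2 volume from h.ofReal
  refine (h1.sub h2).ae_eq ?_
  filter_upwards [ae_mem_disk_or_exterior R] with x hx
  rcases hx with (hx : ‖x‖ < R) | (hx : R < ‖x‖)
  · have h : x ∉ exterior R := fun (h : R < ‖x‖) => lt_asymm h hx
    rw [Pi.sub_apply, indicator_of_mem (show x ∈ disk R from hx), indicator_of_notMem h,
      groundState, if_pos hx, sub_zero, innerProfile]
  · have h : x ∉ disk R := fun (h : ‖x‖ < R) => lt_asymm h hx
    rw [Pi.sub_apply, indicator_of_notMem h, indicator_of_mem (show x ∈ exterior R from hx),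
      groundState, if_neg hx.le.not_gt, zero_sub, outerProfile, max_eq_left hx.le]

theorem ae_eq_innerProfile {k R : ℝ} {C : ℂ} {u : Plane → ℂ}
    (hu : ∀ᵐ x, u x = C * (groundState k R x : ℂ)) :
    (fun x => C * (innerProfile k R x : ℂ)) =ᵐ[volume.restrict (disk R)] u := by
  filter_upwards [ae_restrict_of_ae hu, ae_restrict_mem (measurableSet_disk R)]
    with x h1 (h2 : ‖x‖ < R)
  rw [h1, groundState, if_pos h2, innerProfile]

theorem ae_eq_outerProfile {k R : ℝ} {C : ℂ} {u : Plane → ℂ}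
    (hu : ∀ᵐ x, u x = C * (groundState k R x : ℂ)) :
    (fun x => -C * (outerProfile k R x : ℂ)) =ᵐ[volume.restrict (exterior R)] u := by
  filter_upwards [ae_restrict_of_ae hu, ae_restrict_mem (measurableSet_exterior R)]
    with x h1 (h2 : R < ‖x‖)
  rw [h1, groundState, if_neg h2.le.not_gt, outerProfile, max_eq_left h2.le]
  push_cast
  ring

theorem ae_eq_groundState {k R : ℝ} {C : ℂ} {u : Plane → ℂ}
    (h1 : u =ᵐ[volume.restrict (disk R)] fun x => C * (innerProfile k R x : ℂ))
    (h2 : u =ᵐ[volume.restrict (exterior R)] fun x => -C * (outerProfile k R x : ℂ)) :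
    ∀ᵐ x, u x = C * (groundState k R x : ℂ) := by
  filter_upwards [ae_mem_disk_or_exterior R, (ae_restrict_iff' (measurableSet_disk R)).1 h1,
    (ae_restrict_iff' (measurableSet_exterior R)).1 h2] with x hx h1 h2
  rcases hx with (hx : ‖x‖ < R) | (hx : R < ‖x‖)
  · rw [h1 hx, groundState, if_pos hx, innerProfile]
  · rw [h2 hx, groundState, if_neg hx.le.not_gt, outerProfile, max_eq_left hx.le]
    push_cast
    ring

theorem mem_formDomain_of_groundState {k R : ℝ} (hk : 0 < k) (hR : 0 < R) {C : ℂ} {u : L2Plane}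
    (hu : ∀ᵐ x, u x = C * (groundState k R x : ℂ)) : u ∈ formDomain R := by
  have h1 := ((isProfile_innerProfile hk hR).sobolevData (isTraceDomain_disk hR) hR
    (isRiccatiField_logDerivI hk hR) C).congr (ae_eq_innerProfile hu)
  have h2 := ((isProfile_outerProfile hk hR).sobolevData (isTraceDomain_exterior hR) hR
    (isRiccatiField_logDerivK hk hR) (-C)).congr (ae_eq_outerProfile hu)
  exact ⟨⟨h1.memLp, _, h1.grad⟩, ⟨h2.memLp, _, h2.grad⟩⟩

/-- The radial derivatives on the circle of the two positive solutions agree up to sign. This fixes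
the ratio of the constants on the two sides. -/
theorem logDerivK_mul_boundary {k R : ℝ} (hk : 0 < k) (hR : 0 < R) :
    -logDerivK k R * (besselI 1 (k * R) * besselK 0 (k * R))
      = logDerivI k R * (besselK 1 (k * R) * besselI 0 (k * R)) := by
  have h2 := besselI_zero_pos (k * R)
  have h4 := besselK_zero_pos (mul_pos hk hR)
  rw [logDerivI, logDerivK]
  field_simp

/-- If `k` solves the secular equation, the normal derivative is `ω` times the jump. -/
theorem mul_jump_boundary {ω k R : ℝ} (hk : 0 < k) (hR : 0 < R) (h : k * secular (k * R) = ω) :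
    ω * (besselK 1 (k * R) * besselI 0 (k * R) + besselI 1 (k * R) * besselK 0 (k * R))
      = logDerivI k R * (besselK 1 (k * R) * besselI 0 (k * R)) := by
  have h2 := besselI_zero_pos (k * R)
  have hW := besselWronskian (mul_pos hk hR)
  have e : logDerivI k R * (besselK 1 (k * R) * besselI 0 (k * R))
      = k * (besselI 1 (k * R) * besselK 1 (k * R)) := by
    rw [logDerivI]
    field_simp
  rw [e, ← h, secular]
  linear_combination (k * besselI 1 (k * R) * besselK 1 (k * R)) * hW

/-- Green's identity when `∇u = X u` and the trace of `u` is the constant `a`. -/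
theorem IsRiccatiField.green_of_eq {Ω : Set Plane} {R κ c : ℝ} {X : Fin 2 → Plane → ℝ}
    (hX : IsRiccatiField Ω R κ c X) (hΩ : MeasurableSet Ω) {u v h : Plane → ℂ} {a : ℂ}
    {G H : Fin 2 → Plane → ℂ} (hu : SobolevData Ω R u G fun _ => a) (hv : SobolevData Ω R v H h)
    (hG : ∀ i, G i =ᵐ[volume.restrict Ω] fun x => X i x * u x) :
    ∑ i, pairing (volume.restrict Ω) (G i) (H i) + κ ^ 2 * pairing (volume.restrict Ω) u v
      = c * a * pairing (arcLength R) (fun _ => 1) h := by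
  have h0 : ∀ i, pairing (volume.restrict Ω) (fun x => G i x - X i x * u x)
      (fun x => H i x - X i x * v x) = 0 := fun i => by
    refine integral_eq_zero_of_ae ?_
    filter_upwards [hG i] with x hx
    simp [hx]
  have h1 : pairing (arcLength R) (fun _ => a) h = a * pairing (arcLength R) (fun _ => 1) h := by
    simp only [pairing, one_mul]
    exact integral_const_mul _ _
  rw [hX.green hΩ hu hv, Finset.sum_congr rfl fun i _ => h0 i, h1]
  simp [mul_assoc]

/-- The multiples of the radial function solve the eigenvalue equation. -/
theorem opEq_of_groundState {ω k R : ℝ} (hk : 0 < k) (hR : 0 < R) (h : k * secular (k * R) = ω)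
    {C : ℂ} {u : L2Plane} (hu : ∀ᵐ x, u x = C * (groundState k R x : ℂ)) :
    OpEq ω R u (((-k ^ 2 : ℝ) : ℂ) • u) := by
  obtain ⟨p, hp⟩ := exists_formSpace_of_mem_formDomain (mem_formDomain_of_groundState hk hR hu)
  have h1 := ((isProfile_innerProfile hk hR).sobolevData (isTraceDomain_disk hR) hR
    (isRiccatiField_logDerivI hk hR) C).congr (ae_eq_innerProfile hu)
  have h2 := ((isProfile_outerProfile hk hR).sobolevData (isTraceDomain_exterior hR) hR
    (isRiccatiField_logDerivK hk hR) (-C)).congr (ae_eq_outerProfile hu)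
  rw [← hp] at h1 h2 hu
  have t1 := (sobolevData_disk hR p).trace_unique (isTraceDomain_disk hR) h1 EventuallyEq.rfl
  have t2 := (sobolevData_exterior hR p).trace_unique (isTraceDomain_exterior hR) h2
    EventuallyEq.rfl
  have hmain := (opEq_iff hR ω p (((-k ^ 2 : ℝ) : ℂ) • u)).2 fun q => ?_
  · rw [hp] at hmain
    exact hmain
  have e1 := fun i => h1.grad.ae_eq (isOpen_disk R) p.2.1 EventuallyEq.rfl i
  have e2 := fun i => h2.grad.ae_eq (isOpen_exterior R) p.2.2 EventuallyEq.rfl i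
  have g1 := (isRiccatiField_logDerivI hk hR).green_of_eq (measurableSet_disk R)
    (h1.congr_grad p.2.1 e1) (sobolevData_disk hR q) fun i => by
      filter_upwards [e1 i, ae_eq_innerProfile hu] with x hx hx'
      rw [← hx, ← hx']
  have g2 := (isRiccatiField_logDerivK hk hR).green_of_eq (measurableSet_exterior R)
    (h2.congr_grad p.2.2 e2) (sobolevData_exterior hR q) fun i => by
      filter_upwards [e2 i, ae_eq_outerProfile hu] with x hx hx'
      rw [← hx, ← hx']
  set α := besselK 1 (k * R) * besselI 0 (k * R) with hα
  set β := besselI 1 (k * R) * besselK 0 (k * R) with hβ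
  set t₁ := trace (disk R) (arcLength R) ((q : L2Triple) 0)
  set t₂ := trace (exterior R) (arcLength R) ((q : L2Triple) 0)
  have hJ : inner ℂ (jumpOp hR q) (jumpOp hR p) = C * (α + β) *
      (pairing (arcLength R) (fun _ => 1) t₁ - pairing (arcLength R) (fun _ => 1) t₂) := by
    have hpair : inner ℂ (jumpOp hR q) (jumpOp hR p) = pairing (arcLength R)
        (jump R ((p : L2Triple) 0)) (jump R ((q : L2Triple) 0)) :=
      (pairing_eq_inner (memLp_jump hR p) (memLp_jump hR q)).symm
    have hone : MemLp (fun _ : Plane => (1 : ℂ)) 2 (arcLength R) := memLp_const _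
    rw [hpair, pairing, pairing, pairing, ← integral_sub
      (integrable_pairing hone (sobolevData_disk hR q).memLp_trace)
      (integrable_pairing hone (sobolevData_exterior hR q).memLp_trace), ← integral_const_mul]
    refine integral_congr_ae ?_
    filter_upwards [t1, t2] with x hx1 hx2
    rw [jump, jump, hx1, hx2, map_sub]
    ring
  have hβα := logDerivK_mul_boundary hk hR
  have hωα := mul_jump_boundary hk hR h
  rw [← hα, ← hβ] at hβα hωα
  have hβα' : ((-logDerivK k R : ℝ) : ℂ) * β = logDerivI k R * α := by exact_mod_cast hβα
  have hωα' : (ω : ℂ) * (α + β) = logDerivI k R * α := by exact_mod_cast hωα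
  rw [hJ, inner_smul_right, ← hp]
  simp only [← pairing_coeFn,
    ← fun j => pairing_disk_add_exterior R (Lp.memLp ((p : L2Triple) j))
      (Lp.memLp ((q : L2Triple) j))]
  simp only [Fin.sum_univ_two, Fin.succ_zero_eq_one, Fin.succ_one_eq_two] at g1 g2
  push_cast at hβα' g2 ⊢
  linear_combination g1 + g2 - C * pairing (arcLength R) (fun _ => 1) t₂ * hβα'
    - C * (pairing (arcLength R) (fun _ => 1) t₁ - pairing (arcLength R) (fun _ => 1) t₂) * hωα'

theorem arcLength_ne_zero {R : ℝ} (hR : 0 < R) : arcLength R ≠ 0 := fun h => by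
  have h1 := congrArg (fun μ : Measure Plane => μ univ) h
  have hm : Measurable fun θ : ℝ => (!₂[R * Real.cos θ, R * Real.sin θ] : Plane) :=
    (continuous_polarPoint_right R).measurable
  simp [arcLength, Measure.map_apply hm MeasurableSet.univ, hR.not_ge, Real.pi_pos.not_ge] at h1

/-- Every eigenfunction is a multiple of the radial function. -/
theorem eq_mul_groundState_of_opEq {ω k R : ℝ} (hk : 0 < k) (hR : 0 < R)
    (h : k * secular (k * R) = ω) {u : L2Plane} (hu : OpEq ω R u (((-k ^ 2 : ℝ) : ℂ) • u)) :
    ∃ C : ℂ, ∀ᵐ x, u x = C * (groundState k R x : ℂ) := by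
  obtain ⟨p, hp⟩ := exists_formSpace_of_mem_formDomain hu.1
  subst hp
  have hω : 0 < ω := h ▸ mul_pos hk (secular_pos (mul_pos hk hR))
  have hc := logDerivI_pos hk hR
  have hd := neg_logDerivK_pos hk hR
  have henergy : ‖(p : L2Triple) 1‖ ^ 2 + ‖(p : L2Triple) 2‖ ^ 2
      + k ^ 2 * ‖(p : L2Triple) 0‖ ^ 2 = ω * ‖jumpOp hR p‖ ^ 2 := by
    have h1 := (opEq_iff hR ω p _).1 hu p
    rw [inner_smul_right] at h1
    simp only [inner_self_eq_norm_sq_to_K, Complex.coe_algebraMap] at h1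
    have h2 : ‖(p : L2Triple) 1‖ ^ 2 + ‖(p : L2Triple) 2‖ ^ 2 - ω * ‖jumpOp hR p‖ ^ 2
        = -k ^ 2 * ‖(p : L2Triple) 0‖ ^ 2 := by exact_mod_cast h1
    linarith
  -- The jump term of the energy identity cancels, and the other three terms are nonnegative with
  -- vanishing sum.
  rw [energy_identity hk hR, h, norm_jumpOp_sq, mul_add, ← add_assoc, add_right_comm,
    add_eq_right] at henergy
  have n1 := riccatiDefect_nonneg (disk R) (radialField (logDerivI k)) p
  have n2 := riccatiDefect_nonneg (exterior R) (radialField (logDerivK k)) p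
  have n3 := mul_nonneg hω.le (mul_nonneg (inv_pos.2 (mul_pos hc hd)).le
    (normSq_nonneg (arcLength R) fun x =>
      ((logDerivI k R : ℝ) : ℂ) * trace (disk R) (arcLength R) ((p : L2Triple) 0) x
      + ((-logDerivK k R : ℝ) : ℂ) * trace (exterior R) (arcLength R) ((p : L2Triple) 0) x))
  have sd := sobolevData_disk hR p
  have se := sobolevData_exterior hR p
  have z : ∀ {Ω : Set Plane} {X : Fin 2 → Plane → ℝ}, riccatiDefect Ω X p = 0 →
      (∀ i, MemLp (fun x => (X i x : ℂ) * (p : L2Triple) 0 x) 2 (volume.restrict Ω)) →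
      ∀ i : Fin 2, (p : L2Triple) i.succ =ᵐ[volume.restrict Ω]
        fun x => X i x * (p : L2Triple) 0 x := fun hz hm i => by
    have h1 := (Finset.sum_eq_zero_iff_of_nonneg fun _ _ => normSq_nonneg _ _).1 hz i
      (Finset.mem_univ i)
    filter_upwards [ae_eq_zero_of_normSq ((memLp_restrict _ _).sub (hm i)) h1] with x hx
    exact sub_eq_zero.1 hx
  have hX₁ := isRiccatiField_logDerivI hk hR
  have hX₂ := isRiccatiField_logDerivK hk hR
  have z1 := z (by linarith) fun i => hX₁.memLp_mul (measurableSet_disk R) sd.memLp i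
  have z2 := z (by linarith) fun i => hX₂.memLp_mul (measurableSet_exterior R) se.memLp i
  -- The vanishing Riccati defects determine `u` on each side up to a constant.
  obtain ⟨C, hC⟩ := (isProfile_innerProfile hk hR).exists_const_mul (isOpen_disk R) hX₁
    (fun _ => ae_const_disk hR) sd z1
  obtain ⟨D, hD⟩ := (isProfile_outerProfile hk hR).exists_const_mul (isOpen_exterior R) hX₂
    (fun _ => ae_const_exterior hR) se z2
  have t1 := sd.trace_unique (isTraceDomain_disk hR)
    ((isProfile_innerProfile hk hR).sobolevData (isTraceDomain_disk hR) hR hX₁ C) hC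
  have t2 := se.trace_unique (isTraceDomain_exterior hR)
    ((isProfile_outerProfile hk hR).sobolevData (isTraceDomain_exterior hR) hR hX₂ D) hD
  have h0 : normSq (arcLength R) (fun x =>
      ((logDerivI k R : ℝ) : ℂ) * trace (disk R) (arcLength R) ((p : L2Triple) 0) x
      + ((-logDerivK k R : ℝ) : ℂ) * trace (exterior R) (arcLength R) ((p : L2Triple) 0) x) = 0 := by
    have h1 : ω * ((logDerivI k R * -logDerivK k R)⁻¹ * normSq (arcLength R) fun x =>
      ((logDerivI k R : ℝ) : ℂ) * trace (disk R) (arcLength R) ((p : L2Triple) 0) x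
      + ((-logDerivK k R : ℝ) : ℂ) * trace (exterior R) (arcLength R) ((p : L2Triple) 0) x) = 0 := by
      linarith
    exact (mul_eq_zero.1 ((mul_eq_zero.1 h1).resolve_left hω.ne')).resolve_left
      (inv_pos.2 (mul_pos hc hd)).ne'
  -- The vanishing Cauchy–Schwarz defect, at one point of the circle, relates the two constants.
  have : NeZero (arcLength R) := ⟨arcLength_ne_zero hR⟩
  obtain ⟨x, hx0, hx1, hx2⟩ := ((ae_eq_zero_of_normSq ((sd.memLp_trace.const_mul _).add
    (se.memLp_trace.const_mul _)) h0).and (t1.and t2)).exists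
  have hx3 : ((logDerivI k R : ℝ) : ℂ) * trace (disk R) (arcLength R) ((p : L2Triple) 0) x
      + ((-logDerivK k R : ℝ) : ℂ) * trace (exterior R) (arcLength R) ((p : L2Triple) 0) x = 0 := hx0
  rw [hx1, hx2] at hx3
  have hβα : ((-logDerivK k R : ℝ) : ℂ) * ((besselI 1 (k * R) * besselK 0 (k * R) : ℝ) : ℂ)
      = logDerivI k R * ((besselK 1 (k * R) * besselI 0 (k * R) : ℝ) : ℂ) := by
    exact_mod_cast logDerivK_mul_boundary hk hR
  have hne : (logDerivI k R : ℂ) * ((besselK 1 (k * R) * besselI 0 (k * R) : ℝ) : ℂ) ≠ 0 := by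
    have := besselK_one_pos (mul_pos hk hR)
    have := besselI_zero_pos (k * R)
    exact_mod_cast (by positivity : logDerivI k R * (besselK 1 (k * R) * besselI 0 (k * R)) ≠ 0)
  have hDC : D = -C := by
    have h1 : (logDerivI k R : ℂ) * ((besselK 1 (k * R) * besselI 0 (k * R) : ℝ) : ℂ) * (C + D) = 0 := by
      linear_combination hx3 - D * hβα
    linear_combination (mul_eq_zero.1 h1).resolve_left hne
  rw [hDC] at hD
  exact ⟨C, ae_eq_groundState hC hD⟩

theorem ne_zero_of_groundState {k R : ℝ} (hk : 0 < k) (hR : 0 < R) {C : ℂ} (hC : C ≠ 0)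
    {u : L2Plane} (hu : ∀ᵐ x, u x = C * (groundState k R x : ℂ)) : u ≠ 0 := fun h0 => by
  have hne : volume.restrict (disk R) ≠ 0 := fun h => by
    rw [Measure.restrict_eq_zero] at h
    exact (((isOpen_disk R).measure_pos volume ⟨0, by simpa [disk] using hR⟩).ne') h
  have : NeZero (volume.restrict (disk R)) := ⟨hne⟩
  rw [h0] at hu
  obtain ⟨x, hx1, hx2⟩ := ((ae_eq_innerProfile hu).and
    (ae_restrict_of_ae (Lp.coeFn_zero ℂ 2 volume))).exists
  rw [hx2, Pi.zero_apply] at hx1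
  rcases mul_eq_zero.1 hx1 with h | h
  · exact hC h
  · exact ((isProfile_innerProfile hk hR).pos x).ne' (Complex.ofReal_eq_zero.1 h)

theorem isEigenfunction_iff {ω k R : ℝ} (hk : 0 < k) (hR : 0 < R) (h : k * secular (k * R) = ω)
    (u : L2Plane) : IsEigenfunction ω R (-k ^ 2) u ↔
      ∃ C : ℂ, C ≠ 0 ∧ ∀ᵐ x, u x = C * (groundState k R x : ℂ) := by
  constructor
  · rintro ⟨h0, hu⟩
    obtain ⟨C, hC⟩ := eq_mul_groundState_of_opEq hk hR h hu
    refine ⟨C, ?_, hC⟩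
    rintro rfl
    refine h0 ((Lp.eq_zero_iff_ae_eq_zero).2 ?_)
    filter_upwards [hC] with x hx
    simp [hx]
  · rintro ⟨C, hC, hu⟩
    exact ⟨ne_zero_of_groundState hk hR hC hu, opEq_of_groundState hk hR h hu⟩

theorem exists_isEigenfunction {ω k R : ℝ} (hk : 0 < k) (hR : 0 < R)
    (h : k * secular (k * R) = ω) : ∃ u, IsEigenfunction ω R (-k ^ 2) u := by
  refine ⟨(memLp_groundState hk hR).toLp _, (isEigenfunction_iff hk hR h _).2 ⟨1, one_ne_zero, ?_⟩⟩
  filter_upwards [(memLp_groundState hk hR).coeFn_toLp] with x hx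
  rw [hx, one_mul]

/-- The eigenvalue `-k²` is in the spectrum. A real `t < -k²` is `-κ²` with `κ > k`, hence
`κ F(κR) > ω`, and is in the resolvent set. -/
theorem isLeast_opSpectrum {ω R : ℝ} (hω : 0 < ω) (hR : 0 < R) :
    IsLeast {t : ℝ | (t : ℂ) ∈ opSpectrum ω R} (-secularRoot ω R ^ 2) := by
  have hk := secularRoot_pos hω hR
  refine ⟨?_, fun t ht => ?_⟩
  · obtain ⟨u, hu⟩ := exists_isEigenfunction hk hR (mul_secular_secularRoot hω hR)
    exact mem_opSpectrum_of_isEigenfunction hu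
  · by_contra! hlt
    have h1 : secularRoot ω R < √(-t) := Real.lt_sqrt_of_sq_lt (by linarith)
    have h2 : 0 < √(-t) := hk.trans h1
    have h3 := inResolventSet_of_lt hω h2 hR ((lt_mul_secular_iff hω hR h2).2 h1)
    rw [Real.sq_sqrt (by nlinarith), neg_neg] at h3
    exact ht h3

theorem lambda1_eq {ω R : ℝ} (hω : 0 < ω) (hR : 0 < R) :
    lambda1 ω R = -secularRoot ω R ^ 2 := (isLeast_opSpectrum hω hR).csInf_eq

end DeltaPrime

end

theorem proposition3p1 (ω : ℝ) (hω : 0 < ω) :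
    (∀ R : ℝ, 0 < R →
      -- the spectral threshold is attained, and is the lowest eigenvalue
      IsLeast {t : ℝ | (t : ℂ) ∈ DeltaPrime.opSpectrum ω R} (DeltaPrime.lambda1 ω R) ∧
      IsLeast {t : ℝ | ∃ u, DeltaPrime.IsEigenfunction ω R t u} (DeltaPrime.lambda1 ω R) ∧
      -- it is negative, `λ₁ = -k²`
      ∃ k : ℝ, 0 < k ∧ DeltaPrime.lambda1 ω R = -k ^ 2 ∧
        -- `k` is the unique positive solution of the secular equation
        (∀ x : ℝ, 0 < x →
          (x ^ 2 * R * DeltaPrime.besselI 1 (x * R) * DeltaPrime.besselK 1 (x * R) = ω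
            ↔ x = k)) ∧
        -- the ground states are exactly the nonzero multiples of the explicit radial function
        (∀ u : DeltaPrime.L2Plane,
          DeltaPrime.IsEigenfunction ω R (DeltaPrime.lambda1 ω R) u ↔
            ∃ c : ℂ, c ≠ 0 ∧
              ∀ᵐ x : DeltaPrime.Plane, u x = c * (DeltaPrime.groundState k R x : ℂ))) ∧
    ContinuousOn (fun R : ℝ => DeltaPrime.lambda1 ω R) (Ioi 0) ∧
    StrictMonoOn (fun R : ℝ => DeltaPrime.lambda1 ω R) (Ioi 0) ∧
    Tendsto (fun R : ℝ => DeltaPrime.lambda1 ω R) (𝓝[>] 0) atBot ∧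
    Tendsto (fun R : ℝ => DeltaPrime.lambda1 ω R) atTop (𝓝 (-4 * ω ^ 2)) := by
  have hroot : ∀ R ∈ Ioi (0 : ℝ),
      DeltaPrime.lambda1 ω R = -DeltaPrime.secularRoot ω R ^ 2 := fun R hR =>
    DeltaPrime.lambda1_eq hω hR
  refine ⟨fun R hR => ?_, ?_, fun R hR S hS hRS => ?_, ?_, ?_⟩
  · have hk := DeltaPrime.secularRoot_pos hω hR
    have hsec := DeltaPrime.mul_secular_secularRoot hω hR
    rw [hroot R hR]
    refine ⟨DeltaPrime.isLeast_opSpectrum hω hR, ⟨DeltaPrime.exists_isEigenfunction hk hR hsec,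
      fun t ⟨u, hu⟩ => (DeltaPrime.isLeast_opSpectrum hω hR).2
        (DeltaPrime.mem_opSpectrum_of_isEigenfunction hu)⟩,
      DeltaPrime.secularRoot ω R, hk, rfl, fun x hx => ?_,
      DeltaPrime.isEigenfunction_iff hk hR hsec⟩
    rw [← DeltaPrime.mul_secular_eq_iff hω hR hx, DeltaPrime.secular]
    ring_nf
  · exact ((DeltaPrime.continuousOn_secularRoot hω).pow 2).neg.congr hroot
  · change DeltaPrime.lambda1 ω R < DeltaPrime.lambda1 ω S
    rw [hroot R hR, hroot S hS, neg_lt_neg_iff]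
    exact pow_lt_pow_left₀ (DeltaPrime.strictAntiOn_secularRoot hω hR hS hRS)
      (DeltaPrime.secularRoot_pos hω hS).le two_ne_zero
  · have h := tendsto_neg_atTop_atBot.comp
      ((tendsto_pow_atTop two_ne_zero).comp (DeltaPrime.tendsto_secularRoot_zero hω))
    exact h.congr' (eventually_nhdsWithin_of_forall fun R hR => (hroot R hR).symm)
  · have h := ((DeltaPrime.tendsto_secularRoot_atTop hω).pow 2).neg
    rw [show -(2 * ω) ^ 2 = -4 * ω ^ 2 by ring] at h
    exact h.congr' ((eventually_gt_atTop 0).mono fun R hR => (hroot R hR).symm)
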